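/- For $\theta\in\mathcal D:=\{\theta\in\mathbb C:\ |\cos\theta|<1\}$ let $T_\theta$ be the integral operator on $L^2(\mathbb R)$ with kernel $$T_\theta(t,s)=\frac{1}{2\pi\sqrt{\sin^2\theta}}\;\frac{1}{\dfrac{t^2-2\cos(\theta)\,ts+s^2}{2\sin^2\theta}+1},$$ where $\sqrt{\cdot}$ is the principal square root (on $\mathcal D$ one has $\operatorname{Re}\sin^2\theta>0$, and $\sqrt{\sin^2\theta}=|\sin\theta|$ for real $\theta$). Let $\Pi\varphi(s)=\varphi(-s)$ be the parity operator and $T_\theta^\pm:=\frac{1\pm\Pi}{2}T_\theta$, regarded as an operator in the space $\operatorname{Ran}\frac{1\pm\Pi}{2}$ of even, respectively odd, functions. Then $T_\theta$ is a well-defined bounded operator for every $\theta\in\mathcal D$, and: (i) $\theta\mapsto T_\theta$ is a selfadjoint analytic family on $\mathcal D$ with values in the ideal of trace class operators; that is, $\mathcal D$ is open and invariant under complex conjugation, every $T_\theta$ with $\theta\in\mathcal D$ is trace class, $\theta\mapsto T_\theta$ is complex differentiable on $\mathcal D$ with respect to the trace norm $\|A\|_1=\operatorname{tr}|A|$, and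 $T_{\bar\theta}=T_\theta^*$ for $\theta\in\mathcal D$. (ii) For every $\theta\in(0,\pi)$ the eigenvalues of $T_\theta^+$, repeated according to multiplicity and with eigenvectors forming an orthonormal basis of the even functions, can be labelled in descending order $E_1^+(\theta)\ge E_2^+(\theta)\ge\cdots$. With this labelling each function $\theta\mapsto E_n^+(\theta)$ is continuous on $(0,\pi)$, strictly decreasing on $(0,\frac\pi2]$ and strictly increasing on $[\frac\pi2,\pi)$. For every $\theta\in(0,\pi)$ the eigenvalues of $T_\theta^-$, repeated according to multiplicity and with eigenvectors forming an orthonormal basis of the odd functions, can be labelled as a sequence $E_1^-(\theta),E_2^-(\theta),\dots$ in descending order for $\theta\in(0,\frac\pi2)$ and in ascending order for $\theta\in(\frac\pi2,\pi)$ (at $\theta=\frac\pi2$ one has $T^-_\theta=0$, so all are $0$). With this labelling each function $\theta\mapsto E_n^-(\theta)$ is continuous and strictly decreasing on $(0,\pi)$. -/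

import Mathlib

open MeasureTheory Filter Topology
open scoped ENNReal ComplexConjugate InnerProductSpace

noncomputable section

/-! ### Trace norm and trace-class operators on a complex Hilbert space -/

section TraceClass

variable {H : Type*} [NormedAddCommGroup H] [InnerProductSpace ℂ H] [CompleteSpace H]

/-- The trace norm `‖A‖₁ = tr |A| = ∑ᵢ ⟨bᵢ, |A| bᵢ⟩ ∈ [0, ∞]`, where `|A| = (A* A)^{1/2}` and
`b` is an orthonormal basis of `H` (the value does not depend on which one). -/
def traceNorm (A : H →L[ℂ] H) : ℝ≥0∞ :=
  ∑' i, ENNReal.ofReal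
    (RCLike.re ⟪(exists_hilbertBasis ℂ H).choose_spec.choose i,
      CFC.abs A ((exists_hilbertBasis ℂ H).choose_spec.choose i)⟫_ℂ)

/-- `A` is trace class: `tr |A| < ∞`. -/
def IsTraceClass (A : H →L[ℂ] H) : Prop := traceNorm A < ∞

/-- `F` takes trace-class values on the set `D` and is analytic there as a map into the Banach
space of trace-class operators: at each point of `D` it has a trace-class complex derivative, the
difference quotients converging in trace norm. (Used for open `D`.) -/
def IsTraceClassAnalyticOn (F : ℂ → H →L[ℂ] H) (D : Set ℂ) : Prop :=
  ∀ z ∈ D, IsTraceClass (F z) ∧ ∃ F' : H →L[ℂ] H, IsTraceClass F' ∧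
    Tendsto (fun w : ℂ => traceNorm ((w - z)⁻¹ • (F w - F z) - F')) (𝓝[≠] z) (𝓝 0)

/-- `F` is a selfadjoint analytic family on `D` with values in the trace-class operators: `D` is
open and symmetric about the real axis, `F` is analytic on `D` in trace norm, and
`F(conj z) = F(z)*` for `z ∈ D`. -/
def IsSelfAdjointTraceClassAnalyticFamily (F : ℂ → H →L[ℂ] H) (D : Set ℂ) : Prop :=
  IsOpen D ∧ (∀ z ∈ D, conj z ∈ D) ∧ IsTraceClassAnalyticOn F D ∧
    ∀ z ∈ D, F (conj z) = ContinuousLinearMap.adjoint (F z)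

/-- `E 0, E 1, …` lists the eigenvalues, repeated according to multiplicity, of the operator `A`
in its invariant subspace `V`: there is an orthonormal basis `e 0, e 1, …` of `V` with
`A (e n) = E n • e n`. -/
def IsEigenvalueSequence (A : H →L[ℂ] H) (V : Submodule ℂ H) (E : ℕ → ℝ) : Prop :=
  ∃ e : ℕ → H, Orthonormal ℂ e ∧
    (Submodule.span ℂ (Set.range e)).topologicalClosure = V ∧
    ∀ n, A (e n) = (E n : ℂ) • e n

end TraceClass

/-! ### Integral operators and parity on `L²(ℝ)` -/

/-- The complex Hilbert space `L²(ℝ)`. -/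
abbrev L2R : Type := Lp ℂ 2 (volume : Measure ℝ)

/-- `A` is the integral operator `(A f)(t) = ∫ K(t,s) f(s) ds` on `L²(ℝ)`. -/
def HasKernel (A : L2R →L[ℂ] L2R) (K : ℝ → ℝ → ℂ) : Prop :=
  ∀ f : L2R, (∀ᵐ t : ℝ, Integrable (fun s : ℝ => K t s * f s)) ∧
    A f =ᵐ[volume] fun t : ℝ => ∫ s : ℝ, K t s * f s

theorem HasKernel.unique {A B : L2R →L[ℂ] L2R} {K : ℝ → ℝ → ℂ}
    (hA : HasKernel A K) (hB : HasKernel B K) : A = B := by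
  ext1 f
  exact Lp.ext ((hA f).2.trans (hB f).2.symm)

open Classical in
/-- The bounded integral operator with kernel `K` (and `0` if `K` defines no bounded operator). -/
def integralOperator (K : ℝ → ℝ → ℂ) : L2R →L[ℂ] L2R :=
  if h : ∃ A : L2R →L[ℂ] L2R, HasKernel A K then h.choose else 0

/-- The parity operator `(Π f)(s) = f(-s)`. -/
def parityOp : L2R →L[ℂ] L2R :=
  (Lp.compMeasurePreservingₗᵢ ℂ (fun s : ℝ => -s)
    (Measure.measurePreserving_neg (volume : Measure ℝ))).toContinuousLinearMap

/-- `(1 + Π) / 2`, the projection onto the even functions. -/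
def evenProj : L2R →L[ℂ] L2R := (1 / 2 : ℂ) • (ContinuousLinearMap.id ℂ L2R + parityOp)

/-- `(1 - Π) / 2`, the projection onto the odd functions. -/
def oddProj : L2R →L[ℂ] L2R := (1 / 2 : ℂ) • (ContinuousLinearMap.id ℂ L2R - parityOp)

/-! ### The operators `T_θ` -/

/-- The domain `{θ ∈ ℂ : |cos θ| < 1}`. -/
def thetaDomain : Set ℂ := {θ : ℂ | ‖Complex.cos θ‖ < 1}

/-- The kernel of `T_θ`. On `thetaDomain` the real part of `sin² θ` is positive, so the principal
square root of `sin² θ` is analytic there; it equals `|sin θ|` for real `θ`. -/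
def thetaKernel (θ : ℂ) (t s : ℝ) : ℂ :=
  1 / (2 * (Real.pi : ℂ) * (Complex.sin θ ^ 2) ^ (1 / 2 : ℂ)) *
    (1 / (((t : ℂ) ^ 2 - 2 * Complex.cos θ * t * s + (s : ℂ) ^ 2) / (2 * Complex.sin θ ^ 2) + 1))

/-- For real `θ` the kernel is the usual one, with `|sin θ|`. -/
theorem thetaKernel_ofReal (θ t s : ℝ) :
    thetaKernel (θ : ℂ) t s =
      ((1 / (2 * Real.pi * |Real.sin θ|) *
        (1 / ((t ^ 2 - 2 * Real.cos θ * t * s + s ^ 2) / (2 * Real.sin θ ^ 2) + 1)) : ℝ) : ℂ) := by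
  have h : (Complex.sin (θ : ℂ) ^ 2) ^ (1 / 2 : ℂ) = ((|Real.sin θ| : ℝ) : ℂ) := by
    rw [← Real.sqrt_sq_eq_abs, Real.sqrt_eq_rpow, Complex.ofReal_cpow (sq_nonneg _)]
    push_cast
    rfl
  unfold thetaKernel
  rw [h]
  push_cast
  rfl

/-- The operator `T_θ` on `L²(ℝ)`. -/
def thetaOp (θ : ℂ) : L2R →L[ℂ] L2R := integralOperator (thetaKernel θ)

/-- `T_θ⁺ = (1 + Π)/2 T_θ`. -/
def thetaOpPlus (θ : ℂ) : L2R →L[ℂ] L2R := evenProj ∘L thetaOp θ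

/-- `T_θ⁻ = (1 - Π)/2 T_θ`. -/
def thetaOpMinus (θ : ℂ) : L2R →L[ℂ] L2R := oddProj ∘L thetaOp θ

/-- For each `θ ∈ (0, π)`, `E 0 θ ≥ E 1 θ ≥ …` are the eigenvalues of `T_θ⁺` (in the space of even
functions), with multiplicity. -/
def IsPlusLabelling (E : ℕ → ℝ → ℝ) : Prop :=
  ∀ θ ∈ Set.Ioo 0 Real.pi,
    IsEigenvalueSequence (thetaOpPlus θ) evenProj.range (fun n => E n θ) ∧
      Antitone (fun n => E n θ)

/-- For each `θ ∈ (0, π)`, `E 0 θ, E 1 θ, …` are the eigenvalues of `T_θ⁻` (in the space of odd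
functions), with multiplicity, in descending order if `θ < π/2` and in ascending order if
`θ > π/2`. -/
def IsMinusLabelling (E : ℕ → ℝ → ℝ) : Prop :=
  (∀ θ ∈ Set.Ioo 0 Real.pi,
    IsEigenvalueSequence (thetaOpMinus θ) oddProj.range (fun n => E n θ)) ∧
  (∀ θ ∈ Set.Ioo 0 (Real.pi / 2), Antitone (fun n => E n θ)) ∧
  (∀ θ ∈ Set.Ioo (Real.pi / 2) Real.pi, Monotone (fun n => E n θ))

end

/-! Write `r = cos θ`. Up to powers of `i`, `hermiteWave n` is the normalised Hermite polynomial
times `exp(-x²/2)`, and Mehler's formula (`hasSum_mehler`) sums `r ^ n * h_n(t) * conj (h_n(s))` to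
a Gaussian kernel. Replacing `(t, s)` by `√l (t, s)` and integrating against `exp(-l) dl / 2π` turns
this Gaussian into the kernel of `T_θ`, because `1 / (Q + 1) = ∫ exp(-l (Q + 1)) dl`. Hence, for any
`q` with `|r| < q < 1`, `T_θ = B* φ B`: here `B = featureOp q` maps `L²(ℝ)` to `L²((0, ∞) × ℕ)` and
depends only on `q`, and `φ` is multiplication by `(r / q) ^ n`. Mehler's formula on the diagonal
shows that `B` is Hilbert–Schmidt.

Part (i) follows: `φ ↦ B* φ B` is linear, with trace norm at most a constant times the sup norm of
`φ`, and `u ↦ (u ^ n)` is analytic into `ℓ^∞` for `|u| < 1`. Taking adjoints conjugates `φ`.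

For part (ii), `h_n` has the parity of `n`, so `T_θ⁺` and `T_θ⁻` keep the even and the odd powers of
`r`. Their forms are integrals of `|B f|²` against `(r / q) ^ n`, which increase with `r ≥ 0`. The
increase is strict for `f ≠ 0`: if all components of `B f` with `n ≠ 0` vanish, then `f` is a.e.
constant, hence zero in `L²`. Min-max transfers strict monotonicity to each ordered eigenvalue, and
Weyl's inequality gives continuity. At `r = 0` only `n = 0` survives; the even form stays positive
definite by injectivity of the Laplace transform in `s²`, while the odd operator is zero. Finally `θ
↦ π - θ` changes `r` to `-r`, so it fixes `T⁺` and negates `T⁻`; it suffices to treat `(0, π/2]`. -/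

/-! ### Trace norm of `X* M X` for a Hilbert–Schmidt operator `X`. -/

section TraceNormBound

universe u

variable {H : Type u} [NormedAddCommGroup H] [InnerProductSpace ℂ H]
variable {G : Type*} [NormedAddCommGroup G] [InnerProductSpace ℂ G]

/-- Up to a small error, the absolute value of an element of a C⋆-algebra is a contraction times
the element. -/
theorem exists_contraction_mul_approx_abs {𝔄 : Type*} [CStarAlgebra 𝔄] [PartialOrder 𝔄]
    [StarOrderedRing 𝔄] (A : 𝔄) {ε : ℝ} (hε : 0 < ε) :
    ∃ W : 𝔄, ‖W‖ ≤ 1 ∧ ‖CFC.abs A - W * A‖ ≤ ε := by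
  have hP : 0 ≤ CFC.abs A := CFC.abs_nonneg A
  have habs : CFC.abs A * CFC.abs A = star A * A := CFC.abs_mul_abs A
  generalize CFC.abs A = P at hP habs ⊢
  have hPs : IsSelfAdjoint P := .of_nonneg hP
  have hspec : ∀ x ∈ spectrum ℝ P, 0 ≤ x := fun x hx => spectrum_nonneg_of_nonneg hP hx
  have hf : Continuous (fun x : ℝ => (|x| + ε)⁻¹) := by
    refine Continuous.inv₀ (by fun_prop) fun x => ?_
    positivity
  have hg : Continuous (fun x : ℝ => x * x) := by fun_prop
  have hfg : Continuous (fun x : ℝ => (|x| + ε)⁻¹ * (x * x)) := hf.mul hg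
  have hPP : P * P = cfc (fun x : ℝ => x * x) P := by
    rw [cfc_mul (fun x : ℝ => x) (fun x => x) P continuousOn_id continuousOn_id, cfc_id' ℝ P]
  -- With `P = |A|`, take `W = (P + ε)⁻¹ A*`, a regularised adjoint of the polar factor, so that `W
  -- A = (P + ε)⁻¹ P²`. Both estimates become scalar ones on the spectrum: `(x / (x + ε))² ≤ 1` and
  -- `x - x² / (x + ε) ≤ ε`.
  obtain ⟨R, hR⟩ : ∃ R, R = cfc (fun x : ℝ => (|x| + ε)⁻¹) P := ⟨_, rfl⟩
  have hRs : IsSelfAdjoint R := hR ▸ cfc_predicate _ _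
  have hWA : R * star A * A = cfc (fun x : ℝ => (|x| + ε)⁻¹ * (x * x)) P := by
    rw [mul_assoc, ← habs, hPP, hR, cfc_mul (fun x : ℝ => (|x| + ε)⁻¹) (fun x => x * x) P
      hf.continuousOn hg.continuousOn]
  refine ⟨R * star A, ?_, ?_⟩
  · have h1 : (R * star A) * star (R * star A)
        = cfc (fun x : ℝ => (|x| + ε)⁻¹ * (x * x) * (|x| + ε)⁻¹) P := by
      rw [star_mul, star_star, hRs.star_eq, ← mul_assoc, hWA, hR,
        cfc_mul (fun x : ℝ => (|x| + ε)⁻¹ * (x * x)) (fun x => (|x| + ε)⁻¹) P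
          hfg.continuousOn hf.continuousOn]
    have h2 : ‖R * star A‖ * ‖R * star A‖ ≤ 1 := by
      rw [← CStarRing.norm_self_mul_star, h1]
      refine norm_cfc_le zero_le_one fun x hx => ?_
      have hx0 := hspec x hx
      rw [abs_of_nonneg hx0, Real.norm_of_nonneg (by positivity)]
      have : 0 < x + ε := by positivity
      rw [show (x + ε)⁻¹ * (x * x) * (x + ε)⁻¹ = (x / (x + ε)) ^ 2 by field_simp]
      exact pow_le_one₀ (by positivity) ((div_le_one this).2 (by linarith))
    nlinarith [norm_nonneg (R * star A)]
  · rw [hWA]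
    have h3 : P - cfc (fun x : ℝ => (|x| + ε)⁻¹ * (x * x)) P
        = cfc (fun x : ℝ => x - (|x| + ε)⁻¹ * (x * x)) P := by
      rw [cfc_sub (fun x : ℝ => x) (fun x => (|x| + ε)⁻¹ * (x * x)) P
        continuousOn_id hfg.continuousOn, cfc_id' ℝ P]
    rw [h3]
    refine norm_cfc_le hε.le fun x hx => ?_
    have hx0 := hspec x hx
    have : 0 < x + ε := by positivity
    rw [abs_of_nonneg hx0,
      show x - (x + ε)⁻¹ * (x * x) = x / (x + ε) * ε by field_simp; ring,
      Real.norm_of_nonneg (by positivity)]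
    exact mul_le_of_le_one_left hε.le ((div_le_one this).2 (by linarith))

/-- `C` bounds the square of the Hilbert–Schmidt norm of `X`, also after composition with a
contraction on the right. -/
def HilbertSchmidtBound (X : H →L[ℂ] G) (C : ℝ) : Prop :=
  ∀ W : H →L[ℂ] H, ‖W‖ ≤ 1 → ∀ (ι : Type u) (s : Finset ι) (b : ι → H), Orthonormal ℂ b →
    ∑ i ∈ s, ‖X (W (b i))‖ ^ 2 ≤ C

theorem HilbertSchmidtBound.nonneg {X : H →L[ℂ] G} {C : ℝ} (h : HilbertSchmidtBound X C) :
    0 ≤ C := by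
  simpa using h 0 (by simp) PEmpty ∅ (fun x => x.elim) (by simp)

/-- The trace norm of `X* M X` is at most `‖M‖` times the squared Hilbert–Schmidt norm of `X`. -/
theorem traceNorm_adjoint_comp_comp_le [CompleteSpace H] [CompleteSpace G] {X : H →L[ℂ] G} {C : ℝ}
    (hX : HilbertSchmidtBound X C) (M : G →L[ℂ] G) :
    traceNorm (ContinuousLinearMap.adjoint X ∘L M ∘L X) ≤ ENNReal.ofReal (‖M‖ * C) := by
  set A := ContinuousLinearMap.adjoint X ∘L M ∘L X with hA
  unfold traceNorm
  set b := (exists_hilbertBasis ℂ H).choose_spec.choose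
  rw [ENNReal.tsum_eq_iSup_sum]
  refine iSup_le fun s => ?_
  have hpos : ∀ i, 0 ≤ RCLike.re ⟪b i, CFC.abs A (b i)⟫_ℂ := fun i =>
    ((ContinuousLinearMap.nonneg_iff_isPositive _).1 (CFC.abs_nonneg A)).re_inner_nonneg_right _
  rw [← ENNReal.ofReal_sum_of_nonneg fun i _ => hpos i]
  refine ENNReal.ofReal_le_ofReal (le_of_forall_pos_le_add fun δ hδ => ?_)
  -- The error is split over the finite sum; `card + 1` avoids division by zero. Replacing `|A|` by
  -- `W A` gives terms `⟪X W* b, M X b⟫`, which is why the Hilbert–Schmidt bound allows a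
  -- contraction on the right.
  obtain ⟨W, hW, hWA⟩ := exists_contraction_mul_approx_abs A
    (show 0 < δ / (s.card + 1) by positivity)
  have hb := b.orthonormal
  have hterm : ∀ i ∈ s, RCLike.re ⟪b i, CFC.abs A (b i)⟫_ℂ ≤
      ‖M‖ * ((‖X (ContinuousLinearMap.adjoint W (b i))‖ ^ 2 + ‖X (b i)‖ ^ 2) / 2)
        + δ / (s.card + 1) := by
    intro i _
    have h1 : ⟪b i, CFC.abs A (b i)⟫_ℂ = ⟪X (ContinuousLinearMap.adjoint W (b i)), M (X (b i))⟫_ℂ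
        + ⟪b i, (CFC.abs A - W * A) (b i)⟫_ℂ := by
      rw [← ContinuousLinearMap.adjoint_inner_right, ContinuousLinearMap.adjoint_inner_left,
        ← inner_add_right]
      congr 1
      simp [hA]
    rw [h1, map_add]
    refine add_le_add ?_ ?_
    · refine (re_inner_le_norm _ _).trans ?_
      have h2 : ‖M (X (b i))‖ ≤ ‖M‖ * ‖X (b i)‖ := M.le_opNorm _
      calc _ ≤ ‖X (ContinuousLinearMap.adjoint W (b i))‖ * (‖M‖ * ‖X (b i)‖) := by gcongr
        _ = ‖M‖ * (‖X (ContinuousLinearMap.adjoint W (b i))‖ * ‖X (b i)‖) := by ring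
        _ ≤ _ := by
          gcongr
          nlinarith [sq_nonneg (‖X (ContinuousLinearMap.adjoint W (b i))‖ - ‖X (b i)‖)]
    · refine (re_inner_le_norm _ _).trans ?_
      rw [hb.1 i, one_mul]
      exact ((CFC.abs A - W * A).le_opNorm _).trans (by rwa [hb.1 i, mul_one])
  have hW' : ‖ContinuousLinearMap.adjoint W‖ ≤ 1 := by
    rwa [LinearIsometryEquiv.norm_map]
  have e1 := hX _ hW' _ s (⇑b) hb
  have e2 := hX (ContinuousLinearMap.id ℂ H) ContinuousLinearMap.norm_id_le _ s (⇑b) hb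
  simp only [ContinuousLinearMap.id_apply] at e2
  calc _ ≤ _ := Finset.sum_le_sum hterm
    _ = ‖M‖ * ((∑ i ∈ s, ‖X (ContinuousLinearMap.adjoint W (b i))‖ ^ 2 +
          ∑ i ∈ s, ‖X (b i)‖ ^ 2) / 2) + s.card * (δ / (s.card + 1)) := by
        rw [Finset.sum_add_distrib, ← Finset.mul_sum, ← Finset.sum_div, Finset.sum_add_distrib]
        simp
    _ ≤ ‖M‖ * C + δ := by
        refine add_le_add (by gcongr; linarith) ?_
        rw [mul_div_assoc', div_le_iff₀ (by positivity)]
        nlinarith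

end TraceNormBound

/-! ### Hilbert–Schmidt operators are compact. -/

section CompactOfHilbertSchmidt

universe u
variable {H : Type u} [NormedAddCommGroup H] [InnerProductSpace ℂ H]
variable {G : Type*} [NormedAddCommGroup G] [InnerProductSpace ℂ G]

theorem ContinuousLinearMap.isCompactOperator_smulRight (φ : H →L[ℂ] ℂ) (y : G) :
    IsCompactOperator (φ.smulRight y) := by
  have h : IsCompactOperator (ContinuousLinearMap.id ℂ ℂ) :=
    isCompactOperator_id_iff_locallyCompactSpace.2 inferInstance
  have h2 : IsCompactOperator (⇑(ContinuousLinearMap.toSpanSingleton ℂ y) ∘ ⇑φ) :=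
    (h.clm_comp (ContinuousLinearMap.toSpanSingleton ℂ y)).comp_clm φ
  convert h2 using 1
  ext x
  simp

/-- A Hilbert–Schmidt operator is compact. -/
theorem HilbertSchmidtBound.isCompactOperator [CompleteSpace H] [CompleteSpace G] {X : H →L[ℂ] G} {C : ℝ}
    (hX : HilbertSchmidtBound X C) : IsCompactOperator X := by
  obtain ⟨w, b, hb⟩ := exists_hilbertBasis ℂ H
  have hbo := b.orthonormal
  have hsum : Summable fun i => ‖X (b i)‖ ^ 2 := by
    refine summable_of_sum_le (c := C) (fun i => by positivity) fun s => ?_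
    simpa using hX (ContinuousLinearMap.id ℂ H) ContinuousLinearMap.norm_id_le _ s (⇑b) hbo
  -- Finite-rank truncations of `X` along the basis; they converge in operator norm, since
  -- Cauchy–Schwarz bounds the error by the tail of `∑ ‖X b_i‖²`.
  let F : Finset w → H →L[ℂ] G := fun s => ∑ i ∈ s, (innerSL ℂ (b i)).smulRight (X (b i))
  have hF : ∀ s, IsCompactOperator (F s) := fun s => by
    have : F s ∈ compactOperator (RingHom.id ℂ) H G :=
      Submodule.sum_mem _ fun i _ => ContinuousLinearMap.isCompactOperator_smulRight _ _
    exact this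
  refine isCompactOperator_of_tendsto (l := atTop) (F := F) ?_ (Eventually.of_forall hF)
  rw [Metric.tendsto_nhds]
  intro ε hε
  obtain ⟨s, hs⟩ := summable_iff_vanishing_norm.1 hsum ((ε / 2) ^ 2) (by positivity)
  filter_upwards [eventually_ge_atTop s] with t hst
  rw [dist_eq_norm]
  refine lt_of_le_of_lt ?_ (half_lt_self hε)
  refine ContinuousLinearMap.opNorm_le_bound _ (by positivity) fun x => ?_
  have hx : Tendsto (fun r : Finset w => F t x - F r x) atTop (𝓝 ((F t - X) x)) := by
    have h1 := (b.hasSum_repr x).mapL X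
    refine tendsto_const_nhds.sub ?_
    rw [HasSum, SummationFilter.unconditional_filter] at h1
    refine Tendsto.congr (fun r => ?_) h1
    simp [F, b.repr_apply_apply]
  refine le_of_tendsto hx.norm ?_
  filter_upwards [eventually_ge_atTop t] with r hr
  classical
  have h2 : F r x - F t x = ∑ i ∈ r \ t, ⟪b i, x⟫_ℂ • X (b i) := by
    simp [F, Finset.sum_sdiff_eq_sub hr]
  rw [norm_sub_rev, h2]
  have h3 : ∑ i ∈ r \ t, ‖X (b i)‖ ^ 2 ≤ (ε / 2) ^ 2 := by
    have := hs (r \ t) (Finset.disjoint_of_subset_right hst Finset.sdiff_disjoint)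
    exact (Real.le_norm_self _).trans this.le
  have h4 : ∑ i ∈ r \ t, ‖⟪b i, x⟫_ℂ‖ ^ 2 ≤ ‖x‖ ^ 2 := hbo.sum_inner_products_le x
  have h5 : ‖∑ i ∈ r \ t, ⟪b i, x⟫_ℂ • X (b i)‖ ≤ ∑ i ∈ r \ t, ‖⟪b i, x⟫_ℂ‖ * ‖X (b i)‖ := by
    refine (norm_sum_le _ _).trans (le_of_eq ?_)
    simp [norm_smul]
  refine h5.trans (abs_le_of_sq_le_sq' ?_ (by positivity)).2
  calc _ ≤ _ := Finset.sum_mul_sq_le_sq_mul_sq _ _ _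
    _ ≤ ‖x‖ ^ 2 * (ε / 2) ^ 2 := by gcongr
    _ = _ := by ring

end CompactOfHilbertSchmidt

/-! ### Integral operators with square integrable kernels. -/

section KernelOperators

variable {α β γ : Type*} [MeasurableSpace α] [MeasurableSpace β] [MeasurableSpace γ]
variable {μ : Measure α} {ν : Measure β} {κ : Measure γ}

/-- `T` is the integral operator with kernel `k`. -/
def IsIntegralOperator (T : Lp ℂ 2 ν →L[ℂ] Lp ℂ 2 μ) (k : α → β → ℂ) : Prop :=
  ∀ f : Lp ℂ 2 ν, (∀ᵐ a ∂μ, Integrable (fun b => k a b * f b) ν) ∧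
    T f =ᵐ[μ] fun a => ∫ b, k a b * f b ∂ν

/-- Square integrability of a kernel. -/
structure IsHilbertSchmidtKernel (k : α → β → ℂ) (μ : Measure α) (ν : Measure β) : Prop where
  measurable : Measurable (Function.uncurry k)
  integrable : Integrable (fun p : α × β => ‖k p.1 p.2‖ ^ 2) (μ.prod ν)

/-- Integration against a square integrable function is an inner product. -/
theorem MeasureTheory.MemLp.exists_inner_eq_integral_mul {g : β → ℂ} (hg : MemLp g 2 ν) :
    ∃ u : Lp ℂ 2 ν, ‖u‖ ^ 2 = ∫ b, ‖g b‖ ^ 2 ∂ν ∧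
      ∀ f : Lp ℂ 2 ν, Integrable (fun b => g b * f b) ν ∧ ∫ b, g b * f b ∂ν = ⟪u, f⟫_ℂ := by
  have hg' : MemLp (fun b => conj (g b)) 2 ν := hg.star
  refine ⟨hg'.toLp _, ?_, fun f => ⟨?_, ?_⟩⟩
  · rw [← RCLike.ofReal_inj (K := ℂ)]
    push_cast
    rw [← inner_self_eq_norm_sq_to_K (𝕜 := ℂ), L2.inner_def]
    rw [← integral_ofReal]
    refine integral_congr_ae ?_
    filter_upwards [hg'.coeFn_toLp] with b hb
    rw [hb]
    simp
  · exact hg.integrable_mul (Lp.memLp f)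
  · rw [L2.inner_def]
    refine integral_congr_ae ?_
    filter_upwards [hg'.coeFn_toLp] with b hb
    rw [hb]
    simp [mul_comm]

theorem MeasureTheory.Lp.norm_sq_eq_integral (f : Lp ℂ 2 ν) : ‖f‖ ^ 2 = ∫ b, ‖f b‖ ^ 2 ∂ν := by
  rw [← RCLike.ofReal_inj (K := ℂ)]
  push_cast
  rw [← inner_self_eq_norm_sq_to_K (𝕜 := ℂ), L2.inner_def, ← integral_ofReal]
  refine integral_congr_ae (Eventually.of_forall fun b => ?_)
  simp

variable [SFinite ν]

namespace IsHilbertSchmidtKernel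

variable {k : α → β → ℂ} (hk : IsHilbertSchmidtKernel k μ ν)

include hk

theorem memLp_ae [SFinite μ] : ∀ᵐ a ∂μ, MemLp (k a) 2 ν := by
  filter_upwards [hk.integrable.prod_right_ae] with a ha
  exact (memLp_two_iff_integrable_sq_norm
    (hk.measurable.comp measurable_prodMk_left).aestronglyMeasurable).2 ha

theorem integrable_sq_integral : Integrable (fun a => ∫ b, ‖k a b‖ ^ 2 ∂ν) μ :=
  hk.integrable.integral_prod_left

theorem aestronglyMeasurable_integral (f : Lp ℂ 2 ν) :
    AEStronglyMeasurable (fun a => ∫ b, k a b * f b ∂ν) μ := by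
  have h : StronglyMeasurable (fun p : α × β => k p.1 p.2 * f p.2) :=
    hk.measurable.stronglyMeasurable.mul ((Lp.stronglyMeasurable f).comp_measurable measurable_snd)
  exact h.integral_prod_right'.aestronglyMeasurable

theorem norm_sq_integral_le [SFinite μ] (f : Lp ℂ 2 ν) :
    ∀ᵐ a ∂μ, ‖∫ b, k a b * f b ∂ν‖ ^ 2 ≤ (∫ b, ‖k a b‖ ^ 2 ∂ν) * ‖f‖ ^ 2 := by
  filter_upwards [hk.memLp_ae] with a ha
  obtain ⟨u, hu, h⟩ := ha.exists_inner_eq_integral_mul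
  rw [(h f).2, ← hu, ← mul_pow]
  gcongr
  exact norm_inner_le_norm _ _

theorem memLp_integral [SFinite μ] (f : Lp ℂ 2 ν) : MemLp (fun a => ∫ b, k a b * f b ∂ν) 2 μ := by
  rw [memLp_two_iff_integrable_sq_norm (hk.aestronglyMeasurable_integral f)]
  refine (hk.integrable_sq_integral.mul_const (‖f‖ ^ 2)).mono'
    ((hk.aestronglyMeasurable_integral f).norm.pow 2) ?_
  filter_upwards [hk.norm_sq_integral_le f] with a ha
  rwa [Real.norm_of_nonneg (by positivity)]

theorem integrable_mul_ae [SFinite μ] (f : Lp ℂ 2 ν) : ∀ᵐ a ∂μ, Integrable (fun b => k a b * f b) ν := by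
  filter_upwards [hk.memLp_ae] with a ha
  exact ha.integrable_mul (Lp.memLp f)

/-- A square integrable kernel defines a bounded operator. -/
theorem exists_isIntegralOperator [SFinite μ] :
    ∃ T : Lp ℂ 2 ν →L[ℂ] Lp ℂ 2 μ, IsIntegralOperator T k := by
  let T₀ : Lp ℂ 2 ν →ₗ[ℂ] Lp ℂ 2 μ :=
    { toFun := fun f => (hk.memLp_integral f).toLp _
      map_add' := fun f g => by
        rw [← MemLp.toLp_add]
        refine MemLp.toLp_congr _ _ ?_
        filter_upwards [hk.integrable_mul_ae f, hk.integrable_mul_ae g] with a hf hg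
        rw [Pi.add_apply, ← integral_add hf hg]
        refine integral_congr_ae ?_
        filter_upwards [Lp.coeFn_add f g] with b hb
        rw [hb, Pi.add_apply, mul_add]
      map_smul' := fun c f => by
        rw [RingHom.id_apply, ← MemLp.toLp_const_smul]
        refine MemLp.toLp_congr _ _ (Eventually.of_forall fun a => ?_)
        rw [Pi.smul_apply, smul_eq_mul, ← integral_const_mul]
        refine integral_congr_ae ?_
        filter_upwards [Lp.coeFn_smul c f] with b hb
        rw [hb, Pi.smul_apply, smul_eq_mul]
        ring }
  have hT : ∀ f, T₀ f =ᵐ[μ] fun a => ∫ b, k a b * f b ∂ν := fun f =>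
    (hk.memLp_integral f).coeFn_toLp
  refine ⟨T₀.mkContinuous (√(∫ a, ∫ b, ‖k a b‖ ^ 2 ∂ν ∂μ)) fun f => ?_, fun f =>
    ⟨hk.integrable_mul_ae f, hT f⟩⟩
  have h0 : 0 ≤ ∫ a, ∫ b, ‖k a b‖ ^ 2 ∂ν ∂μ :=
    integral_nonneg fun a => integral_nonneg fun b => by positivity
  refine (abs_le_of_sq_le_sq' ?_ (by positivity)).2
  rw [mul_pow, Real.sq_sqrt h0, Lp.norm_sq_eq_integral, ← integral_mul_const]
  refine integral_mono_ae ?_ (hk.integrable_sq_integral.mul_const _) ?_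
  · exact (memLp_two_iff_integrable_sq_norm (Lp.aestronglyMeasurable _)).1 (Lp.memLp _)
  · filter_upwards [hT f, hk.norm_sq_integral_le f] with a h1 h2
    simpa only [h1] using h2

/-- Bessel's inequality pointwise in `a`: the value of `T W b_i` at `a` is an inner product of `W
b_i` with the vector `u` representing `k a`, so the sum of squares is at most `‖W* u‖² ≤ ∫ ‖k a
b‖²`. Integrate over `a`. -/
theorem hilbertSchmidtBound [SFinite μ] {T : Lp ℂ 2 ν →L[ℂ] Lp ℂ 2 μ} (hT : IsIntegralOperator T k) :
    HilbertSchmidtBound T (∫ a, ∫ b, ‖k a b‖ ^ 2 ∂ν ∂μ) := by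
  intro W hW ι s b hb
  simp only [Lp.norm_sq_eq_integral]
  have hint : ∀ g : Lp ℂ 2 μ, Integrable (fun a => ‖g a‖ ^ 2) μ := fun g =>
    (memLp_two_iff_integrable_sq_norm (Lp.aestronglyMeasurable _)).1 (Lp.memLp g)
  rw [← integral_finsetSum _ fun i _ => hint _]
  refine integral_mono_ae (integrable_finsetSum _ fun i _ => hint _) hk.integrable_sq_integral ?_
  have h1 : ∀ᵐ a ∂μ, ∀ i ∈ s, T (W (b i)) a = ∫ x, k a x * W (b i) x ∂ν :=
    (Finset.eventually_all s).2 fun i _ => (hT (W (b i))).2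
  filter_upwards [h1, hk.memLp_ae] with a ha hka
  obtain ⟨u, hu, h⟩ := hka.exists_inner_eq_integral_mul
  calc ∑ i ∈ s, ‖T (W (b i)) a‖ ^ 2 = ∑ i ∈ s, ‖⟪b i, ContinuousLinearMap.adjoint W u⟫_ℂ‖ ^ 2 := by
        refine Finset.sum_congr rfl fun i hi => ?_
        rw [ha i hi, (h _).2, ContinuousLinearMap.adjoint_inner_right, norm_inner_symm]
    _ ≤ ‖ContinuousLinearMap.adjoint W u‖ ^ 2 := hb.sum_inner_products_le _
    _ ≤ ‖u‖ ^ 2 := by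
        gcongr
        refine (ContinuousLinearMap.le_opNorm _ _).trans ?_
        rw [LinearIsometryEquiv.norm_map]
        exact mul_le_of_le_one_left (norm_nonneg _) hW
    _ = _ := hu

theorem conj_swap [SFinite μ] : IsHilbertSchmidtKernel (fun b a => conj (k a b)) ν μ where
  measurable := by
    have := hk.measurable.comp measurable_swap
    exact Complex.continuous_conj.measurable.comp this
  integrable := by simpa using! hk.integrable.swap

/-- The adjoint of a Hilbert–Schmidt integral operator has the conjugate transposed kernel. -/
theorem adjoint [SFinite μ] {T : Lp ℂ 2 ν →L[ℂ] Lp ℂ 2 μ}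
    (hT : IsIntegralOperator T k) :
    IsIntegralOperator (ContinuousLinearMap.adjoint T) (fun b a => conj (k a b)) := by
  obtain ⟨S, hS⟩ := hk.conj_swap.exists_isIntegralOperator
  suffices S = ContinuousLinearMap.adjoint T by rwa [← this]
  rw [ContinuousLinearMap.eq_adjoint_iff]
  intro g f
  rw [L2.inner_def, L2.inner_def]
  -- Fubini is justified by pairing the kernel with the tensor product of `conj g` and `f`, both
  -- square integrable on the product.
  have h1 : Integrable (Function.uncurry fun a b => conj (g a) * (k a b * f b)) (μ.prod ν) := by
    have e1 : MemLp (fun p : α × β => k p.1 p.2) 2 (μ.prod ν) :=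
      (memLp_two_iff_integrable_sq_norm hk.measurable.aestronglyMeasurable).2 hk.integrable
    have e2 : MemLp (fun p : α × β => conj (g p.1) * f p.2) 2 (μ.prod ν) := by
      have m1 : AEStronglyMeasurable (fun p : α × β => conj (g p.1) * f p.2) (μ.prod ν) :=
        (Complex.continuous_conj.comp_aestronglyMeasurable
          ((Lp.stronglyMeasurable g).comp_measurable measurable_fst).aestronglyMeasurable).mul
          ((Lp.stronglyMeasurable f).comp_measurable measurable_snd).aestronglyMeasurable
      rw [memLp_two_iff_integrable_sq_norm m1]
      have := ((memLp_two_iff_integrable_sq_norm (Lp.aestronglyMeasurable _)).1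
        (Lp.memLp g)).mul_prod ((memLp_two_iff_integrable_sq_norm
          (Lp.aestronglyMeasurable _)).1 (Lp.memLp f))
      simpa [mul_pow] using this
    convert e1.integrable_mul e2 using 1
    ext p
    simp only [Function.uncurry, Pi.mul_apply]
    ring
  calc _ = ∫ b, ∫ a, conj (g a) * (k a b * f b) ∂μ ∂ν := by
        refine integral_congr_ae ?_
        filter_upwards [(hS g).2] with b hb
        rw [RCLike.inner_apply, hb, ← integral_conj, ← integral_const_mul]
        refine integral_congr_ae (Eventually.of_forall fun a => ?_)
        simp only [map_mul, Complex.conj_conj]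
        ring
    _ = ∫ a, ∫ b, conj (g a) * (k a b * f b) ∂ν ∂μ := (integral_integral_swap h1).symm
    _ = _ := by
        refine integral_congr_ae ?_
        filter_upwards [(hT f).2] with a ha
        rw [RCLike.inner_apply, ha, integral_const_mul, mul_comm]

end IsHilbertSchmidtKernel

/-- The composition of two Hilbert–Schmidt integral operators is an integral operator. -/
theorem IsHilbertSchmidtKernel.comp [SFinite μ] {j : γ → α → ℂ} {k : α → β → ℂ} [SFinite κ]
    (hj : IsHilbertSchmidtKernel j κ μ) (hk : IsHilbertSchmidtKernel k μ ν)
    {S : Lp ℂ 2 μ →L[ℂ] Lp ℂ 2 κ} {T : Lp ℂ 2 ν →L[ℂ] Lp ℂ 2 μ}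
    (hS : IsIntegralOperator S j) (hT : IsIntegralOperator T k) :
    IsIntegralOperator (S ∘L T) (fun c b => ∫ a, j c a * k a b ∂μ) := by
  intro f
  have hint : ∀ᵐ c ∂κ, Integrable (Function.uncurry fun b a => j c a * k a b * f b)
      (ν.prod μ) := by
    have hmeas : Measurable fun p : α × β => k p.1 p.2 * f p.2 :=
      hk.measurable.mul ((Lp.stronglyMeasurable f).measurable.comp measurable_snd)
    -- Cauchy–Schwarz, applied to absolute values, puts `a ↦ ∫ ‖k a b * f b‖` in `L²`; paired with
    -- `j c`, this gives the absolute integrability needed for Fubini.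
    have hR : MemLp (fun a => ∫ b, ‖k a b * f b‖ ∂ν) 2 μ := by
      have hm : AEStronglyMeasurable (fun a => ∫ b, ‖k a b * f b‖ ∂ν) μ :=
        (hmeas.norm.stronglyMeasurable.integral_prod_right').aestronglyMeasurable
      rw [memLp_two_iff_integrable_sq_norm hm]
      refine (hk.integrable_sq_integral.mul_const (‖f‖ ^ 2)).mono' (hm.norm.pow 2) ?_
      filter_upwards [hk.memLp_ae] with a ha
      have hf : MemLp (fun b => ((‖f b‖ : ℝ) : ℂ)) 2 ν := (Lp.memLp f).norm.ofReal
      have hka : MemLp (fun b => ((‖k a b‖ : ℝ) : ℂ)) 2 ν := ha.norm.ofReal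
      obtain ⟨u, hu, h⟩ := hka.exists_inner_eq_integral_mul
      have h1 := (h (hf.toLp _)).2
      have h2 : ∫ b, ‖k a b * f b‖ ∂ν = ‖⟪u, hf.toLp _⟫_ℂ‖ := by
        rw [← h1, ← RCLike.norm_of_nonneg (K := ℂ)
          (integral_nonneg fun b => norm_nonneg (k a b * f b)), ← integral_ofReal]
        congr 1
        refine integral_congr_ae ?_
        filter_upwards [hf.coeFn_toLp] with b hb
        rw [hb, norm_mul]
        push_cast
        rfl
      have h3 : ‖hf.toLp _‖ = ‖f‖ := by
        rw [Lp.norm_toLp, Lp.norm_def]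
        congr 1
        exact eLpNorm_congr_norm_ae (Eventually.of_forall fun b => by simp)
      rw [Real.norm_of_nonneg (by positivity), h2, norm_norm]
      simp only [Complex.norm_real, norm_norm] at hu
      rw [← hu, ← h3, ← mul_pow]
      gcongr
      exact norm_inner_le_norm _ _
    filter_upwards [hj.memLp_ae] with c hc
    have hjc : Measurable (j c) := hj.measurable.comp measurable_prodMk_left
    have hm : Measurable (Function.uncurry fun b a => j c a * k a b * f b) := by
      have := (hmeas.comp (measurable_swap (α := β) (β := α)))
      have h2 := (hjc.comp (measurable_snd (α := β) (β := α))).mul this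
      convert h2 using 1
      ext p
      simp [Function.uncurry, mul_assoc]
    rw [integrable_prod_iff' hm.aestronglyMeasurable]
    constructor
    · filter_upwards [hk.integrable_mul_ae f] with a ha
      simpa [Function.uncurry, mul_assoc] using ha.const_mul (j c a)
    · have := hc.norm.integrable_mul hR
      convert this using 1
      ext a
      simp only [Function.uncurry, Pi.mul_apply, ← integral_const_mul]
      simp [mul_assoc]
  refine ⟨?_, ?_⟩
  · filter_upwards [hint] with c hc
    have := hc.integral_prod_left
    simpa [Function.uncurry, integral_mul_const] using this
  · filter_upwards [hint, (hS (T f)).2] with c hc hSc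
    rw [ContinuousLinearMap.comp_apply, hSc]
    calc _ = ∫ a, ∫ b, j c a * k a b * f b ∂ν ∂μ := by
          refine integral_congr_ae ?_
          filter_upwards [(hT f).2] with a ha
          rw [ha, ← integral_const_mul]
          simp [mul_assoc]
      _ = ∫ b, ∫ a, j c a * k a b * f b ∂μ ∂ν := (integral_integral_swap hc).symm
      _ = _ := by simp [integral_mul_const]

end KernelOperators

/-! ### Multiplication operators, depending linearly and boundedly on the symbol. -/

section Multiplication

open scoped BoundedContinuousFunction

variable {α : Type*} [MeasurableSpace α] {μ : Measure α}

/-- Multiplication by `φ ∘ g` on `L²(μ)`, for a bounded sequence `φ` and a measurable integer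
valued `g`. -/
theorem exists_multiplicationOperator {g : α → ℕ} (hg : Measurable g) :
    ∃ M : (ℕ →ᵇ ℂ) →L[ℂ] Lp ℂ 2 μ →L[ℂ] Lp ℂ 2 μ,
      ∀ φ f, M φ f =ᵐ[μ] fun a => φ (g a) * f a := by
  have hmeas : ∀ φ : ℕ →ᵇ ℂ, Measurable fun a => φ (g a) := fun φ =>
    (measurable_from_nat (f := φ)).comp hg
  have hb : ∀ (φ : ℕ →ᵇ ℂ) (f : Lp ℂ 2 μ), ∀ᵐ a ∂μ, ‖φ (g a) * f a‖ ≤ ‖φ‖ * ‖f a‖ :=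
    fun φ f => Eventually.of_forall fun a => by
      rw [norm_mul]
      gcongr
      exact φ.norm_coe_le_norm _
  have hm : ∀ (φ : ℕ →ᵇ ℂ) (f : Lp ℂ 2 μ), MemLp (fun a => φ (g a) * f a) 2 μ := fun φ f =>
    (Lp.memLp f).of_le_mul ((hmeas φ).aestronglyMeasurable.mul (Lp.aestronglyMeasurable f)) (hb φ f)
  have hc : ∀ φ f, (hm φ f).toLp _ =ᵐ[μ] fun a => φ (g a) * f a := fun φ f =>
    (hm φ f).coeFn_toLp
  let M₀ : (ℕ →ᵇ ℂ) →ₗ[ℂ] Lp ℂ 2 μ →ₗ[ℂ] Lp ℂ 2 μ := LinearMap.mk₂ ℂ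
    (fun φ f => (hm φ f).toLp _)
    (fun φ ψ f => by
      rw [← MemLp.toLp_add]
      exact MemLp.toLp_congr _ _ (Eventually.of_forall fun a => by simp [add_mul]))
    (fun c φ f => by
      rw [← MemLp.toLp_const_smul]
      exact MemLp.toLp_congr _ _ (Eventually.of_forall fun a => by simp [mul_assoc]))
    (fun φ f f' => by
      rw [← MemLp.toLp_add]
      refine MemLp.toLp_congr _ _ ?_
      filter_upwards [Lp.coeFn_add f f'] with a ha
      simp only [ha, Pi.add_apply, mul_add])
    (fun c φ f => by
      rw [← MemLp.toLp_const_smul]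
      refine MemLp.toLp_congr _ _ ?_
      filter_upwards [Lp.coeFn_smul c f] with a ha
      simp only [ha, Pi.smul_apply, smul_eq_mul]
      ring)
  refine ⟨M₀.mkContinuous₂ 1 fun φ f => ?_, fun φ f => hc φ f⟩
  rw [one_mul]
  refine Lp.norm_le_mul_norm_of_ae_le_mul ?_
  filter_upwards [hc φ f, hb φ f] with a h1 h2
  rwa [show M₀ φ f a = _ from h1]

end Multiplication

/-! ### Enumeration in descending order. -/

section Enumeration

/-- A positive function on a countably infinite type with finite superlevel sets can be enumerated
in descending order. -/
theorem exists_equiv_nat_antitone {ι : Type*} [Countable ι] [Infinite ι] (v : ι → ℝ)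
    (hv : ∀ i, {j | v i ≤ v j}.Finite) : ∃ σ : ℕ ≃ ι, Antitone (v ∘ σ) := by
  obtain ⟨enc, henc⟩ := exists_injective_nat ι
  -- Order by descending value, ties broken by an injective code. Initial segments are then finite
  -- and there is no maximum, so the order is that of `ℕ`.
  let f : ι → ℝᵒᵈ ×ₗ ℕ := fun i => toLex (OrderDual.toDual (v i), enc i)
  have hf : Function.Injective f := fun i j h => henc (by
    have := congrArg (fun p => (ofLex p).2) h
    exact this)
  let _ : LinearOrder ι := LinearOrder.lift' f hf
  have hle : ∀ {i j : ι}, i ≤ j → v j ≤ v i := fun {i j} h => by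
    have h' : f i ≤ f j := h
    rcases (Prod.Lex.le_iff).1 h' with h1 | ⟨h1, -⟩
    · exact le_of_lt h1
    · exact le_of_eq (congrArg OrderDual.ofDual h1).symm
  have hfin : ∀ i : ι, (Set.Iic i).Finite := fun i => (hv i).subset fun j hj => hle hj
  let _ : LocallyFiniteOrder ι := LocallyFiniteOrder.ofFiniteIcc fun a b =>
    (hfin b).subset fun x hx => hx.2
  have : NoMaxOrder ι := ⟨fun i => by
    obtain ⟨j, hj⟩ := (hfin i).exists_notMem
    exact ⟨j, not_le.1 hj⟩⟩
  obtain ⟨i₀⟩ : Nonempty ι := inferInstance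
  obtain ⟨m, hm, hmin⟩ := (hfin i₀).exists_minimal ⟨i₀, le_refl i₀⟩
  let _ : OrderBot ι :=
    { bot := m
      bot_le := fun j => by
        rcases le_total m j with h | h
        · exact h
        · exact hmin (h.trans hm) h }
  let _ : SuccOrder ι := LinearLocallyFiniteOrder.succOrder ι
  let _ : PredOrder ι := LinearLocallyFiniteOrder.predOrder ι
  let τ : ι ≃o ℕ := orderIsoNatOfLinearSuccPredArch
  exact ⟨τ.symm.toEquiv, fun a b hab => hle (τ.symm.monotone hab)⟩

end Enumeration

/-! ### Min-max comparison and existence of eigenvalue sequences. -/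

section EigenvalueSequences

variable {H : Type*} [NormedAddCommGroup H] [InnerProductSpace ℂ H]

theorem Orthonormal.hasSum_inner_smul_of_mem_closure_span [CompleteSpace H] {e : ℕ → H} (he : Orthonormal ℂ e) {x : H}
    (hx : x ∈ (Submodule.span ℂ (Set.range e)).topologicalClosure) :
    HasSum (fun k => ⟪e k, x⟫_ℂ • e k) x := by
  set V := (Submodule.span ℂ (Set.range e)).topologicalClosure with hV
  have : CompleteSpace V :=
    (Submodule.isClosed_topologicalClosure _).completeSpace_coe
  have hmem : ∀ k, e k ∈ V := fun k =>
    Submodule.le_topologicalClosure _ (Submodule.subset_span ⟨k, rfl⟩)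
  let e' : ℕ → V := fun k => ⟨e k, hmem k⟩
  have he' : Orthonormal ℂ e' := ⟨fun k => he.1 k, fun i j hij => he.2 hij⟩
  have hbot : (Submodule.span ℂ (Set.range e'))ᗮ = ⊥ := by
    rw [eq_bot_iff]
    intro y hy
    have h1 : (y : H) ∈ (Submodule.span ℂ (Set.range e))ᗮ := by
      rw [Submodule.mem_orthogonal]
      intro u hu
      refine Submodule.span_induction ?_ (by simp) (fun a b _ _ ha hb => by
        rw [inner_add_left, ha, hb, add_zero]) (fun c a _ ha => by
        rw [inner_smul_left, ha, mul_zero]) hu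
      rintro _ ⟨k, rfl⟩
      exact (Submodule.mem_orthogonal _ _).1 hy (e' k) (Submodule.subset_span ⟨k, rfl⟩)
    rw [← Submodule.orthogonal_closure] at h1
    have h2 := (Submodule.mem_orthogonal _ _).1 h1 y y.2
    rw [inner_self_eq_zero] at h2
    simpa using h2
  let b := HilbertBasis.mkOfOrthogonalEqBot he' hbot
  have h3 := (b.hasSum_repr ⟨x, hx⟩).mapL V.subtypeL
  have hb : ∀ k, b k = e' k := fun k => by simp [b]
  simpa [b.repr_apply_apply, hb, e'] using h3

/-- The quadratic form is diagonal in an eigenbasis. Scalar operators give Parseval's identity as a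
special case. -/
theorem Orthonormal.hasSum_eigenvalue_mul_norm_inner_sq [CompleteSpace H] {e : ℕ → H} (he : Orthonormal ℂ e)
    {A : H →L[ℂ] H} {E : ℕ → ℝ} (hE : ∀ n, A (e n) = (E n : ℂ) • e n) {x : H}
    (hx : x ∈ (Submodule.span ℂ (Set.range e)).topologicalClosure) :
    HasSum (fun k => E k * ‖⟪e k, x⟫_ℂ‖ ^ 2) (RCLike.re ⟪x, A x⟫_ℂ) := by
  have h := ((he.hasSum_inner_smul_of_mem_closure_span hx).mapL ((innerSL ℂ x) ∘L A))
  have h2 := RCLike.hasSum_re ℂ h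
  rw [ContinuousLinearMap.comp_apply, innerSL_apply_apply] at h2
  convert h2 using 1
  ext k
  simp only [ContinuousLinearMap.comp_apply, innerSL_apply_apply, map_smul, hE k, smul_eq_mul]
  rw [← inner_conj_symm x (e k), mul_left_comm, RCLike.mul_conj]
  simp [← Complex.ofReal_pow, ← Complex.ofReal_mul]

/-- Two descending eigenvalue sequences on the same space: some unit vector has form value at least
the `n`-th eigenvalue of the first operator and at most that of the second. -/
theorem IsEigenvalueSequence.exists_le_inner_le [CompleteSpace H] {A B : H →L[ℂ] H} {V : Submodule ℂ H}
    {E E' : ℕ → ℝ} (hA : IsEigenvalueSequence A V E) (hB : IsEigenvalueSequence B V E')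
    (hE : Antitone E) (hE' : Antitone E') (n : ℕ) :
    ∃ x ∈ V, ‖x‖ = 1 ∧ E n ≤ RCLike.re ⟪x, A x⟫_ℂ ∧ RCLike.re ⟪x, B x⟫_ℂ ≤ E' n := by
  obtain ⟨e, he, hV, hAe⟩ := hA
  obtain ⟨e', he', hV', hBe⟩ := hB
  let S : (Fin (n + 1) → ℂ) →ₗ[ℂ] H := Fintype.linearCombination ℂ fun i : Fin (n + 1) => e i
  let L : (Fin (n + 1) → ℂ) →ₗ[ℂ] (Fin n → ℂ) :=
    LinearMap.pi fun k : Fin n => (innerSL ℂ (e' k)).toLinearMap ∘ₗ S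
  -- Dimension count: the span of `e 0, …, e n` contains a nonzero vector orthogonal to `e' 0, …, e'
  -- (n - 1)`. It only sees eigenvalues of `A` that are at least `E n` and eigenvalues of `B` that
  -- are at most `E' n`.
  obtain ⟨c, hc, hc0⟩ : ∃ c, L c = 0 ∧ c ≠ 0 := by
    have : LinearMap.ker L ≠ ⊥ := LinearMap.ker_ne_bot_of_finrank_lt (by simp)
    obtain ⟨c, hc, h0⟩ := (Submodule.ne_bot_iff _).1 this
    exact ⟨c, hc, h0⟩
  have hS : ∀ c, S c = ∑ i : Fin (n + 1), c i • e i := fun c => by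
    simp [S, Fintype.linearCombination_apply]
  have hSc : S c ≠ 0 := by
    intro h0
    apply hc0
    have hli : LinearIndependent ℂ fun i : Fin (n + 1) => e i :=
      (he.comp _ Fin.val_injective).linearIndependent
    rw [hS] at h0
    exact funext fun i => Fintype.linearIndependent_iff.1 hli c h0 i
  have hmem : S c ∈ V := by
    rw [hS, ← hV]
    exact Submodule.sum_mem _ fun i _ => Submodule.smul_mem _ _
      (Submodule.le_topologicalClosure _ (Submodule.subset_span ⟨i, rfl⟩))
  set x : H := ((‖S c‖ : ℂ)⁻¹) • S c with hx
  have hxV : x ∈ V := V.smul_mem _ hmem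
  have hx1 : ‖x‖ = 1 := by
    rw [hx, norm_smul, norm_inv, Complex.norm_real, norm_norm,
      inv_mul_cancel₀ (norm_ne_zero_iff.2 hSc)]
  have hlow : ∀ k, k < n → ⟪e' k, x⟫_ℂ = 0 := fun k hk => by
    have := congrFun hc ⟨k, hk⟩
    simp only [L, LinearMap.pi_apply, LinearMap.comp_apply] at this
    rw [hx, inner_smul_right]
    have h : ⟪e' k, S c⟫_ℂ = 0 := this
    rw [h, mul_zero]
  have hhigh : ∀ k, n < k → ⟪e k, x⟫_ℂ = 0 := fun k hk => by
    rw [hx, inner_smul_right, hS, inner_sum]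
    refine mul_eq_zero_of_right _ (Finset.sum_eq_zero fun i _ => ?_)
    rw [inner_smul_right, he.2 (by omega), mul_zero]
  have one : ∀ {f : ℕ → H}, Orthonormal ℂ f →
      x ∈ (Submodule.span ℂ (Set.range f)).topologicalClosure →
      ∀ a : ℝ, HasSum (fun k => a * ‖⟪f k, x⟫_ℂ‖ ^ 2) a := fun {f} hf hxf a => by
    have := hf.hasSum_eigenvalue_mul_norm_inner_sq
      (A := (a : ℂ) • ContinuousLinearMap.id ℂ H) (E := fun _ => a) (fun n => by simp) hxf
    have h2 : RCLike.re ⟪x, ((a : ℂ) • ContinuousLinearMap.id ℂ H) x⟫_ℂ = a := by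
      simp [inner_self_eq_norm_sq_to_K, hx1]
    rwa [h2] at this
  refine ⟨x, hxV, hx1, ?_, ?_⟩
  · rw [← hV] at hxV
    refine hasSum_le (fun k => ?_) (one he hxV (E n))
      (he.hasSum_eigenvalue_mul_norm_inner_sq hAe hxV)
    rcases le_or_gt k n with h | h
    · exact mul_le_mul_of_nonneg_right (hE h) (by positivity)
    · simp [hhigh k h]
  · rw [← hV'] at hxV
    refine hasSum_le (fun k => ?_) (he'.hasSum_eigenvalue_mul_norm_inner_sq hBe hxV)
      (one he' hxV (E' n))
    rcases lt_or_ge k n with h | h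
    · simp [hlow k h]
    · exact mul_le_mul_of_nonneg_right (hE' h) (by positivity)

/-- Strictness survives because one and the same vector witnesses both bounds; no supremum or
infimum is taken. -/
theorem IsEigenvalueSequence.lt_of_inner_lt [CompleteSpace H] {A B : H →L[ℂ] H} {V : Submodule ℂ H}
    {E E' : ℕ → ℝ} (hA : IsEigenvalueSequence A V E) (hB : IsEigenvalueSequence B V E')
    (hE : Antitone E) (hE' : Antitone E')
    (h : ∀ x ∈ V, x ≠ 0 → RCLike.re ⟪x, A x⟫_ℂ < RCLike.re ⟪x, B x⟫_ℂ) (n : ℕ) : E n < E' n := by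
  obtain ⟨x, hx, hx1, h1, h2⟩ := hA.exists_le_inner_le hB hE hE' n
  exact (h1.trans_lt (h x hx (by rintro rfl; simp at hx1))).trans_le h2

/-- Weyl's inequality: the forms of `A` and `B` differ by at most `‖A - B‖` on unit vectors. -/
theorem IsEigenvalueSequence.abs_sub_le [CompleteSpace H] {A B : H →L[ℂ] H} {V : Submodule ℂ H}
    {E E' : ℕ → ℝ} (hA : IsEigenvalueSequence A V E) (hB : IsEigenvalueSequence B V E')
    (hE : Antitone E) (hE' : Antitone E') (n : ℕ) : |E n - E' n| ≤ ‖A - B‖ := by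
  have key : ∀ x : H, ‖x‖ = 1 → |RCLike.re ⟪x, A x⟫_ℂ - RCLike.re ⟪x, B x⟫_ℂ| ≤ ‖A - B‖ := by
    intro x hx
    rw [← map_sub, ← inner_sub_right, ← sub_apply]
    refine (RCLike.abs_re_le_norm _).trans ((norm_inner_le_norm _ _).trans ?_)
    have := (A - B).le_opNorm x
    rw [hx] at this ⊢
    linarith
  rw [abs_sub_le_iff]
  constructor
  · obtain ⟨x, -, hx1, h1, h2⟩ := hA.exists_le_inner_le hB hE hE' n
    linarith [(abs_le.1 (key x hx1)).2]
  · obtain ⟨x, -, hx1, h1, h2⟩ := hB.exists_le_inner_le hA hE' hE n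
    linarith [(abs_le.1 (key x hx1)).1]

theorem IsEigenvalueSequence.neg {A : H →L[ℂ] H} {V : Submodule ℂ H} {E : ℕ → ℝ}
    (hA : IsEigenvalueSequence A V E) : IsEigenvalueSequence (-A) V (fun n => -E n) := by
  obtain ⟨e, he, hV, h⟩ := hA
  exact ⟨e, he, hV, fun n => by simp [h n]⟩

/-- A compact selfadjoint operator with finite trace that is positive definite on an
infinite-dimensional closed subspace and vanishes on its complement has a descending eigenvalue
sequence. -/
theorem exists_isEigenvalueSequence [CompleteSpace H] {A : H →L[ℂ] H} {V : Submodule ℂ H} [CompleteSpace V]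
    (hc : IsCompactOperator A) (hs : A.IsSymmetric)
    (hpos : ∀ x ∈ V, x ≠ 0 → 0 < RCLike.re ⟪x, A x⟫_ℂ) (hperp : ∀ x ∈ Vᗮ, A x = 0)
    (hinf : ¬ FiniteDimensional ℂ V) {C : ℝ}
    (htr : ∀ (ι : Type) (s : Finset ι) (b : ι → H), Orthonormal ℂ b →
      ∑ i ∈ s, RCLike.re ⟪b i, A (b i)⟫_ℂ ≤ C) :
    ∃ E : ℕ → ℝ, IsEigenvalueSequence A V E ∧ Antitone E := by
  -- The index set collects orthonormal bases of all eigenspaces with nonzero eigenvalue, each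
  -- finite-dimensional by compactness.
  let ι : Type := Σ μ : {μ : ℂ // μ ≠ 0},
    Fin (Module.finrank ℂ (Module.End.eigenspace (A : Module.End ℂ H) μ))
  have hfd : ∀ μ : {μ : ℂ // μ ≠ 0},
      FiniteDimensional ℂ (Module.End.eigenspace (A : Module.End ℂ H) μ) := fun μ =>
    ContinuousLinearMap.finite_dimensional_eigenspace hc μ μ.2
  let b₀ := fun μ : {μ : ℂ // μ ≠ 0} =>
    stdOrthonormalBasis ℂ (Module.End.eigenspace (A : Module.End ℂ H) μ)
  let b : ι → H := fun i => b₀ i.1 i.2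
  have hb : Orthonormal ℂ b :=
    (hs.orthogonalFamily_eigenspaces.comp
      (Subtype.coe_injective (p := fun μ : ℂ => μ ≠ 0))).orthonormal_sigma_orthonormal
      (v_family := fun μ => ⇑(b₀ μ)) fun μ => (b₀ μ).orthonormal
  have hAb : ∀ i, A (b i) = (i.1 : ℂ) • b i := fun i =>
    Module.End.mem_eigenspace_iff.1 (b₀ i.1 i.2).2
  have hVV : Vᗮᗮ = V := Submodule.orthogonal_orthogonal V
  have hrange : ∀ x, A x ∈ V := fun x => by
    rw [← hVV, Submodule.mem_orthogonal]
    intro y hy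
    have := hs y x
    simp only [ContinuousLinearMap.coe_coe, hperp y hy, inner_zero_left] at this
    exact this.symm
  have hbV : ∀ i, b i ∈ V := fun i => by
    have h1 := V.smul_mem ((i.1 : ℂ)⁻¹) (hrange (b i))
    rwa [hAb, smul_smul, inv_mul_cancel₀ i.1.2, one_smul] at h1
  let v : ι → ℝ := fun i => RCLike.re ⟪b i, A (b i)⟫_ℂ
  have hbne : ∀ i, b i ≠ 0 := fun i => hb.ne_zero i
  have hv : ∀ i, 0 < v i := fun i => hpos _ (hbV i) (hbne i)
  have hvμ : ∀ i, ((v i : ℝ) : ℂ) = i.1 := fun i => by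
    have h1 : conj (i.1 : ℂ) = i.1 := hs.conj_eigenvalue_eq_self
      (Module.End.hasEigenvalue_of_hasEigenvector ⟨(b₀ i.1 i.2).2, hbne i⟩)
    have h2 : v i = (i.1 : ℂ).re := by
      simp [v, hAb, inner_self_eq_norm_sq_to_K, hb.1 i]
    rw [h2]
    exact Complex.conj_eq_iff_re.1 h1
  have hsum : Summable v :=
    summable_of_sum_le (fun i => (hv i).le) fun s => htr ι s b hb
  -- A vector orthogonal to all `b i` has a `V`-component `y` orthogonal to every eigenspace: for
  -- nonzero eigenvalues by construction, and for `0` because positive definiteness puts the kernel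
  -- in `Vᗮ`. The spectral theorem then forces `y = 0`.
  have hdense : (Submodule.span ℂ (Set.range b)).topologicalClosure = V := by
    refine le_antisymm (Submodule.topologicalClosure_minimal _
      (Submodule.span_le.2 (by rintro _ ⟨i, rfl⟩; exact hbV i))
      (completeSpace_coe_iff_isComplete.1 inferInstance : IsComplete (V : Set H)).isClosed) ?_
    have h1 : (Submodule.span ℂ (Set.range b))ᗮ ≤ Vᗮ := by
      intro x hx
      have hxb : ∀ i, ⟪b i, x⟫_ℂ = 0 := fun i =>
        (Submodule.mem_orthogonal _ _).1 hx _ (Submodule.subset_span ⟨i, rfl⟩)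
      obtain ⟨y, hy, z, hz, hyz⟩ := V.exists_add_mem_mem_orthogonal x
      have hyb : ∀ i, ⟪b i, y⟫_ℂ = 0 := fun i => by
        have := hxb i
        rwa [hyz, inner_add_right, (Submodule.mem_orthogonal _ _).1 hz _ (hbV i), add_zero] at this
      have hy0 : y ∈ (⨆ μ, Module.End.eigenspace (A : Module.End ℂ H) μ)ᗮ := by
        rw [← Submodule.iInf_orthogonal, Submodule.mem_iInf]
        intro μ
        rw [Submodule.mem_orthogonal]
        intro w hw
        by_cases hμ : μ = 0
        · have hAw : A w = 0 := by
            have := Module.End.mem_eigenspace_iff.1 hw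
            rw [hμ, zero_smul] at this
            exact this
          obtain ⟨w₁, hw₁, w₂, hw₂, hww⟩ := V.exists_add_mem_mem_orthogonal w
          have hAw₁ : A w₁ = 0 := by
            rw [hww, map_add, hperp _ hw₂, add_zero] at hAw
            exact hAw
          have : w₁ = 0 := by
            by_contra h0
            have := hpos _ hw₁ h0
            simp [hAw₁] at this
          rw [hww, this, zero_add]
          exact (Submodule.mem_orthogonal' _ _).1 hw₂ _ hy
        · have h2 := (b₀ ⟨μ, hμ⟩).sum_repr ⟨w, hw⟩
          have h3 := congrArg Subtype.val h2
          simp only at h3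
          rw [← h3]
          simp only [AddSubmonoidClass.coe_finsetSum, Submodule.coe_smul, sum_inner,
            inner_smul_left]
          exact Finset.sum_eq_zero fun i _ => mul_eq_zero_of_right _ (hyb ⟨⟨μ, hμ⟩, i⟩)
      rw [ContinuousLinearMap.orthogonalComplement_iSup_eigenspaces_eq_bot hc hs,
        Submodule.mem_bot] at hy0
      rw [hyz, hy0, zero_add]
      exact hz
    have h2 := Submodule.orthogonal_le h1
    rw [hVV] at h2
    rwa [← Submodule.orthogonal_orthogonal_eq_closure]
  have : Infinite ι := by
    by_contra hfin
    rw [not_infinite_iff_finite] at hfin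
    apply hinf
    have : FiniteDimensional ℂ (Submodule.span ℂ (Set.range b)) :=
      FiniteDimensional.span_of_finite ℂ (Set.finite_range b)
    rw [← hdense, (Submodule.closed_of_finiteDimensional
      (Submodule.span ℂ (Set.range b))).submodule_topologicalClosure_eq]
    exact this
  -- The trace bound makes the positive eigenvalues summable. This gives countability here and
  -- finite superlevel sets below, as the enumeration requires.
  have : Countable ι := by
    have h1 := hsum.countable_support
    have h2 : Function.support v = Set.univ := Set.eq_univ_of_forall fun i => (hv i).ne'
    rw [h2] at h1
    exact Set.countable_univ_iff.1 h1
  obtain ⟨σ, hσ⟩ := exists_equiv_nat_antitone v fun i => by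
    have h1 := hsum.tendsto_cofinite_zero.eventually_lt_const (hv i)
    rw [Filter.eventually_cofinite] at h1
    simpa using h1
  refine ⟨v ∘ σ, ⟨b ∘ σ, hb.comp _ σ.injective, ?_, fun n => ?_⟩, hσ⟩
  · rwa [σ.surjective.range_comp]
  · simp only [Function.comp_apply, hAb, hvμ]

end EigenvalueSequences

noncomputable section

/-! ### Hermite functions as Fourier integrals, and Mehler's formula. -/

section Hermite

open Complex

/-- The Gaussian weight `exp(-ξ²/2 + i x ξ)`. -/
def gaussianWave (x ξ : ℝ) : ℂ := cexp (-(ξ : ℂ) ^ 2 / 2 + I * x * ξ)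

/-- The `n`-th Hermite polynomial times `exp(-x²/2)`, normalised by `√n!` and up to a power of `i`,
written as a Fourier integral. -/
def hermiteWave (n : ℕ) (x : ℝ) : ℂ :=
  ((√(2 * Real.pi * n.factorial))⁻¹ : ℝ) * ∫ ξ : ℝ, (ξ : ℂ) ^ n * gaussianWave x ξ

theorem norm_gaussianWave (x ξ : ℝ) : ‖gaussianWave x ξ‖ = Real.exp (-ξ ^ 2 / 2) := by
  rw [gaussianWave, norm_exp]
  congr 1
  have : (-(ξ : ℂ) ^ 2 / 2 + I * x * ξ) = ((-ξ ^ 2 / 2 : ℝ) : ℂ) + ((x * ξ : ℝ) : ℂ) * I := by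
    push_cast; ring
  rw [this, add_re, ofReal_re, re_ofReal_mul, I_re, mul_zero, add_zero]

theorem integrable_abs_pow_mul_exp_neg_sq_half (n : ℕ) :
    Integrable fun ξ : ℝ => |ξ| ^ n * Real.exp (-ξ ^ 2 / 2) := by
  have h := integrable_rpow_mul_exp_neg_mul_sq (b := 1 / 2) (by norm_num) (s := n)
    (by have : (0 : ℝ) ≤ n := n.cast_nonneg
        linarith)
  refine h.norm.congr (Eventually.of_forall fun ξ => ?_)
  simp only [Real.rpow_natCast, norm_mul, norm_pow, Real.norm_eq_abs, Real.abs_exp]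
  congr 2
  ring

theorem norm_pow_mul_gaussianWave (n : ℕ) (x ξ : ℝ) :
    ‖(ξ : ℂ) ^ n * gaussianWave x ξ‖ = |ξ| ^ n * Real.exp (-ξ ^ 2 / 2) := by
  rw [norm_mul, norm_gaussianWave, norm_pow, norm_real, Real.norm_eq_abs]

theorem integrable_pow_mul_gaussianWave (n : ℕ) (x : ℝ) :
    Integrable fun ξ : ℝ => (ξ : ℂ) ^ n * gaussianWave x ξ := by
  refine (integrable_abs_pow_mul_exp_neg_sq_half n).mono' ?_
    (Eventually.of_forall fun ξ => (norm_pow_mul_gaussianWave n x ξ).le)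
  exact (by unfold gaussianWave; fun_prop : Continuous fun ξ : ℝ =>
    (ξ : ℂ) ^ n * gaussianWave x ξ).aestronglyMeasurable

theorem continuous_hermiteWave (n : ℕ) : Continuous (hermiteWave n) := by
  refine continuous_const.mul (continuous_of_dominated (fun x => ?_) (fun x => Eventually.of_forall
    fun ξ => (norm_pow_mul_gaussianWave n x ξ).le) (integrable_abs_pow_mul_exp_neg_sq_half n)
    (Eventually.of_forall fun ξ => ?_))
  · exact (integrable_pow_mul_gaussianWave n x).aestronglyMeasurable
  · unfold gaussianWave
    fun_prop

theorem hermiteWave_neg (n : ℕ) (x : ℝ) : hermiteWave n (-x) = (-1) ^ n * hermiteWave n x := by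
  unfold hermiteWave
  rw [← integral_neg_eq_self (fun ξ : ℝ => (ξ : ℂ) ^ n * gaussianWave (-x) ξ), mul_left_comm,
    ← integral_const_mul ((-1 : ℂ) ^ n)]
  congr 1
  refine integral_congr_ae (Eventually.of_forall fun ξ => ?_)
  simp only
  rw [← mul_assoc, ← mul_pow]
  congr 1
  · push_cast
    ring
  · unfold gaussianWave
    congr 1
    push_cast
    ring

theorem conj_hermiteWave (n : ℕ) (x : ℝ) : conj (hermiteWave n x) = hermiteWave n (-x) := by
  unfold hermiteWave
  rw [map_mul, conj_ofReal, ← integral_conj]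
  congr 1
  refine integral_congr_ae (Eventually.of_forall fun ξ => ?_)
  simp only
  rw [map_mul, map_pow, conj_ofReal, gaussianWave, gaussianWave, ← exp_conj]
  congr 2
  have : conj (2 : ℂ) = 2 := map_ofNat _ 2
  simp [this]

/-- Keeps `1 - r²` in the right half-plane, where the Gaussian integral converges and the principal
square root is compatible with inversion. -/
theorem one_sub_sq_re_pos {r : ℂ} (hr : ‖r‖ < 1) : 0 < (1 - r ^ 2).re := by
  have h1 : ‖r ^ 2‖ < 1 := by
    rw [norm_pow]
    exact pow_lt_one₀ (norm_nonneg _) hr two_ne_zero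
  have := re_le_norm (r ^ 2)
  rw [sub_re, one_re]
  linarith

/-- The closed form of the Mehler series. -/
def mehlerKernel (r : ℂ) (t s : ℝ) : ℂ :=
  ((1 - r ^ 2) ^ (1 / 2 : ℂ))⁻¹ *
    cexp (-((t : ℂ) ^ 2 - 2 * r * t * s + (s : ℂ) ^ 2) / (2 * (1 - r ^ 2)))

/-- Two successive Gaussian integrals by completing the square, first in `ξ`, then in `η`, where the
quadratic coefficient is `(1 - r²) / 2`. Expanding `exp(r ξ η)` in the same double integral produces
the Mehler series. -/
theorem inv_two_pi_mul_integral_gaussian {r : ℂ} (hr : ‖r‖ < 1) (t s : ℝ) :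
    ((2 * Real.pi : ℝ) : ℂ)⁻¹ * ∫ η : ℝ, ∫ ξ : ℝ,
      cexp (r * ξ * η) * (gaussianWave t ξ * gaussianWave (-s) η) = mehlerKernel r t s := by
  have hpi : ((2 * Real.pi : ℝ) : ℂ) ≠ 0 := by
    exact_mod_cast (by positivity : (2 * Real.pi : ℝ) ≠ 0)
  have hre := one_sub_sq_re_pos hr
  have hS : (1 - r ^ 2) ≠ 0 := fun h => by simp [h] at hre
  have h1 : ∀ η : ℝ, ∫ ξ : ℝ, cexp (r * ξ * η) * (gaussianWave t ξ * gaussianWave (-s) η)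
      = ((2 * Real.pi : ℝ) : ℂ) ^ (1 / 2 : ℂ) *
        cexp (-((1 - r ^ 2) / 2) * η ^ 2 + I * (r * t - s) * η + -(t : ℂ) ^ 2 / 2) := by
    intro η
    have := integral_cexp_quadratic (b := -(1 / 2)) (by norm_num) (r * η + I * t)
      (-(η : ℂ) ^ 2 / 2 + I * (-s) * η)
    convert this using 1
    · congr 1
      ext ξ
      rw [gaussianWave, gaussianWave, ← exp_add, ← exp_add]
      congr 1
      push_cast
      ring
    · congr 2
      · push_cast
        ring
      · have : I ^ 2 = -1 := I_sq
        ring_nf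
        rw [this]
        ring
  simp_rw [h1]
  rw [integral_const_mul, integral_cexp_quadratic (b := -((1 - r ^ 2) / 2))
    (by rw [neg_re, show (1 - r ^ 2) / 2 = (1 - r ^ 2) / (2 : ℝ) by norm_num, div_ofReal_re]
        linarith)]
  have h2 : (Real.pi / - -((1 - r ^ 2) / 2) : ℂ) ^ (1 / 2 : ℂ)
      = ((2 * Real.pi : ℝ) : ℂ) ^ (1 / 2 : ℂ) * ((1 - r ^ 2) ^ (1 / 2 : ℂ))⁻¹ := by
    rw [show (Real.pi / - -((1 - r ^ 2) / 2) : ℂ) = ((2 * Real.pi : ℝ) : ℂ) * (1 - r ^ 2)⁻¹ by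
      push_cast; field_simp]
    have harg : (1 - r ^ 2).arg ≠ Real.pi := fun h => by
      have := (arg_eq_pi_iff.1 h).1
      linarith
    rw [← inv_cpow _ _ harg, cpow_def_of_ne_zero (mul_ne_zero hpi (inv_ne_zero hS)),
      cpow_def_of_ne_zero hpi, cpow_def_of_ne_zero (inv_ne_zero hS),
      log_ofReal_mul (by positivity) (inv_ne_zero hS), add_mul, exp_add,
      ofReal_log (by positivity)]
  have h3 : ((2 * Real.pi : ℝ) : ℂ) ^ (1 / 2 : ℂ) * ((2 * Real.pi : ℝ) : ℂ) ^ (1 / 2 : ℂ)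
      = ((2 * Real.pi : ℝ) : ℂ) := by
    rw [← cpow_add _ _ hpi]
    norm_num
  rw [h2, mehlerKernel]
  have h4 : (-(t : ℂ) ^ 2 / 2 - (I * (r * t - s)) ^ 2 / (4 * -((1 - r ^ 2) / 2)))
      = (-((t : ℂ) ^ 2 - 2 * r * t * s + (s : ℂ) ^ 2) / (2 * (1 - r ^ 2))) := by
    rw [mul_pow, I_sq]
    field_simp
    ring
  rw [h4]
  generalize ((2 * Real.pi : ℝ) : ℂ) ^ (1 / 2 : ℂ) = a at h3 ⊢
  rw [show ∀ x y : ℂ, a * (a * x * y) = a * a * (x * y) by intros; ring, h3,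
    inv_mul_cancel_left₀ hpi]

/-- Since `c |ξ η| ≤ c (ξ² + η²) / 2`, a Gaussian of rate `(1 - c) / 2` in each variable remains. -/
theorem integrable_exp_mul_gaussian {c : ℝ} (hc : c < 1) (hc0 : 0 ≤ c) :
    Integrable fun p : ℝ × ℝ => Real.exp (c * |p.1| * |p.2|) *
      (Real.exp (-p.1 ^ 2 / 2) * Real.exp (-p.2 ^ 2 / 2)) := by
  have hg : Integrable fun ξ : ℝ => Real.exp (-((1 - c) / 2) * ξ ^ 2) :=
    integrable_exp_neg_mul_sq (by linarith)
  refine (hg.mul_prod hg).mono' ?_ (Eventually.of_forall fun p => ?_)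
  · exact (by fun_prop : Continuous fun p : ℝ × ℝ => Real.exp (c * |p.1| * |p.2|) *
      (Real.exp (-p.1 ^ 2 / 2) * Real.exp (-p.2 ^ 2 / 2))).aestronglyMeasurable
  · rw [Real.norm_of_nonneg (by positivity), ← Real.exp_add, ← Real.exp_add, ← Real.exp_add]
    refine Real.exp_le_exp.2 ?_
    have h1 := mul_le_mul_of_nonneg_left (two_mul_le_add_sq |p.1| |p.2|) hc0
    rw [sq_abs, sq_abs] at h1
    nlinarith

theorem integrable_cexp_mul_of_norm_eq_gaussian {r : ℂ} (hr : ‖r‖ < 1) {w : ℝ × ℝ → ℂ}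
    (hw : Continuous w)
    (hnorm : ∀ p, ‖w p‖ = Real.exp (-p.1 ^ 2 / 2) * Real.exp (-p.2 ^ 2 / 2)) :
    Integrable fun p : ℝ × ℝ => cexp (r * p.1 * p.2) * w p := by
  refine (integrable_exp_mul_gaussian hr (norm_nonneg r)).mono' ((by fun_prop :
    Continuous fun p : ℝ × ℝ => cexp (r * p.1 * p.2)).mul hw).aestronglyMeasurable
    (Eventually.of_forall fun p => ?_)
  rw [norm_mul, hnorm]
  refine mul_le_mul_of_nonneg_right ?_ (by positivity)
  rw [norm_exp]
  refine Real.exp_le_exp.2 ((re_le_norm _).trans (le_of_eq ?_))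
  rw [norm_mul, norm_mul, norm_real, norm_real, Real.norm_eq_abs, Real.norm_eq_abs]

/-- Dominated convergence for the exponential series: the absolute values of its terms sum to
`exp(‖r‖ |ξ η|)`, which is integrable against the Gaussian weight. -/
theorem hasSum_integral_cexp_mul {r : ℂ} (hr : ‖r‖ < 1) {w : ℝ × ℝ → ℂ} (hw : Continuous w)
    (hnorm : ∀ p, ‖w p‖ = Real.exp (-p.1 ^ 2 / 2) * Real.exp (-p.2 ^ 2 / 2)) :
    HasSum (fun n : ℕ => ∫ p : ℝ × ℝ, (r * p.1 * p.2) ^ n / (n.factorial : ℂ) * w p)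
      (∫ p : ℝ × ℝ, cexp (r * p.1 * p.2) * w p) := by
  refine hasSum_integral_of_dominated_convergence
    (fun n p => (‖r‖ * |p.1| * |p.2|) ^ n / (n.factorial : ℝ) *
      (Real.exp (-p.1 ^ 2 / 2) * Real.exp (-p.2 ^ 2 / 2))) (fun n => ?_)
    (fun n => Eventually.of_forall fun p => ?_)
    (Eventually.of_forall fun p => (Real.summable_pow_div_factorial _).mul_right _) ?_
    (Eventually.of_forall fun p => ?_)
  · have : Continuous fun p : ℝ × ℝ => (r * p.1 * p.2) ^ n / (n.factorial : ℂ) :=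
      Continuous.div_const (by fun_prop) _
    exact (this.mul hw).aestronglyMeasurable
  · rw [norm_mul, hnorm, norm_div, norm_pow, norm_mul, norm_mul, norm_real, norm_real,
      Real.norm_eq_abs, Real.norm_eq_abs, norm_natCast]
  · refine (integrable_exp_mul_gaussian hr (norm_nonneg r)).congr
      (Eventually.of_forall fun p => ?_)
    simp only
    rw [tsum_mul_right, Real.exp_eq_exp_ℝ, NormedSpace.exp_eq_tsum_div]
  · have := NormedSpace.expSeries_div_hasSum_exp (r * p.1 * p.2 : ℂ)
    rw [← Complex.exp_eq_exp_ℂ] at this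
    exact this.mul_right _

/-- The double integral factorises, and the normalisation `√(2π n!)` absorbs `1 / (2π)` and `1 /
n!`. -/
theorem integral_pow_div_factorial_mul_gaussianWave (r : ℂ) (t s : ℝ) (n : ℕ) :
    ((2 * Real.pi : ℝ) : ℂ)⁻¹ * ∫ p : ℝ × ℝ, (r * p.1 * p.2) ^ n / (n.factorial : ℂ) *
      (gaussianWave t p.1 * gaussianWave (-s) p.2) =
      r ^ n * (hermiteWave n t * conj (hermiteWave n s)) := by
  rw [conj_hermiteWave, hermiteWave, hermiteWave]
  have h3 : ∀ p : ℝ × ℝ, (r * p.1 * p.2) ^ n / (n.factorial : ℂ) *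
      (gaussianWave t p.1 * gaussianWave (-s) p.2) = (r ^ n / (n.factorial : ℂ)) *
      (((p.1 : ℂ) ^ n * gaussianWave t p.1) * ((p.2 : ℂ) ^ n * gaussianWave (-s) p.2)) := by
    intro p
    ring
  simp_rw [h3]
  rw [integral_const_mul, Measure.volume_eq_prod,
    integral_prod_mul (fun x : ℝ => (x : ℂ) ^ n * gaussianWave t x)
    (fun y : ℝ => (y : ℂ) ^ n * gaussianWave (-s) y)]
  generalize (∫ x : ℝ, (x : ℂ) ^ n * gaussianWave t x) = a
  generalize (∫ y : ℝ, (y : ℂ) ^ n * gaussianWave (-s) y) = b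
  have h4 : (√(2 * Real.pi * n.factorial))⁻¹ * (√(2 * Real.pi * n.factorial))⁻¹
      = (2 * Real.pi)⁻¹ * (n.factorial : ℝ)⁻¹ := by
    rw [← mul_inv, Real.mul_self_sqrt (by positivity), mul_inv]
  generalize (√(2 * Real.pi * n.factorial))⁻¹ = c at h4 ⊢
  have h5 := congrArg (fun x : ℝ => (x : ℂ)) h4
  simp only [ofReal_mul] at h5
  rw [show r ^ n * (c * a * (c * b)) = c * c * (r ^ n * (a * b)) by ring, h5]
  push_cast
  ring

/-- **Mehler's formula.** -/
theorem hasSum_mehler {r : ℂ} (hr : ‖r‖ < 1) (t s : ℝ) :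
    HasSum (fun n => r ^ n * (hermiteWave n t * conj (hermiteWave n s))) (mehlerKernel r t s) := by
  rw [← inv_two_pi_mul_integral_gaussian hr]
  have hw : Continuous fun p : ℝ × ℝ => gaussianWave t p.1 * gaussianWave (-s) p.2 := by
    unfold gaussianWave
    fun_prop
  have hnorm : ∀ p : ℝ × ℝ, ‖gaussianWave t p.1 * gaussianWave (-s) p.2‖ =
      Real.exp (-p.1 ^ 2 / 2) * Real.exp (-p.2 ^ 2 / 2) := fun p => by
    rw [norm_mul, norm_gaussianWave, norm_gaussianWave]
  have h2 := (hasSum_integral_cexp_mul hr hw hnorm).mul_left ((2 * Real.pi : ℝ) : ℂ)⁻¹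
  simp only [integral_pow_div_factorial_mul_gaussianWave] at h2
  rwa [Measure.volume_eq_prod, integral_prod_symm _
    (integrable_cexp_mul_of_norm_eq_gaussian hr hw hnorm)] at h2

/-- On the diagonal with `r = q` the exponent simplifies, because `1 - q² = (1 - q)(1 + q)`. The
surviving Gaussian decay in `t` drives every integrability statement about the feature kernel. -/
theorem hasSum_mehler_self {q : ℝ} (hq : 0 ≤ q) (hq1 : q < 1) (t : ℝ) :
    HasSum (fun n => q ^ n * ‖hermiteWave n t‖ ^ 2)
      ((√(1 - q ^ 2))⁻¹ * Real.exp (-(t ^ 2 / (1 + q)))) := by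
  have h := hasSum_mehler (r := (q : ℂ)) (by simpa [abs_of_nonneg hq] using hq1) t t
  rw [← Complex.hasSum_ofReal]
  convert h using 1
  · ext n
    rw [mul_conj, normSq_eq_norm_sq]
    push_cast
    rfl
  · rw [mehlerKernel, Real.sqrt_eq_rpow]
    push_cast
    rw [ofReal_cpow (by nlinarith)]
    push_cast
    congr 2
    have h1 : (1 - (q : ℂ) ^ 2) = (1 - q) * (1 + q) := by ring
    have h2 : (1 - (q : ℂ)) ≠ 0 := by exact_mod_cast (by linarith : (1 - q) ≠ 0)
    have h3 : (1 + (q : ℂ)) ≠ 0 := by exact_mod_cast (by linarith : (1 + q) ≠ 0)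
    rw [h1]
    field_simp
    ring

end Hermite


/-! ### The square integrable feature kernel and the factorisation of the kernel of `T_θ`. -/

section Feature

open scoped BoundedContinuousFunction

/-- The measure on `(0, ∞) × ℕ` used to diagonalise the operators `T_θ` simultaneously. -/
def featureMeasure : Measure (ℝ × ℕ) := (volume.restrict (Set.Ioi 0)).prod Measure.count

instance : SFinite featureMeasure := by unfold featureMeasure; infer_instance

/-- The kernel of the operator which diagonalises the operators `T_θ` with `|cos θ| < q`. -/
def featureKernel (q : ℝ) (x : ℝ × ℕ) (s : ℝ) : ℂ :=
  ((√q ^ x.2 * √(Real.exp (-x.1) / (2 * Real.pi)) : ℝ) : ℂ) * conj (hermiteWave x.2 (√x.1 * s))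

theorem measurable_featureKernel (q : ℝ) : Measurable (Function.uncurry (featureKernel q)) := by
  have h : Measurable fun p : (ℝ × ℝ) × ℕ => featureKernel q (p.1.1, p.2) p.1.2 := by
    refine measurable_from_prod_countable_left fun n => ?_
    have h1 : Continuous fun p : ℝ × ℝ => conj (hermiteWave n (√p.1 * p.2)) :=
      Complex.continuous_conj.comp ((continuous_hermiteWave n).comp (by fun_prop))
    have h2 : Continuous fun p : ℝ × ℝ =>
      ((√q ^ n * √(Real.exp (-p.1) / (2 * Real.pi)) : ℝ) : ℂ) := by fun_prop
    exact (h2.mul h1).measurable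
  have hg : Measurable fun p : (ℝ × ℕ) × ℝ => ((p.1.1, p.2), p.1.2) := by fun_prop
  exact h.comp hg

theorem norm_sq_featureKernel {q : ℝ} (hq : 0 ≤ q) (x : ℝ × ℕ) (s : ℝ) :
    ‖featureKernel q x s‖ ^ 2 =
      Real.exp (-x.1) / (2 * Real.pi) * (q ^ x.2 * ‖hermiteWave x.2 (√x.1 * s)‖ ^ 2) := by
  have h : (√q ^ x.2) ^ 2 = q ^ x.2 := by rw [← pow_mul, mul_comm, pow_mul, Real.sq_sqrt hq]
  rw [featureKernel, norm_mul, RCLike.norm_conj, Complex.norm_real,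
    Real.norm_of_nonneg (by positivity), mul_pow, mul_pow, h, Real.sq_sqrt (by positivity)]
  ring

theorem hasSum_norm_sq_featureKernel {q : ℝ} (hq : 0 ≤ q) (hq1 : q < 1) {l : ℝ} (hl : 0 ≤ l)
    (s : ℝ) : HasSum (fun n : ℕ => ‖featureKernel q (l, n) s‖ ^ 2)
      (Real.exp (-l) / (2 * Real.pi) *
        ((√(1 - q ^ 2))⁻¹ * Real.exp (-(l * s ^ 2 / (1 + q))))) := by
  have h := (hasSum_mehler_self hq hq1 (√l * s)).mul_left (Real.exp (-l) / (2 * Real.pi))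
  rw [mul_pow, Real.sq_sqrt hl] at h
  simpa only [norm_sq_featureKernel hq] using h

theorem tsum_ofReal_norm_sq_featureKernel {q : ℝ} (hq : 0 ≤ q) (hq1 : q < 1) {l : ℝ} (hl : 0 ≤ l)
    (s : ℝ) : ∑' n : ℕ, ENNReal.ofReal (‖featureKernel q (l, n) s‖ ^ 2) =
      ENNReal.ofReal (Real.exp (-l) / (2 * Real.pi) *
        ((√(1 - q ^ 2))⁻¹ * Real.exp (-(l * s ^ 2 / (1 + q))))) := by
  have h := hasSum_norm_sq_featureKernel hq hq1 hl s
  rw [← h.tsum_eq, ENNReal.ofReal_tsum_of_nonneg (fun n => by positivity) h.summable]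

theorem memLp_featureKernel {q : ℝ} (hq : 0 ≤ q) (hq1 : q < 1) (s : ℝ) :
    MemLp (fun x => featureKernel q x s) 2 featureMeasure := by
  have hm : Measurable fun x => featureKernel q x s :=
    (measurable_featureKernel q).comp measurable_prodMk_right
  rw [memLp_two_iff_integrable_sq_norm hm.aestronglyMeasurable]
  refine ⟨(hm.norm.pow_const 2).aestronglyMeasurable, ?_⟩
  rw [hasFiniteIntegral_iff_ofReal (Eventually.of_forall fun x => by positivity), featureMeasure,
    lintegral_prod _ (hm.norm.pow_const 2).ennreal_ofReal.aemeasurable]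
  simp only [lintegral_count]
  have hb : ∀ᵐ l : ℝ ∂(volume.restrict (Set.Ioi 0)),
      ∑' n : ℕ, ENNReal.ofReal (‖featureKernel q (l, n) s‖ ^ 2) ≤
        ENNReal.ofReal ((2 * Real.pi)⁻¹ * (√(1 - q ^ 2))⁻¹ * Real.exp (-l)) := by
    filter_upwards [ae_restrict_mem measurableSet_Ioi] with l hl
    have hl' : 0 ≤ l := le_of_lt hl
    rw [tsum_ofReal_norm_sq_featureKernel hq hq1 hl']
    refine ENNReal.ofReal_le_ofReal ?_
    have h1 : Real.exp (-(l * s ^ 2 / (1 + q))) ≤ 1 := Real.exp_le_one_iff.2 (by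
      rw [neg_nonpos]; positivity)
    calc _ ≤ Real.exp (-l) / (2 * Real.pi) * ((√(1 - q ^ 2))⁻¹ * 1) := by gcongr
      _ = _ := by ring
  refine (lintegral_mono_ae hb).trans_lt ?_
  have hi : IntegrableOn (fun l : ℝ => (2 * Real.pi)⁻¹ * (√(1 - q ^ 2))⁻¹ * Real.exp (-l))
      (Set.Ioi 0) := (integrableOn_exp_neg_Ioi 0).const_mul _
  have := hi.hasFiniteIntegral
  rwa [hasFiniteIntegral_iff_ofReal (Eventually.of_forall fun x => by positivity)] at this

theorem lintegral_gaussian {a : ℝ} (ha : 0 < a) :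
    ∫⁻ s : ℝ, ENNReal.ofReal (Real.exp (-a * s ^ 2)) = ENNReal.ofReal (√(Real.pi / a)) := by
  rw [← integral_gaussian, ofReal_integral_eq_lintegral_ofReal (integrable_exp_neg_mul_sq ha)
    (Eventually.of_forall fun s => by positivity)]

/-- Tonelli: the sum over `n` is Mehler's formula on the diagonal, the Gaussian integral over `s`
contributes a multiple of `l ^ (-1/2)`, and `exp(-l) l ^ (-1/2)` is the integrand of `Γ(1/2)`. -/
theorem isHilbertSchmidtKernel_featureKernel {q : ℝ} (hq : 0 ≤ q) (hq1 : q < 1) :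
    IsHilbertSchmidtKernel (featureKernel q) featureMeasure volume := by
  have hm := measurable_featureKernel q
  refine ⟨hm, ?_⟩
  have hm2 : Measurable fun p : (ℝ × ℕ) × ℝ => ‖featureKernel q p.1 p.2‖ ^ 2 := hm.norm.pow_const 2
  refine ⟨hm2.aestronglyMeasurable, ?_⟩
  rw [hasFiniteIntegral_iff_ofReal (Eventually.of_forall fun x => by positivity),
    lintegral_prod _ hm2.ennreal_ofReal.aemeasurable, featureMeasure,
    lintegral_prod _ (hm2.ennreal_ofReal.lintegral_prod_right').aemeasurable]
  simp only [lintegral_count]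
  set C : ℝ := (2 * Real.pi)⁻¹ * (√(1 - q ^ 2))⁻¹ with hC
  have hC0 : 0 ≤ C := by positivity
  have hb : ∀ᵐ l : ℝ ∂(volume.restrict (Set.Ioi 0)),
      ∑' n : ℕ, ∫⁻ s : ℝ, ENNReal.ofReal (‖featureKernel q (l, n) s‖ ^ 2) ≤
        ENNReal.ofReal (C * √(Real.pi * (1 + q)) * (Real.exp (-l) * l ^ ((1 / 2 : ℝ) - 1))) := by
    filter_upwards [ae_restrict_mem measurableSet_Ioi] with l hl
    have hl0 : 0 < l := hl
    rw [← lintegral_tsum (f := fun n s => ENNReal.ofReal (‖featureKernel q (l, n) s‖ ^ 2))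
      fun n => (hm2.ennreal_ofReal.comp
      (measurable_prodMk_left (x := ((l, n) : ℝ × ℕ)))).aemeasurable]
    simp only [tsum_ofReal_norm_sq_featureKernel hq hq1 hl0.le]
    have h1 : ∀ s : ℝ, ENNReal.ofReal (Real.exp (-l) / (2 * Real.pi) *
        ((√(1 - q ^ 2))⁻¹ * Real.exp (-(l * s ^ 2 / (1 + q))))) =
        ENNReal.ofReal (C * Real.exp (-l)) *
          ENNReal.ofReal (Real.exp (-(l / (1 + q)) * s ^ 2)) := fun s => by
      rw [← ENNReal.ofReal_mul (by positivity), hC]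
      congr 1
      rw [show -(l * s ^ 2 / (1 + q)) = -(l / (1 + q)) * s ^ 2 by ring]
      ring
    simp only [h1]
    rw [lintegral_const_mul' _ _ ENNReal.ofReal_ne_top, lintegral_gaussian (by positivity),
      ← ENNReal.ofReal_mul (by positivity)]
    refine ENNReal.ofReal_le_ofReal (le_of_eq ?_)
    rw [show Real.pi / (l / (1 + q)) = Real.pi * (1 + q) * l⁻¹ by field_simp,
      Real.sqrt_mul (by positivity), Real.sqrt_inv, Real.sqrt_eq_rpow l,
      ← Real.rpow_neg hl0.le]
    norm_num
    ring
  refine (lintegral_mono_ae hb).trans_lt ?_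
  have hi : IntegrableOn (fun l : ℝ => C * √(Real.pi * (1 + q)) *
      (Real.exp (-l) * l ^ ((1 / 2 : ℝ) - 1))) (Set.Ioi 0) :=
    (Real.GammaIntegral_convergent (by norm_num)).const_mul _
  have := hi.hasFiniteIntegral
  rwa [hasFiniteIntegral_iff_ofReal] at this
  filter_upwards [ae_restrict_mem measurableSet_Ioi] with l hl
  have : (0 : ℝ) < l := hl
  positivity

/-- The kernel of `T_θ` in terms of `r = cos θ`. -/
def cosKernel (r : ℂ) (t s : ℝ) : ℂ :=
  1 / (2 * (Real.pi : ℂ) * (1 - r ^ 2) ^ (1 / 2 : ℂ)) *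
    (1 / (((t : ℂ) ^ 2 - 2 * r * t * s + (s : ℂ) ^ 2) / (2 * (1 - r ^ 2)) + 1))

theorem thetaKernel_eq_cosKernel (θ : ℂ) : thetaKernel θ = cosKernel (Complex.cos θ) := by
  ext t s
  rw [thetaKernel, cosKernel, Complex.sin_sq]

/-- The quotient equals `(t + s)² / (4 (1 + r)) + (t - s)² / (4 (1 - r))`, and `1 / (1 ± r)` has
nonnegative real part. So the denominator of the kernel never vanishes. -/
theorem re_quadratic_nonneg {r : ℂ} (hr : ‖r‖ < 1) (t s : ℝ) :
    0 ≤ (((t : ℂ) ^ 2 - 2 * r * t * s + (s : ℂ) ^ 2) / (2 * (1 - r ^ 2))).re := by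
  have key : ∀ z : ℂ, ‖z‖ < 1 → 0 ≤ ((1 + z)⁻¹).re ∧ 1 + z ≠ 0 := fun z hz => by
    have h1 : 0 < (1 + z).re := by
      rw [Complex.add_re, Complex.one_re]
      linarith [neg_le_of_abs_le (Complex.abs_re_le_norm z)]
    refine ⟨?_, fun h => by simp [h] at h1⟩
    rw [Complex.inv_re]
    exact div_nonneg h1.le (Complex.normSq_nonneg _)
  obtain ⟨h1, h1'⟩ := key r hr
  obtain ⟨h2, h2'⟩ := key (-r) (by rwa [norm_neg])
  have h : ((t : ℂ) ^ 2 - 2 * r * t * s + (s : ℂ) ^ 2) / (2 * (1 - r ^ 2)) =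
      (((t + s) ^ 2 / 4 : ℝ) : ℂ) * (1 + r)⁻¹ + (((t - s) ^ 2 / 4 : ℝ) : ℂ) * (1 + -r)⁻¹ := by
    rw [show 1 - r ^ 2 = (1 + r) * (1 + -r) by ring]
    push_cast
    field_simp
    ring
  rw [h, Complex.add_re, Complex.re_ofReal_mul, Complex.re_ofReal_mul]
  positivity

/-- Scaling both variables by `√l` multiplies the exponent `-Q` of the Mehler kernel by `l`, so the
integral is `∫ exp(-(Q + 1) l) dl = 1 / (Q + 1)` up to the prefactor. -/
theorem integral_exp_mul_mehlerKernel {r : ℂ} (hr : ‖r‖ < 1) (t s : ℝ) :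
    ∫ l in Set.Ioi (0 : ℝ), ((Real.exp (-l) / (2 * Real.pi) : ℝ) : ℂ) *
      mehlerKernel r (√l * t) (√l * s) = cosKernel r t s := by
  set Q := ((t : ℂ) ^ 2 - 2 * r * t * s + (s : ℂ) ^ 2) / (2 * (1 - r ^ 2)) with hQ
  have hQ0 : 0 ≤ Q.re := re_quadratic_nonneg hr t s
  have h1 : ∀ l ∈ Set.Ioi (0 : ℝ), ((Real.exp (-l) / (2 * Real.pi) : ℝ) : ℂ) *
      mehlerKernel r (√l * t) (√l * s) =
      1 / (2 * (Real.pi : ℂ) * (1 - r ^ 2) ^ (1 / 2 : ℂ)) * Complex.exp (-(Q + 1) * l) := by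
    intro l hl
    have hs : ((√l : ℝ) : ℂ) * ((√l : ℝ) : ℂ) = l := by
      rw [← Complex.ofReal_mul, Real.mul_self_sqrt (le_of_lt hl)]
    rw [mehlerKernel, show -(Q + 1) * l = -l + -(Q * l) by ring, Complex.exp_add, hQ]
    have : -((((√l * t : ℝ) : ℂ)) ^ 2 - 2 * r * ((√l * t : ℝ) : ℂ) * ((√l * s : ℝ) : ℂ) +
        ((√l * s : ℝ) : ℂ) ^ 2) / (2 * (1 - r ^ 2)) =
        -(((t : ℂ) ^ 2 - 2 * r * t * s + (s : ℂ) ^ 2) / (2 * (1 - r ^ 2)) * l) := by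
      rw [← hs]
      push_cast
      ring
    rw [this]
    push_cast
    ring
  have hre : (-(Q + 1)).re < 0 := by
    rw [Complex.neg_re, Complex.add_re, Complex.one_re]
    linarith
  have hne : Q + 1 ≠ 0 := fun h => by simp [h] at hre
  rw [setIntegral_congr_fun measurableSet_Ioi h1, integral_const_mul,
    integral_exp_mul_complex_Ioi hre, cosKernel, ← hQ]
  rw [Complex.ofReal_zero, mul_zero, Complex.exp_zero, neg_div_neg_eq]

/-- The kernel of `T_θ` as a superposition of products of Hermite functions. -/
theorem integral_featureKernel {q : ℝ} (hq : 0 < q) (hq1 : q < 1) {r : ℂ} (hr : ‖r‖ ≤ q)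
    {φ : ℕ →ᵇ ℂ} (hφ : ∀ n, φ n = (r / q) ^ n) (t s : ℝ) :
    ∫ x, conj (featureKernel q x t) * (φ x.2 * featureKernel q x s) ∂featureMeasure =
      cosKernel r t s := by
  have hint : Integrable (fun x => conj (featureKernel q x t) * (φ x.2 * featureKernel q x s))
      featureMeasure := by
    refine (memLp_featureKernel hq.le hq1 t).star.integrable_mul (p := 2) (q := 2) ?_
    refine (memLp_featureKernel hq.le hq1 s).of_le_mul (c := ‖φ‖) ?_
      (Eventually.of_forall fun x => ?_)
    · exact (measurable_from_nat.comp measurable_snd).aestronglyMeasurable.mul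
        (memLp_featureKernel hq.le hq1 s).aestronglyMeasurable
    · rw [norm_mul]
      gcongr
      exact φ.norm_coe_le_norm _
  rw [← integral_exp_mul_mehlerKernel (hr.trans_lt hq1)]
  rw [featureMeasure] at hint ⊢
  rw [integral_prod _ hint]
  refine integral_congr_ae ?_
  filter_upwards [hint.prod_right_ae, ae_restrict_mem measurableSet_Ioi] with l hl hl0
  rw [integral_countable hl]
  -- The two factors `√q ^ n` of the feature kernels cancel the `q ^ n` in the denominator of `φ n`,
  -- leaving `r ^ n`.
  have hqn : ∀ n : ℕ, (√q ^ n * √q ^ n : ℝ) = q ^ n := fun n => by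
    rw [← mul_pow, Real.mul_self_sqrt hq.le]
  have h := (hasSum_mehler (hr.trans_lt hq1) (√l * t) (√l * s)).mul_left
    ((Real.exp (-l) / (2 * Real.pi) : ℝ) : ℂ)
  rw [← h.tsum_eq]
  refine tsum_congr fun n => ?_
  simp only [featureKernel, hφ, map_mul, Complex.conj_ofReal, Complex.conj_conj]
  have hc : Measure.real Measure.count {n} = 1 := by simp [Measure.real]
  rw [hc, one_smul]
  have hqC : (q : ℂ) ≠ 0 := by exact_mod_cast hq.ne'
  have e1 : ((√q ^ n * √q ^ n : ℝ) : ℂ) * (r / q) ^ n = r ^ n := by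
    rw [hqn]
    push_cast
    rw [← mul_pow, mul_div_cancel₀ _ hqC]
  have e2 : ((√(Real.exp (-l) / (2 * Real.pi)) * √(Real.exp (-l) / (2 * Real.pi)) : ℝ) : ℂ) =
      ((Real.exp (-l) / (2 * Real.pi) : ℝ) : ℂ) := by
    rw [Real.mul_self_sqrt (by positivity)]
  rw [← e1, ← e2]
  push_cast
  ring

end Feature


/-! ### Uniqueness for exponential moments and for the Laplace transform in `s²`. -/

section ExponentialUniqueness

open ProbabilityTheory

variable {α : Type*} [MeasurableSpace α] {μ : Measure α}

/-- The positive and negative parts of `h` are densities of two finite measures whose images under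
`X` have the same moment generating function, finite everywhere. Analytic continuation gives equal
characteristic functions, hence equal images. -/
theorem setIntegral_preimage_eq_zero_of_integral_exp_mul_real {X : α → ℝ} (hX : Measurable X)
    {h : α → ℝ} (hi : ∀ y : ℝ, Integrable (fun s => Real.exp (y * X s) * h s) μ)
    (h0 : ∀ y : ℝ, ∫ s, Real.exp (y * X s) * h s ∂μ = 0) {S : Set ℝ} (hS : MeasurableSet S) :
    ∫ s in X ⁻¹' S, h s ∂μ = 0 := by
  have hint : Integrable h μ := by simpa using hi 0
  let pos : Measure α := μ.withDensity fun s => ENNReal.ofReal (h s)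
  let neg : Measure α := μ.withDensity fun s => ENNReal.ofReal (-h s)
  have : IsFiniteMeasure pos := isFiniteMeasure_withDensity_ofReal hint.2
  have : IsFiniteMeasure neg := isFiniteMeasure_withDensity_ofReal hint.neg.2
  have hm1 : AEMeasurable (fun s => ENNReal.ofReal (h s)) μ := hint.1.aemeasurable.ennreal_ofReal
  have hm2 : AEMeasurable (fun s => ENNReal.ofReal (-h s)) μ :=
    hint.1.aemeasurable.neg.ennreal_ofReal
  have hexp : ∀ y : ℝ, Measurable fun s => Real.exp (y * X s) := fun y => by fun_prop
  have i1 : ∀ y : ℝ, Integrable (fun s => max (h s) 0 * Real.exp (y * X s)) μ := fun y => by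
    refine (hi y).mono ((hint.1.sup aestronglyMeasurable_const).mul
      (hexp y).aestronglyMeasurable) (Eventually.of_forall fun s => ?_)
    rw [norm_mul, norm_mul, mul_comm]
    gcongr
    rw [Real.norm_eq_abs, Real.norm_eq_abs, abs_of_nonneg (le_max_right _ _)]
    exact max_le (le_abs_self _) (abs_nonneg _)
  have i2 : ∀ y : ℝ, Integrable (fun s => max (-h s) 0 * Real.exp (y * X s)) μ := fun y => by
    refine (hi y).mono ((hint.1.neg.sup aestronglyMeasurable_const).mul
      (hexp y).aestronglyMeasurable) (Eventually.of_forall fun s => ?_)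
    rw [norm_mul, norm_mul, mul_comm]
    gcongr
    rw [Real.norm_eq_abs, Real.norm_eq_abs, abs_of_nonneg (le_max_right _ _)]
    exact max_le (neg_le_abs _) (abs_nonneg _)
  have hpos : ∀ y : ℝ, Integrable (fun s => Real.exp (y * X s)) pos := fun y => by
    rw [integrable_withDensity_iff_integrable_smul₀' hm1
      (Eventually.of_forall fun s => ENNReal.ofReal_lt_top)]
    simpa only [ENNReal.toReal_ofReal', smul_eq_mul] using i1 y
  have hmgf : mgf X pos = mgf X neg := by
    ext y
    rw [mgf, mgf, integral_withDensity_eq_integral_toReal_smul₀ hm1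
      (Eventually.of_forall fun s => ENNReal.ofReal_lt_top),
      integral_withDensity_eq_integral_toReal_smul₀ hm2
      (Eventually.of_forall fun s => ENNReal.ofReal_lt_top)]
    simp only [ENNReal.toReal_ofReal', smul_eq_mul]
    rw [← sub_eq_zero, ← integral_sub (i1 y) (i2 y)]
    refine Eq.trans ?_ (h0 y)
    refine integral_congr_ae (Eventually.of_forall fun s => ?_)
    simp only
    rw [← sub_mul, max_zero_sub_max_neg_zero_eq_self, mul_comm]
  have hset : integrableExpSet X pos = Set.univ := Set.eq_univ_of_forall hpos
  have huniv : pos Set.univ = neg Set.univ := by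
    have h1 := congrFun hmgf 0
    rw [mgf_zero', mgf_zero'] at h1
    exact (measureReal_eq_measureReal_iff).1 h1
  have hzero : pos = 0 ↔ neg = 0 := by
    rw [← Measure.measure_univ_eq_zero, ← Measure.measure_univ_eq_zero, huniv]
  have hmap : pos.map X = neg.map X := by
    refine Measure.ext_of_complexMGF_eq hX.aemeasurable hX.aemeasurable (funext fun z => ?_)
    exact eqOn_complexMGF_of_mgf' hmgf hzero (by simp [hset])
  have hS' := hX hS
  have hval := congrArg (fun m => m S) hmap
  simp only [Measure.map_apply hX hS] at hval
  simp only [pos, neg, withDensity_apply _ hS'] at hval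
  rw [integral_eq_lintegral_pos_part_sub_lintegral_neg_part hint.integrableOn, hval, sub_self]

/-- If all exponential moments in `X` of a function vanish, so do its integrals over sets defined
through `X`. -/
theorem setIntegral_preimage_eq_zero_of_integral_exp_mul {X : α → ℝ} (hX : Measurable X)
    {h : α → ℂ} (hi : ∀ y : ℝ, Integrable (fun s => (Real.exp (y * X s) : ℂ) * h s) μ)
    (h0 : ∀ y : ℝ, ∫ s, (Real.exp (y * X s) : ℂ) * h s ∂μ = 0) {S : Set ℝ}
    (hS : MeasurableSet S) : ∫ s in X ⁻¹' S, h s ∂μ = 0 := by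
  have hint : Integrable h μ := by simpa using hi 0
  apply Complex.ext
  · have h1 := setIntegral_preimage_eq_zero_of_integral_exp_mul_real (h := fun s => (h s).re) hX
      (fun y => by simpa [← Complex.ofReal_exp] using! (hi y).re) (fun y => by
        have := congrArg Complex.re (h0 y)
        rw [← RCLike.re_eq_complex_re, ← integral_re (hi y)] at this
        simpa [← Complex.ofReal_exp] using this) hS
    rw [← RCLike.re_eq_complex_re, ← integral_re hint.integrableOn]
    simpa using h1
  · have h1 := setIntegral_preimage_eq_zero_of_integral_exp_mul_real (h := fun s => (h s).im) hX
      (fun y => by simpa [← Complex.ofReal_exp] using! (hi y).im) (fun y => by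
        have := congrArg Complex.im (h0 y)
        rw [← RCLike.im_eq_complex_im, ← integral_im (hi y)] at this
        simpa [← Complex.ofReal_exp] using this) hS
    rw [← RCLike.im_eq_complex_im, ← integral_im hint.integrableOn]
    simpa using h1

theorem ae_eq_zero_of_integral_exp_mul_eq_zero {h : ℝ → ℂ}
    (hi : ∀ y : ℝ, Integrable (fun s => (Real.exp (y * s) : ℂ) * h s))
    (h0 : ∀ y : ℝ, ∫ s, (Real.exp (y * s) : ℂ) * h s = 0) : h =ᵐ[volume] 0 := by
  have hint : Integrable h := by simpa using hi 0
  exact hint.ae_eq_zero_of_forall_setIntegral_eq_zero fun S hS _ =>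
    setIntegral_preimage_eq_zero_of_integral_exp_mul measurable_id hi h0 hS

/-- Injectivity of the Laplace transform in `s²` on even functions. -/
theorem ae_eq_zero_of_integral_exp_neg_mul_sq_eq_zero {h : ℝ → ℂ} {a : ℝ} (ha : 0 < a)
    (hi : Integrable fun s => (Real.exp (-a * s ^ 2) : ℂ) * h s)
    (heven : ∀ᵐ s : ℝ, h (-s) = h s)
    (h0 : ∀ k : ℕ, ∫ s, (Real.exp (-((k + 1) * a) * s ^ 2) : ℂ) * h s = 0) : h =ᵐ[volume] 0 := by
  set g : ℝ → ℂ := fun s => (Real.exp (-a * s ^ 2) : ℂ) * h s with hg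
  set X : ℝ → ℝ := fun s => Real.exp (-a * s ^ 2) with hX
  have hXm : Measurable X := by fun_prop
  have hX1 : ∀ s, |X s| ≤ 1 := fun s => by
    rw [hX, Real.abs_exp]
    exact Real.exp_le_one_iff.2 (by nlinarith [sq_nonneg s])
  have hbound : ∀ (y : ℝ) (s : ℝ), ‖(Real.exp (y * X s) : ℂ)‖ ≤ Real.exp |y| := fun y s => by
    rw [Complex.norm_real, Real.norm_eq_abs, Real.abs_exp]
    refine Real.exp_le_exp.2 ((le_abs_self _).trans ?_)
    rw [abs_mul]
    exact mul_le_of_le_one_right (abs_nonneg _) (hX1 s)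
  have hgi : ∀ y : ℝ, Integrable fun s => (Real.exp (y * X s) : ℂ) * g s := fun y =>
    hi.bdd_mul (c := Real.exp |y|) (by fun_prop) (Eventually.of_forall fun s => hbound y s)
  -- Since `X = exp(-a s²)` is bounded, `exp(y X)` may be expanded under the integral; the moments
  -- `∫ X ^ k g` are the vanishing integrals of the hypothesis.
  have hg0 : ∀ y : ℝ, ∫ s, (Real.exp (y * X s) : ℂ) * g s = 0 := by
    intro y
    have hs : HasSum (fun k : ℕ => ∫ s, (((y * X s) ^ k / k.factorial : ℝ) : ℂ) * g s)
        (∫ s, (Real.exp (y * X s) : ℂ) * g s) := by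
      refine hasSum_integral_of_dominated_convergence
        (fun k s => |y| ^ k / k.factorial * ‖g s‖) (fun k => ?_)
        (fun k => Eventually.of_forall fun s => ?_)
        (Eventually.of_forall fun s => (Real.summable_pow_div_factorial _).mul_right _) ?_
        (Eventually.of_forall fun s => ?_)
      · have : Measurable fun s => (((y * X s) ^ k / k.factorial : ℝ) : ℂ) := by fun_prop
        exact this.aestronglyMeasurable.mul hi.1
      · rw [norm_mul, Complex.norm_real, norm_div, norm_pow, Real.norm_natCast, norm_mul]
        gcongr
        exact mul_le_of_le_one_right (abs_nonneg _) (hX1 s)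
      · simp only [tsum_mul_right]
        exact hi.norm.const_mul _
      · refine HasSum.mul_right _ ?_
        rw [Complex.hasSum_ofReal, Real.exp_eq_exp_ℝ]
        exact NormedSpace.expSeries_div_hasSum_exp _
    have hz : ∀ k : ℕ, ∫ s, (((y * X s) ^ k / k.factorial : ℝ) : ℂ) * g s = 0 := fun k => by
      have : ∀ s, (((y * X s) ^ k / k.factorial : ℝ) : ℂ) * g s =
          ((y ^ k / k.factorial : ℝ) : ℂ) *
            ((Real.exp (-((k + 1) * a) * s ^ 2) : ℂ) * h s) := fun s => by
        rw [hg, show -(((k : ℝ) + 1) * a) * s ^ 2 = k * (-a * s ^ 2) + -a * s ^ 2 by ring,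
          Real.exp_add, Real.exp_nat_mul, hX]
        push_cast
        ring
      simp only [this]
      rw [integral_const_mul, h0 k, mul_zero]
    simp only [hz] at hs
    exact hs.unique hasSum_zero
  -- `|s|` is recovered from `X s` as `√(-log X / a)`, so integrals of `g` over all measurable sets
  -- symmetric about the origin vanish.
  have hpre : ∀ E : Set ℝ, MeasurableSet E → ∫ s in {s | |s| ∈ E}, g s = 0 := by
    intro E hE
    have hT : MeasurableSet ((fun v : ℝ => √(-(Real.log v) / a)) ⁻¹' E) :=
      (by fun_prop : Measurable fun v : ℝ => √(-(Real.log v) / a)) hE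
    have := setIntegral_preimage_eq_zero_of_integral_exp_mul hXm hgi hg0 hT
    have hs : X ⁻¹' ((fun v : ℝ => √(-(Real.log v) / a)) ⁻¹' E) = {s | |s| ∈ E} := by
      ext s
      simp only [Set.mem_preimage, Set.mem_ofPred_eq, hX, Real.log_exp]
      rw [show -(-a * s ^ 2) / a = s ^ 2 by field_simp, Real.sqrt_sq_eq_abs]
    rwa [hs] at this
  have hgeven : ∀ᵐ s : ℝ, g (-s) = g s := by
    filter_upwards [heven] with s hs
    rw [hg]
    simp only [hs, even_two, Even.neg_pow]
  -- Evenness makes the integral over `E ∪ -E` twice the integral over `E`.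
  have hhalf : ∀ E : Set ℝ, MeasurableSet E → E ⊆ Set.Ioi 0 → ∫ s in E, g s = 0 := by
    intro E hE hE0
    have h1 : {s : ℝ | |s| ∈ E} = E ∪ (fun s => -s) ⁻¹' E := by
      ext s
      simp only [Set.mem_ofPred_eq, Set.mem_union, Set.mem_preimage]
      rcases le_total 0 s with hs | hs
      · rw [abs_of_nonneg hs]
        refine ⟨Or.inl, fun h => h.elim id fun h => ?_⟩
        have : (0 : ℝ) < -s := hE0 h
        linarith
      · rw [abs_of_nonpos hs]
        refine ⟨Or.inr, fun h => h.elim (fun h => ?_) id⟩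
        have : (0 : ℝ) < s := hE0 h
        linarith
    have hdisj : Disjoint E ((fun s => -s) ⁻¹' E) := by
      rw [Set.disjoint_left]
      intro s hs hs'
      have h2 : (0 : ℝ) < s := hE0 hs
      have h3 : (0 : ℝ) < -s := hE0 hs'
      linarith
    have h2 : ∫ s in (fun s : ℝ => -s) ⁻¹' E, g s = ∫ s in E, g s := by
      have := (Measure.measurePreserving_neg (volume : Measure ℝ)).setIntegral_preimage_emb
        (Homeomorph.neg ℝ).measurableEmbedding g E
      rw [← this]
      exact setIntegral_congr_ae (measurable_neg hE) (hgeven.mono fun s hs _ => hs.symm)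
    have h3 := hpre E hE
    rw [h1, setIntegral_union hdisj (measurable_neg hE) hi.integrableOn hi.integrableOn, h2,
      ← two_mul] at h3
    simpa using h3
  have hposz : ∀ᵐ s ∂(volume.restrict (Set.Ioi (0 : ℝ))), g s = 0 := by
    refine Integrable.ae_eq_zero_of_forall_setIntegral_eq_zero hi.integrableOn fun S hS _ => ?_
    rw [Measure.restrict_restrict hS]
    exact hhalf _ (hS.inter measurableSet_Ioi) Set.inter_subset_right
  rw [ae_restrict_iff' measurableSet_Ioi] at hposz
  have hnegz := (Measure.measurePreserving_neg
    (volume : Measure ℝ)).quasiMeasurePreserving.ae hposz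
  filter_upwards [hposz, hnegz, hgeven, compl_mem_ae_iff.2 (measure_singleton (0 : ℝ))]
    with s h1 h2 h3 h4
  have hs : g s = 0 := by
    rcases lt_or_gt_of_ne (show s ≠ 0 from h4) with hs | hs
    · rw [← h3]
      exact h2 (by simpa using hs)
    · exact h1 hs
  simpa [hg] using hs

end ExponentialUniqueness


/-! ### A square integrable function is determined by its Hermite coefficients with `n ≠ 0`. -/

section HermiteUniqueness

/-- A single term of the diagonal Mehler series at `q = 1/2` is at most its sum. -/
theorem pow_half_mul_norm_hermiteWave_le (n : ℕ) (x : ℝ) :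
    √(1 / 2) ^ n * ‖hermiteWave n x‖ ≤
      √((√(1 - (1 / 2 : ℝ) ^ 2))⁻¹ * Real.exp (-(x ^ 2 / (1 + 1 / 2)))) := by
  have h := hasSum_mehler_self (q := 1 / 2) (by norm_num) (by norm_num) x
  have h1 := le_hasSum h n fun m _ => by positivity
  refine Real.le_sqrt_of_sq_le ?_
  rwa [mul_pow, ← pow_mul, mul_comm n 2, pow_mul, Real.sq_sqrt (by norm_num)]

theorem memLp_sqrt_gaussian (C : ℝ) (hC : 0 ≤ C) {b : ℝ} (hb : 0 < b) :
    MemLp (fun s : ℝ => √(C * Real.exp (-b * s ^ 2))) 2 volume := by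
  rw [memLp_two_iff_integrable_sq_norm
    (by fun_prop : Continuous fun s : ℝ => √(C * Real.exp (-b * s ^ 2))).aestronglyMeasurable]
  refine ((integrable_exp_neg_mul_sq hb).const_mul C).congr (Eventually.of_forall fun s => ?_)
  simp only [Real.norm_eq_abs, sq_abs]
  rw [Real.sq_sqrt (by positivity)]

/-- Mehler's formula integrated against a square integrable function. -/
theorem hasSum_integral_mehler {r : ℂ} (hr : ‖r‖ ≤ 1 / 4) (x : ℝ) {a : ℝ} (ha : 0 < a) (f : L2R) :
    HasSum (fun n => r ^ n * (hermiteWave n x * ∫ s, conj (hermiteWave n (a * s)) * f s))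
      (∫ s, mehlerKernel r x (a * s) * f s) := by
  have hr1 : ‖r‖ < 1 := hr.trans_lt (by norm_num)
  set C : ℝ := (√(1 - (1 / 2 : ℝ) ^ 2))⁻¹ with hC
  set K : ℝ := √(C * Real.exp (-(x ^ 2 / (1 + 1 / 2)))) with hK
  set G : ℝ → ℝ := fun s => √(C * Real.exp (-(a ^ 2 / (1 + 1 / 2)) * s ^ 2)) with hG
  have hmeas : ∀ n, AEStronglyMeasurable
      (fun s : ℝ => r ^ n * (hermiteWave n x * (conj (hermiteWave n (a * s)) * f s))) volume :=
    fun n => by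
      have : Continuous fun s : ℝ => conj (hermiteWave n (a * s)) :=
        Complex.continuous_conj.comp ((continuous_hermiteWave n).comp (by fun_prop))
      exact ((this.aestronglyMeasurable.mul (Lp.aestronglyMeasurable f)).const_mul _).const_mul _
  have hint : Integrable fun s => K * (G s * ‖f s‖) :=
    ((memLp_sqrt_gaussian C (by positivity) (by positivity)).integrable_mul
      (Lp.memLp f).norm).const_mul K
  have key := hasSum_integral_of_dominated_convergence (μ := volume)
    (F := fun (n : ℕ) (s : ℝ) =>
      r ^ n * (hermiteWave n x * (conj (hermiteWave n (a * s)) * f s)))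
    (f := fun s => mehlerKernel r x (a * s) * f s)
    (fun n s => (1 / 2) ^ n * (K * (G s * ‖f s‖))) hmeas
    (fun n => Eventually.of_forall fun s => ?_)
    (Eventually.of_forall fun s => (summable_geometric_of_lt_one (by norm_num)
      (by norm_num)).mul_right _) ?_ (Eventually.of_forall fun s => ?_)
  · simpa only [integral_const_mul] using key
  · have h1 := pow_half_mul_norm_hermiteWave_le n x
    have h2 := pow_half_mul_norm_hermiteWave_le n (a * s)
    rw [show -((a * s) ^ 2 / (1 + 1 / 2)) = -(a ^ 2 / (1 + 1 / 2)) * s ^ 2 by ring] at h2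
    -- `4⁻ⁿ` is split into `2⁻ⁿ`, which makes the series converge, and one `√(1/2) ^ n` for each
    -- Hermite factor. This is the origin of the bound `1/4`.
    have h3 : ‖r‖ ^ n ≤ (1 / 2) ^ n * (√(1 / 2) ^ n * √(1 / 2) ^ n) := by
      rw [← mul_pow, ← mul_pow, Real.mul_self_sqrt (by norm_num)]
      exact pow_le_pow_left₀ (norm_nonneg _) (hr.trans (by norm_num)) n
    rw [norm_mul, norm_mul, norm_mul, norm_pow, RCLike.norm_conj]
    calc _ ≤ (1 / 2) ^ n * (√(1 / 2) ^ n * √(1 / 2) ^ n) *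
          (‖hermiteWave n x‖ * (‖hermiteWave n (a * s)‖ * ‖f s‖)) := by gcongr
      _ = (1 / 2) ^ n * ((√(1 / 2) ^ n * ‖hermiteWave n x‖) *
          ((√(1 / 2) ^ n * ‖hermiteWave n (a * s)‖) * ‖f s‖)) := by ring
      _ ≤ _ := by gcongr
  · simp only [tsum_mul_right]
    exact hint.const_mul _
  · have := (hasSum_mehler hr1 x (a * s)).mul_right (f s)
    simpa only [mul_assoc] using this

theorem integrable_exp_mul_exp_neg_mul_sq {b : ℝ} (hb : 0 < b) (y : ℝ) :
    Integrable fun s : ℝ => Real.exp (y * s) * Real.exp (-b * s ^ 2) := by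
  have := (integrable_cexp_quadratic (b := (b : ℂ)) (by rwa [Complex.ofReal_re]) (y : ℂ) 0).norm
  refine this.congr (Eventually.of_forall fun s => ?_)
  have h : -(b : ℂ) * (s : ℂ) ^ 2 + y * s + 0 = ((y * s + -b * s ^ 2 : ℝ) : ℂ) := by
    push_cast
    ring
  simp only
  rw [h, ← Complex.ofReal_exp, Complex.norm_real, Real.norm_eq_abs, Real.abs_exp, Real.exp_add]

/-- With only `n = 0` left, the integrated Mehler series does not depend on `r`. Comparing `r = 1/4`
with `r = 0` identifies the two-sided Laplace transform of `exp(-b s²) f` with that of a multiple of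
`exp(-b s²)`. So `f` is a.e. constant, and the only constant in `L²(ℝ)` is zero. -/
theorem eq_zero_of_integral_hermiteWave_eq_zero {f : L2R} {a : ℝ} (ha : 0 < a)
    (h : ∀ n ≠ 0, ∫ s, conj (hermiteWave n (a * s)) * f s = 0) : f = 0 := by
  have hval : ∀ {r : ℂ}, ‖r‖ ≤ 1 / 4 → ∀ x, ∫ s, mehlerKernel r x (a * s) * f s =
      hermiteWave 0 x * ∫ s, conj (hermiteWave 0 (a * s)) * f s := fun {r} hr x => by
    have h1 := hasSum_integral_mehler hr x ha f
    have h2 := hasSum_single (f := fun n => r ^ n * (hermiteWave n x *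
      ∫ s, conj (hermiteWave n (a * s)) * f s)) 0 fun n hn => by rw [h n hn, mul_zero, mul_zero]
    simpa using h1.unique h2
  -- At `r = 1/4` one has `2 (1 - r²) = 15/8`, which yields `8/15` and the cross term `4/15`; then
  -- `8/15 - 1/2 = 1/30` below.
  set b : ℝ := 8 / 15 * a ^ 2 with hb
  have hb0 : 0 < b := by positivity
  have hbC : (b : ℂ) ≠ 0 := by exact_mod_cast hb0.ne'
  set D : ℂ := ∫ s, (Real.exp (-(1 / 2 * a ^ 2) * s ^ 2) : ℂ) * f s with hD
  set κ : ℂ := (1 - ((1 / 4 : ℝ) : ℂ) ^ 2) ^ (1 / 2 : ℂ) with hκ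
  have hκ0 : κ ≠ 0 := by
    rw [hκ, Ne, Complex.cpow_eq_zero_iff]
    norm_num
  have hexp : ∀ x : ℝ, ∫ s, (Real.exp (4 / 15 * a * x * s) : ℂ) *
      ((Real.exp (-b * s ^ 2) : ℂ) * f s) = κ * D * (Real.exp (x ^ 2 / 30) : ℂ) := by
    intro x
    have h1 := (hval (r := ((1 / 4 : ℝ) : ℂ)) (by rw [Complex.norm_real]; norm_num) x).trans
      (hval (r := 0) (by norm_num) x).symm
    have e1 : ∀ s : ℝ, mehlerKernel ((1 / 4 : ℝ) : ℂ) x (a * s) * f s =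
        (κ⁻¹ * (Real.exp (-(8 / 15 * x ^ 2)) : ℂ)) * ((Real.exp (4 / 15 * a * x * s) : ℂ) *
        ((Real.exp (-b * s ^ 2) : ℂ) * f s)) := fun s => by
      rw [mehlerKernel, ← hκ]
      have : Complex.exp (-((x : ℂ) ^ 2 - 2 * ((1 / 4 : ℝ) : ℂ) * x * ((a * s : ℝ) : ℂ) +
          ((a * s : ℝ) : ℂ) ^ 2) / (2 * (1 - ((1 / 4 : ℝ) : ℂ) ^ 2))) =
          (Real.exp (-(8 / 15 * x ^ 2)) : ℂ) * ((Real.exp (4 / 15 * a * x * s) : ℂ) *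
            (Real.exp (-b * s ^ 2) : ℂ)) := by
        rw [← Complex.ofReal_mul, ← Complex.ofReal_mul, ← Real.exp_add, ← Real.exp_add, hb]
        push_cast
        congr 1
        ring
      rw [this]
      ring
    have e2 : ∀ s : ℝ, mehlerKernel 0 x (a * s) * f s =
        (Real.exp (-(1 / 2 * x ^ 2)) : ℂ) *
          ((Real.exp (-(1 / 2 * a ^ 2) * s ^ 2) : ℂ) * f s) := fun s => by
      rw [mehlerKernel, ← mul_assoc, ← Complex.ofReal_mul, ← Real.exp_add]
      have : -((x : ℂ) ^ 2 - 2 * 0 * x * ((a * s : ℝ) : ℂ) + ((a * s : ℝ) : ℂ) ^ 2) /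
          (2 * (1 - 0 ^ 2)) = ((-(1 / 2 * x ^ 2) + -(1 / 2 * a ^ 2) * s ^ 2 : ℝ) : ℂ) := by
        push_cast
        ring
      rw [this, ← Complex.ofReal_exp]
      simp
    simp only [e1, e2] at h1
    rw [integral_const_mul, integral_const_mul, ← hD] at h1
    have h3 : (Real.exp (8 / 15 * x ^ 2) : ℂ) * (Real.exp (-(8 / 15 * x ^ 2)) : ℂ) = 1 := by
      rw [← Complex.ofReal_mul, ← Real.exp_add]
      simp
    have h4 : (Real.exp (8 / 15 * x ^ 2) : ℂ) * (Real.exp (-(1 / 2 * x ^ 2)) : ℂ) =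
        (Real.exp (x ^ 2 / 30) : ℂ) := by
      rw [← Complex.ofReal_mul, ← Real.exp_add]
      congr 2
      ring
    generalize (∫ s, (Real.exp (4 / 15 * a * x * s) : ℂ) *
      ((Real.exp (-b * s ^ 2) : ℂ) * f s)) = J at h1 ⊢
    calc J = κ * κ⁻¹ * ((Real.exp (8 / 15 * x ^ 2) : ℂ) * (Real.exp (-(8 / 15 * x ^ 2)) : ℂ)) * J := by
          rw [h3, mul_inv_cancel₀ hκ0]; ring
      _ = κ * (Real.exp (8 / 15 * x ^ 2) : ℂ) *
          (κ⁻¹ * (Real.exp (-(8 / 15 * x ^ 2)) : ℂ) * J) := by ring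
      _ = _ := by rw [h1, ← h4]; ring
  set c : ℂ := κ * D / ((Real.pi : ℂ) / b) ^ (1 / 2 : ℂ) with hc
  have hG : ((Real.pi : ℂ) / b) ^ (1 / 2 : ℂ) ≠ 0 := by
    rw [Ne, Complex.cpow_eq_zero_iff]
    simp [hbC, Real.pi_ne_zero]
  have hgauss : ∀ y : ℝ, ∫ s : ℝ, (Real.exp (y * s) : ℂ) * (Real.exp (-b * s ^ 2) : ℂ) =
      ((Real.pi : ℂ) / b) ^ (1 / 2 : ℂ) * (Real.exp (y ^ 2 / (4 * b)) : ℂ) := fun y => by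
    have := integral_cexp_quadratic (b := -(b : ℂ)) (by simpa using hb0) y 0
    rw [neg_neg] at this
    convert this using 2
    · ext s
      rw [← Complex.ofReal_mul, ← Real.exp_add]
      push_cast
      congr 1
      ring
    · push_cast
      congr 1
      field_simp
      ring
  have hgi : ∀ y : ℝ, MemLp (fun s : ℝ => (Real.exp (y * s) : ℂ) * (Real.exp (-b * s ^ 2) : ℂ)) 2 :=
    fun y => by
      rw [memLp_two_iff_integrable_sq_norm (by fun_prop : Continuous fun s : ℝ =>
        (Real.exp (y * s) : ℂ) * (Real.exp (-b * s ^ 2) : ℂ)).aestronglyMeasurable]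
      refine (integrable_exp_mul_exp_neg_mul_sq (b := 2 * b) (by positivity) (2 * y)).congr
        (Eventually.of_forall fun s => ?_)
      simp only
      rw [← Complex.ofReal_mul, ← Real.exp_add, ← Real.exp_add, Complex.norm_real,
        Real.norm_eq_abs, Real.abs_exp, ← Real.exp_nat_mul]
      congr 1
      push_cast
      ring
  have hgi1 : ∀ y : ℝ, Integrable fun s : ℝ =>
      (Real.exp (y * s) : ℂ) * (Real.exp (-b * s ^ 2) : ℂ) := fun y => by
    refine ((integrable_exp_mul_exp_neg_mul_sq hb0 y).ofReal (𝕜 := ℂ)).congr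
      (Eventually.of_forall fun s => ?_)
    exact Complex.ofReal_mul _ _
  have hif : ∀ y : ℝ, Integrable fun s : ℝ =>
      (Real.exp (y * s) : ℂ) * ((Real.exp (-b * s ^ 2) : ℂ) * f s) := fun y => by
    refine ((hgi y).integrable_mul (Lp.memLp f)).congr (Eventually.of_forall fun s => ?_)
    simp only [Pi.mul_apply, mul_assoc]
  have hfc : (fun s => (Real.exp (-b * s ^ 2) : ℂ) * (f s - c)) =ᵐ[volume] 0 := by
    have hexpand : ∀ y s : ℝ, (Real.exp (y * s) : ℂ) * ((Real.exp (-b * s ^ 2) : ℂ) * (f s - c)) =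
        (Real.exp (y * s) : ℂ) * ((Real.exp (-b * s ^ 2) : ℂ) * f s) -
        c * ((Real.exp (y * s) : ℂ) * (Real.exp (-b * s ^ 2) : ℂ)) := fun y s => by ring
    refine ae_eq_zero_of_integral_exp_mul_eq_zero (fun y => ?_) fun y => ?_
    · simp only [hexpand]
      exact (hif y).sub ((hgi1 y).const_mul c)
    · simp only [hexpand]
      rw [integral_sub (hif y) ((hgi1 y).const_mul c), integral_const_mul, hgauss y]
      -- This `x` makes the frequency `4/15 a x` equal to `y`.
      have h1 := hexp (15 / (4 * a) * y)
      rw [show 4 / 15 * a * (15 / (4 * a) * y) = y by field_simp] at h1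
      have h2 : (15 / (4 * a) * y) ^ 2 / 30 = y ^ 2 / (4 * b) := by
        rw [hb]
        field_simp
        ring
      rw [h1, h2, ← mul_assoc c, hc, div_mul_cancel₀ _ hG, sub_self]
  have hfc' : (fun _ : ℝ => c) =ᵐ[volume] f := by
    filter_upwards [hfc] with s hs
    have h1 : (Real.exp (-b * s ^ 2) : ℂ) ≠ 0 := by exact_mod_cast (Real.exp_pos _).ne'
    exact (sub_eq_zero.1 ((mul_eq_zero.1 hs).resolve_left h1)).symm
  have hc0 : c = 0 := by
    have h1 : MemLp (fun _ : ℝ => c) 2 volume := (Lp.memLp f).ae_eq hfc'.symm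
    rcases (memLp_const_iff two_ne_zero ENNReal.ofNat_ne_top).1 h1 with h | h
    · exact h
    · simp at h
  rw [Lp.eq_zero_iff_ae_eq_zero]
  filter_upwards [hfc'] with s hs
  rw [← hs, hc0]
  rfl

end HermiteUniqueness


/-! ### The representation `T_θ = B* φ B` and the analytic trace-class family. -/

section FeatureOperators

open scoped BoundedContinuousFunction

/-- The integral operator with kernel `featureKernel q`. -/
def featureOp (q : Set.Ioo (0 : ℝ) 1) : L2R →L[ℂ] Lp ℂ 2 featureMeasure :=
  (isHilbertSchmidtKernel_featureKernel q.2.1.le q.2.2).exists_isIntegralOperator.choose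

theorem isIntegralOperator_featureOp (q : Set.Ioo (0 : ℝ) 1) :
    IsIntegralOperator (featureOp q) (featureKernel q) :=
  (isHilbertSchmidtKernel_featureKernel q.2.1.le q.2.2).exists_isIntegralOperator.choose_spec

/-- Multiplication by a bounded function of the second variable. -/
def featureMul :
    (ℕ →ᵇ ℂ) →L[ℂ] Lp ℂ 2 featureMeasure →L[ℂ] Lp ℂ 2 featureMeasure :=
  (exists_multiplicationOperator (μ := featureMeasure)
    (g := fun x : ℝ × ℕ => x.2) measurable_snd).choose

theorem featureMul_apply (φ : ℕ →ᵇ ℂ) (g : Lp ℂ 2 featureMeasure) :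
    featureMul φ g =ᵐ[featureMeasure] fun x => φ x.2 * g x :=
  (exists_multiplicationOperator (μ := featureMeasure)
    (g := fun x : ℝ × ℕ => x.2) measurable_snd).choose_spec φ g

/-- The operator `B* φ B`, where `B` is `featureOp q`. -/
def featureForm (q : Set.Ioo (0 : ℝ) 1) (φ : ℕ →ᵇ ℂ) : L2R →L[ℂ] L2R :=
  ContinuousLinearMap.adjoint (featureOp q) ∘L featureMul φ ∘L featureOp q

variable (q : Set.Ioo (0 : ℝ) 1)

theorem featureForm_add (φ ψ : ℕ →ᵇ ℂ) :
    featureForm q (φ + ψ) = featureForm q φ + featureForm q ψ := by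
  simp only [featureForm, map_add, ContinuousLinearMap.add_comp, ContinuousLinearMap.comp_add]

theorem featureForm_smul (c : ℂ) (φ : ℕ →ᵇ ℂ) :
    featureForm q (c • φ) = c • featureForm q φ := by
  simp only [featureForm, map_smul, ContinuousLinearMap.smul_comp, ContinuousLinearMap.comp_smul]

theorem featureForm_sub (φ ψ : ℕ →ᵇ ℂ) :
    featureForm q (φ - ψ) = featureForm q φ - featureForm q ψ := by
  simp only [featureForm, map_sub, ContinuousLinearMap.sub_comp, ContinuousLinearMap.comp_sub]

theorem hilbertSchmidtBound_featureOp : ∃ C, HilbertSchmidtBound (featureOp q) C :=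
  ⟨_, (isHilbertSchmidtKernel_featureKernel q.2.1.le q.2.2).hilbertSchmidtBound
    (isIntegralOperator_featureOp q)⟩

theorem isCompactOperator_featureForm (φ : ℕ →ᵇ ℂ) : IsCompactOperator (featureForm q φ) := by
  obtain ⟨C, hC⟩ := hilbertSchmidtBound_featureOp q
  exact hC.isCompactOperator.clm_comp
    (ContinuousLinearMap.adjoint (featureOp q) ∘L featureMul φ)

/-- Norm convergence of symbols in `ℓ^∞` thereby becomes trace-norm convergence of operators. -/
theorem traceNorm_featureForm_le :
    ∃ C, ∀ φ, traceNorm (featureForm q φ) ≤ ENNReal.ofReal (C * ‖φ‖) := by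
  obtain ⟨C, hC⟩ := hilbertSchmidtBound_featureOp q
  refine ⟨‖featureMul‖ * C, fun φ => (traceNorm_adjoint_comp_comp_le hC _).trans
    (ENNReal.ofReal_le_ofReal ?_)⟩
  calc _ ≤ ‖featureMul‖ * ‖φ‖ * C :=
        mul_le_mul_of_nonneg_right (featureMul.le_opNorm φ) hC.nonneg
    _ = _ := by ring

theorem adjoint_featureMul {φ ψ : ℕ →ᵇ ℂ} (h : ∀ n, ψ n = conj (φ n)) :
    ContinuousLinearMap.adjoint (featureMul φ) = featureMul ψ := by
  symm
  rw [ContinuousLinearMap.eq_adjoint_iff]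
  intro f g
  rw [L2.inner_def, L2.inner_def]
  refine integral_congr_ae ?_
  filter_upwards [featureMul_apply ψ f, featureMul_apply φ g] with x h1 h2
  rw [h1, h2, h, RCLike.inner_apply, RCLike.inner_apply, map_mul, Complex.conj_conj]
  ring

theorem adjoint_featureForm {φ ψ : ℕ →ᵇ ℂ} (h : ∀ n, ψ n = conj (φ n)) :
    ContinuousLinearMap.adjoint (featureForm q φ) = featureForm q ψ := by
  rw [featureForm, ContinuousLinearMap.adjoint_comp, ContinuousLinearMap.adjoint_comp,
    ContinuousLinearMap.adjoint_adjoint, adjoint_featureMul h, featureForm,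
    ContinuousLinearMap.comp_assoc]

/-- Reduces positivity and comparison of forms to the signs of the real parts of the symbol. -/
theorem inner_featureForm (φ : ℕ →ᵇ ℂ) (f : L2R) :
    RCLike.re ⟪f, featureForm q φ f⟫_ℂ =
      ∫ x, (φ x.2).re * ‖featureOp q f x‖ ^ 2 ∂featureMeasure ∧
    Integrable (fun x => (φ x.2).re * ‖featureOp q f x‖ ^ 2) featureMeasure := by
  have h1 : ⟪f, featureForm q φ f⟫_ℂ = ⟪featureOp q f, featureMul φ (featureOp q f)⟫_ℂ := by
    rw [featureForm, ContinuousLinearMap.comp_apply, ContinuousLinearMap.adjoint_inner_right,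
      ContinuousLinearMap.comp_apply]
  have hint := L2.integrable_inner (𝕜 := ℂ) (featureOp q f) (featureMul φ (featureOp q f))
  have h2 : ∀ᵐ x ∂featureMeasure,
      RCLike.re ⟪featureOp q f x, featureMul φ (featureOp q f) x⟫_ℂ =
        (φ x.2).re * ‖featureOp q f x‖ ^ 2 := by
    filter_upwards [featureMul_apply φ (featureOp q f)] with x hx
    rw [hx, RCLike.inner_apply, mul_assoc, RCLike.mul_conj]
    rw [RCLike.re_eq_complex_re, ← Complex.re_mul_ofReal]
    push_cast
    rfl
  constructor
  · rw [h1, L2.inner_def, ← integral_re hint]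
    exact integral_congr_ae h2
  · exact hint.re.congr h2

theorem hasKernel_featureForm {r : ℂ} (hr : ‖r‖ ≤ (q : ℝ)) {φ : ℕ →ᵇ ℂ}
    (hφ : ∀ n, φ n = (r / (q : ℝ)) ^ n) : HasKernel (featureForm q φ) (cosKernel r) := by
  have hk := isHilbertSchmidtKernel_featureKernel q.2.1.le q.2.2
  have hB := isIntegralOperator_featureOp q
  have hk2 : IsHilbertSchmidtKernel (fun (x : ℝ × ℕ) s => φ x.2 * featureKernel q x s)
      featureMeasure volume := by
    have hm : Measurable (Function.uncurry fun (x : ℝ × ℕ) s => φ x.2 * featureKernel q x s) := by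
      have h1 : Measurable fun p : (ℝ × ℕ) × ℝ => φ p.1.2 :=
        (measurable_from_nat (f := φ)).comp (measurable_snd.comp measurable_fst)
      exact h1.mul hk.measurable
    refine ⟨hm, (hk.integrable.const_mul (‖φ‖ ^ 2)).mono' (hm.norm.pow_const 2).aestronglyMeasurable
      (Eventually.of_forall fun p => ?_)⟩
    rw [Real.norm_of_nonneg (by positivity), norm_mul, mul_pow]
    gcongr
    exact φ.norm_coe_le_norm _
  have hMB : IsIntegralOperator (featureMul φ ∘L featureOp q)
      (fun (x : ℝ × ℕ) s => φ x.2 * featureKernel q x s) := by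
    intro f
    refine ⟨hk2.integrable_mul_ae f, ?_⟩
    filter_upwards [featureMul_apply φ (featureOp q f), (hB f).2] with x h1 h2
    rw [ContinuousLinearMap.comp_apply, h1, h2, ← integral_const_mul]
    simp only [mul_assoc]
  have h := hk.conj_swap.comp hk2 (hk.adjoint hB) hMB
  have he : (fun t s => ∫ x, conj (featureKernel q x t) * (φ x.2 * featureKernel q x s)
      ∂featureMeasure) = cosKernel r := by
    ext t s
    exact integral_featureKernel q.2.1 q.2.2 hr hφ t s
  rw [he] at h
  exact h

/-- The sequence `δ_k`. -/
def singleSeq (k : ℕ) : ℕ →ᵇ ℂ :=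
  BoundedContinuousFunction.ofNormedAddCommGroupDiscrete (Pi.single k 1) 1 fun n => by
    by_cases h : n = k
    · subst h
      simp
    · simp [Pi.single_eq_of_ne h]

theorem norm_singleSeq_le (k : ℕ) : ‖singleSeq k‖ ≤ 1 := by
  refine (BoundedContinuousFunction.norm_le zero_le_one).2 fun n => ?_
  by_cases h : n = k
  · subst h
    simp [singleSeq]
  · simp [singleSeq, Pi.single_eq_of_ne h]

/-- The sequence `1, u, u², …`, for `‖u‖ < 1`. -/
def powSeq (u : ℂ) : ℕ →ᵇ ℂ := ∑' k, u ^ k • singleSeq k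

theorem norm_pow_smul_singleSeq_le (u : ℂ) (k : ℕ) : ‖u ^ k • singleSeq k‖ ≤ ‖u‖ ^ k := by
  rw [norm_smul, norm_pow]
  exact mul_le_of_le_one_right (by positivity) (norm_singleSeq_le k)

theorem powSeq_apply {u : ℂ} (hu : ‖u‖ < 1) (n : ℕ) : powSeq u n = u ^ n := by
  have hs : Summable fun k => u ^ k • singleSeq k :=
    Summable.of_norm_bounded (summable_geometric_of_lt_one (norm_nonneg _) hu)
      (norm_pow_smul_singleSeq_le u)
  have h := hs.hasSum.mapL (BoundedContinuousFunction.evalCLM ℂ n)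
  have h2 := hasSum_single (f := fun k => BoundedContinuousFunction.evalCLM ℂ n
    (u ^ k • singleSeq k)) n fun k hk => by
      simp [BoundedContinuousFunction.evalCLM_apply, singleSeq, Pi.single_eq_of_ne hk.symm]
  have h3 := h.unique h2
  simpa [BoundedContinuousFunction.evalCLM_apply, singleSeq, powSeq] using h3

/-- Weierstrass: on a ball of radius `σ` with `‖u‖ < σ < 1` the defining series is dominated by `∑ σ
^ k` in sup norm. -/
theorem differentiableAt_powSeq {u : ℂ} (hu : ‖u‖ < 1) : DifferentiableAt ℂ powSeq u := by
  obtain ⟨σ, h1, h2⟩ := exists_between hu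
  have h := Complex.differentiableOn_tsum_of_summable_norm (F := fun k (u : ℂ) => u ^ k • singleSeq k)
    (summable_geometric_of_lt_one ((norm_nonneg u).trans h1.le) h2)
    (fun k => ((differentiable_id.pow k).smul_const (singleSeq k)).differentiableOn)
    (Metric.isOpen_ball (x := (0 : ℂ)) (ε := σ)) (fun k w hw => by
      refine (norm_pow_smul_singleSeq_le w k).trans ?_
      exact pow_le_pow_left₀ (norm_nonneg _) (mem_ball_zero_iff.1 hw).le k)
  exact h.differentiableAt (Metric.isOpen_ball.mem_nhds (mem_ball_zero_iff.2 h1))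

theorem norm_div_lt_one {r : ℂ} (hr : ‖r‖ < (q : ℝ)) : ‖r / (q : ℝ)‖ < 1 := by
  rw [norm_div, Complex.norm_real, Real.norm_of_nonneg q.2.1.le]
  exact (div_lt_one q.2.1).2 hr

theorem hasKernel_featureForm_powSeq {r : ℂ} (hr : ‖r‖ < (q : ℝ)) :
    HasKernel (featureForm q (powSeq (r / (q : ℝ)))) (cosKernel r) :=
  hasKernel_featureForm q hr.le fun n => powSeq_apply (norm_div_lt_one q hr) n

theorem exists_norm_lt_Ioo {r : ℂ} (hr : ‖r‖ < 1) : ∃ q : Set.Ioo (0 : ℝ) 1, ‖r‖ < (q : ℝ) := by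
  obtain ⟨q, h1, h2⟩ := exists_between hr
  exact ⟨⟨q, (norm_nonneg r).trans_lt h1, h2⟩, h1⟩

theorem hasKernel_thetaOp {θ : ℂ} (hθ : θ ∈ thetaDomain) :
    HasKernel (thetaOp θ) (thetaKernel θ) := by
  obtain ⟨q, hq⟩ := exists_norm_lt_Ioo (show ‖Complex.cos θ‖ < 1 from hθ)
  have h : ∃ A : L2R →L[ℂ] L2R, HasKernel A (thetaKernel θ) :=
    ⟨_, thetaKernel_eq_cosKernel θ ▸ hasKernel_featureForm_powSeq q hq⟩
  rw [thetaOp, integralOperator, dif_pos h]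
  exact h.choose_spec

/-- A kernel determines its operator, so every `q > ‖cos θ‖` gives a representation; a single `q`
thus serves several angles, or a neighbourhood of one, with the same `B`. -/
theorem thetaOp_eq_featureForm {θ : ℂ} (hθ : ‖Complex.cos θ‖ < (q : ℝ)) :
    thetaOp θ = featureForm q (powSeq (Complex.cos θ / (q : ℝ))) := by
  refine (hasKernel_thetaOp (hθ.trans q.2.2)).unique ?_
  rw [thetaKernel_eq_cosKernel]
  exact hasKernel_featureForm_powSeq q hθ

theorem isOpen_thetaDomain : IsOpen thetaDomain :=
  isOpen_lt Complex.continuous_cos.norm continuous_const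

theorem conj_mem_thetaDomain {θ : ℂ} (hθ : θ ∈ thetaDomain) : conj θ ∈ thetaDomain := by
  have h : ‖Complex.cos θ‖ < 1 := hθ
  show ‖Complex.cos (conj θ)‖ < 1
  rwa [Complex.cos_conj, RCLike.norm_conj]

theorem isTraceClassAnalyticOn_thetaOp : IsTraceClassAnalyticOn thetaOp thetaDomain := by
  intro z hz
  obtain ⟨q, hq⟩ := exists_norm_lt_Ioo (show ‖Complex.cos z‖ < 1 from hz)
  obtain ⟨C, hC⟩ := traceNorm_featureForm_le q
  have htc : ∀ φ, IsTraceClass (featureForm q φ) := fun φ =>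
    (hC φ).trans_lt ENNReal.ofReal_lt_top
  refine ⟨thetaOp_eq_featureForm q hq ▸ htc _, ?_⟩
  have hd : DifferentiableAt ℂ (fun w => powSeq (Complex.cos w / (q : ℝ))) z :=
    DifferentiableAt.comp (g := powSeq) (f := fun w => Complex.cos w / (q : ℝ)) z
      (differentiableAt_powSeq (norm_div_lt_one q hq))
      (Complex.differentiable_cos.differentiableAt.div_const _)
  have hslope := hasDerivAt_iff_tendsto_slope.1 hd.hasDerivAt
  set F' := deriv (fun w => powSeq (Complex.cos w / (q : ℝ))) z
  refine ⟨featureForm q F', htc _, ?_⟩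
  -- The condition on `q` is open, so near `z` the difference quotients of `thetaOp` are forms of
  -- the difference quotients of symbols for one fixed `q`.
  have hnhds : ∀ᶠ w in 𝓝[≠] z, ‖Complex.cos w‖ < (q : ℝ) :=
    (Complex.continuous_cos.norm.continuousAt.eventually_lt continuousAt_const hq).filter_mono
      nhdsWithin_le_nhds
  have hlim : Tendsto (fun w => ENNReal.ofReal
      (C * ‖slope (fun w => powSeq (Complex.cos w / (q : ℝ))) z w - F'‖)) (𝓝[≠] z) (𝓝 0) := by
    have h1 : Tendsto (fun w => C * ‖slope (fun w => powSeq (Complex.cos w / (q : ℝ))) z w - F'‖)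
        (𝓝[≠] z) (𝓝 0) := by
      simpa using ((tendsto_sub_nhds_zero_iff.2 hslope).norm).const_mul C
    simpa using! (ENNReal.continuous_ofReal.tendsto 0).comp h1
  refine tendsto_of_tendsto_of_tendsto_of_le_of_le' tendsto_const_nhds hlim
    (Eventually.of_forall fun _ => zero_le) ?_
  filter_upwards [hnhds] with w hw
  refine le_trans (le_of_eq ?_) (hC _)
  rw [thetaOp_eq_featureForm q hw, thetaOp_eq_featureForm q hq, featureForm_sub, slope_def_module,
    featureForm_smul, featureForm_sub]

theorem adjoint_thetaOp {θ : ℂ} (hθ : θ ∈ thetaDomain) :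
    thetaOp (conj θ) = ContinuousLinearMap.adjoint (thetaOp θ) := by
  obtain ⟨q, hq⟩ := exists_norm_lt_Ioo (show ‖Complex.cos θ‖ < 1 from hθ)
  have hq' : ‖Complex.cos (conj θ)‖ < (q : ℝ) := by rwa [Complex.cos_conj, RCLike.norm_conj]
  rw [thetaOp_eq_featureForm q hq, thetaOp_eq_featureForm q hq']
  refine (adjoint_featureForm q fun n => ?_).symm
  rw [powSeq_apply (norm_div_lt_one q hq), powSeq_apply (norm_div_lt_one q hq'), Complex.cos_conj]
  simp

theorem isSelfAdjointTraceClassAnalyticFamily_thetaOp :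
    IsSelfAdjointTraceClassAnalyticFamily thetaOp thetaDomain :=
  ⟨isOpen_thetaDomain, fun _ => conj_mem_thetaDomain, isTraceClassAnalyticOn_thetaOp,
    fun _ => adjoint_thetaOp⟩

end FeatureOperators


/-! ### Which components of `B f` determine `f`. -/

section FeatureInjective

variable (q : Set.Ioo (0 : ℝ) 1)

theorem ae_featureMeasure_iff {P : ℝ × ℕ → Prop} (h : ∀ᵐ x ∂featureMeasure, P x) :
    ∀ᵐ l : ℝ, 0 < l → ∀ n, P (l, n) := by
  have h1 := Measure.ae_ae_of_ae_prod h
  rw [ae_restrict_iff' measurableSet_Ioi] at h1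
  filter_upwards [h1] with l hl hl0 n
  exact ae_iff_of_countable.1 (hl hl0) n (by simp)

theorem ae_integral_hermiteWave_eq_zero {f : L2R} {N : Set ℕ}
    (h : ∀ᵐ x ∂featureMeasure, x.2 ∈ N → featureOp q f x = 0) :
    ∀ᵐ l : ℝ, 0 < l → ∀ n ∈ N, ∫ s, conj (hermiteWave n (√l * s)) * f s = 0 := by
  filter_upwards [ae_featureMeasure_iff (h.and (isIntegralOperator_featureOp q f).2)]
    with l hl hl0 n hn
  obtain ⟨h1, h2⟩ := hl hl0 n
  rw [h1 hn] at h2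
  simp only [featureKernel, mul_assoc] at h2
  rw [integral_const_mul] at h2
  refine (mul_eq_zero.1 h2.symm).resolve_left ?_
  have h3 : 0 < √(q : ℝ) := Real.sqrt_pos.2 q.2.1
  have h4 : 0 < √(q : ℝ) ^ n * √(Real.exp (-l) / (2 * Real.pi)) := by positivity
  exact_mod_cast h4.ne'

/-- One good scale `l` suffices. This gives strict monotonicity, where the symbols agree at `n = 0`.
-/
theorem eq_zero_of_featureOp_eq_zero_of_ne_zero {f : L2R}
    (h : ∀ᵐ x ∂featureMeasure, x.2 ≠ 0 → featureOp q f x = 0) : f = 0 := by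
  have h1 := ae_integral_hermiteWave_eq_zero q (N := {n | n ≠ 0}) h
  have h2 : ∃ l : ℝ, 0 < l ∧ ∀ n ≠ 0, ∫ s, conj (hermiteWave n (√l * s)) * f s = 0 := by
    have : (ae (volume.restrict (Set.Ioi (0 : ℝ)))).NeBot := ae_restrict_neBot.2 (by simp)
    obtain ⟨l, hl, hl0⟩ :=
      ((ae_restrict_of_ae h1).and (ae_restrict_mem (μ := volume)
        (measurableSet_Ioi (a := (0 : ℝ))))).exists
    exact ⟨l, hl0, hl hl0⟩
  obtain ⟨l, hl0, hl⟩ := h2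
  exact eq_zero_of_integral_hermiteWave_eq_zero (Real.sqrt_pos.2 hl0) hl

theorem hermiteWave_zero_mul_conj (x : ℝ) :
    hermiteWave 0 0 * conj (hermiteWave 0 x) = (Real.exp (-(1 / 2) * x ^ 2) : ℂ) := by
  have h1 := hasSum_mehler (r := 0) (by simp) 0 x
  have h2 := hasSum_single (f := fun n => (0 : ℂ) ^ n * (hermiteWave n 0 * conj (hermiteWave n x)))
    0 fun n hn => by rw [zero_pow hn, zero_mul]
  have h3 := h2.unique h1
  rw [pow_zero, one_mul] at h3
  rw [h3, mehlerKernel]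
  push_cast
  norm_num
  congr 1
  ring

theorem ae_comp_mul_left {P : ℝ → Prop} (h : ∀ᵐ l : ℝ, P l) {c : ℝ} (hc : c ≠ 0) :
    ∀ᵐ l : ℝ, P (c * l) := by
  have h1 : (volume : Measure ℝ).map (c * ·) ≪ volume := by
    rw [Real.map_volume_mul_left hc]
    exact Measure.smul_absolutelyContinuous
  exact ae_of_ae_map (by fun_prop) (h1.ae_le h)

/-- The component `n = 0` is the Gaussian transform `∫ exp(-l s² / 2) f`, known to vanish for almost
every scale `l`. This gives positivity of the even part at `θ = π/2`, where no other component
contributes. -/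
theorem eq_zero_of_featureOp_eq_zero_of_even {f : L2R} (hf : ∀ᵐ s : ℝ, f (-s) = f s)
    (h : ∀ᵐ x ∂featureMeasure, x.2 = 0 → featureOp q f x = 0) : f = 0 := by
  have h1 : ∀ᵐ l : ℝ, 0 < l → ∫ s, (Real.exp (-(1 / 2 * l) * s ^ 2) : ℂ) * f s = 0 := by
    filter_upwards [ae_integral_hermiteWave_eq_zero q (N := {0}) h] with l hl hl0
    have h2 := hl hl0 0 rfl
    have h3 : ∀ s : ℝ, (Real.exp (-(1 / 2 * l) * s ^ 2) : ℂ) * f s =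
        hermiteWave 0 0 * (conj (hermiteWave 0 (√l * s)) * f s) := fun s => by
      rw [← mul_assoc, hermiteWave_zero_mul_conj, mul_pow, Real.sq_sqrt hl0.le,
        show -(1 / 2 * l) * s ^ 2 = -(1 / 2) * (l * s ^ 2) by ring]
    simp only [h3]
    rw [integral_const_mul, h2, mul_zero]
  -- Dilations preserve null sets, so almost every `l` has all its multiples `(k + 1) l` outside the
  -- exceptional set.
  have h2 : ∀ᵐ l : ℝ, ∀ k : ℕ, 0 < ((k : ℝ) + 1) * l →
      ∫ s, (Real.exp (-(1 / 2 * (((k : ℝ) + 1) * l)) * s ^ 2) : ℂ) * f s = 0 :=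
    ae_all_iff.2 fun k => ae_comp_mul_left h1 (by positivity)
  have : (ae (volume.restrict (Set.Ioi (0 : ℝ)))).NeBot := ae_restrict_neBot.2 (by simp)
  obtain ⟨l, hl, hl0⟩ :=
    ((ae_restrict_of_ae h2).and (ae_restrict_mem (μ := volume)
      (measurableSet_Ioi (a := (0 : ℝ))))).exists
  have hl0' : 0 < l := hl0
  rw [Lp.eq_zero_iff_ae_eq_zero]
  refine ae_eq_zero_of_integral_exp_neg_mul_sq_eq_zero (a := 1 / 2 * l) (by positivity) ?_ hf
    fun k => ?_
  · have hG : MemLp (fun s : ℝ => (Real.exp (-(1 / 2 * l) * s ^ 2) : ℂ)) 2 volume := by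
      rw [memLp_two_iff_integrable_sq_norm (by fun_prop : Continuous fun s : ℝ =>
        (Real.exp (-(1 / 2 * l) * s ^ 2) : ℂ)).aestronglyMeasurable]
      refine (integrable_exp_neg_mul_sq hl0').congr (Eventually.of_forall fun s => ?_)
      simp only
      rw [Complex.norm_real, Real.norm_eq_abs, Real.abs_exp, ← Real.exp_nat_mul]
      congr 1
      push_cast
      ring
    exact hG.integrable_mul (Lp.memLp f)
  · rw [← hl k (by positivity)]
    congr! 7
    ring

end FeatureInjective

/-! ### Parity projections. -/

section Parity

/-- The projection `(1 + (-1)ᵖ Π) / 2`. -/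
def parityProj (p : ℕ) : L2R →L[ℂ] L2R :=
  (1 / 2 : ℂ) • (ContinuousLinearMap.id ℂ L2R + (-1 : ℂ) ^ p • parityOp)

theorem parityProj_zero : parityProj 0 = evenProj := by simp [parityProj, evenProj]

theorem parityProj_one : parityProj 1 = oddProj := by
  simp [parityProj, oddProj, sub_eq_add_neg]

theorem parityOp_apply (f : L2R) : parityOp f =ᵐ[volume] fun s => f (-s) :=
  Lp.coeFn_compMeasurePreserving f (Measure.measurePreserving_neg (volume : Measure ℝ))

theorem ae_comp_neg {P : ℝ → Prop} (h : ∀ᵐ s : ℝ, P s) : ∀ᵐ s : ℝ, P (-s) :=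
  (Measure.measurePreserving_neg (volume : Measure ℝ)).quasiMeasurePreserving.ae h

theorem parityOp_parityOp (f : L2R) : parityOp (parityOp f) = f := by
  refine Lp.ext ?_
  filter_upwards [parityOp_apply (parityOp f), ae_comp_neg (parityOp_apply f)] with s h1 h2
  rw [h1, h2, neg_neg]

theorem inner_parityOp_parityOp (f g : L2R) : ⟪parityOp f, parityOp g⟫_ℂ = ⟪f, g⟫_ℂ :=
  LinearIsometry.inner_map_map _ f g

theorem inner_parityOp_left (f g : L2R) : ⟪parityOp f, g⟫_ℂ = ⟪f, parityOp g⟫_ℂ := by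
  rw [← inner_parityOp_parityOp f, parityOp_parityOp]

variable (p : ℕ)

theorem neg_one_pow_mul_self : ((-1 : ℂ) ^ p) * (-1) ^ p = 1 := by
  rw [← mul_pow]
  simp

theorem parityProj_apply (f : L2R) :
    parityProj p f = (1 / 2 : ℂ) • (f + (-1 : ℂ) ^ p • parityOp f) := rfl

theorem parityOp_parityProj (f : L2R) : parityOp (parityProj p f) = (-1 : ℂ) ^ p • parityProj p f := by
  rw [parityProj_apply, map_smul, map_add, map_smul, parityOp_parityOp, smul_comm]
  congr 1
  rw [smul_add, smul_smul, neg_one_pow_mul_self, one_smul, add_comm]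

theorem mem_range_parityProj {f : L2R} :
    f ∈ (parityProj p).range ↔ parityOp f = (-1 : ℂ) ^ p • f := by
  constructor
  · rintro ⟨g, rfl⟩
    exact parityOp_parityProj p g
  · intro h
    refine ⟨f, ?_⟩
    show parityProj p f = f
    rw [parityProj_apply, h, smul_smul, neg_one_pow_mul_self, one_smul, ← two_smul ℂ, smul_smul]
    norm_num

theorem isClosed_range_parityProj : IsClosed ((parityProj p).range : Set L2R) := by
  have : ((parityProj p).range : Set L2R) = {f | parityOp f = (-1 : ℂ) ^ p • f} := by
    ext f
    exact mem_range_parityProj p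
  rw [this]
  exact isClosed_eq parityOp.continuous (continuous_const_smul _)

instance : CompleteSpace (parityProj p).range :=
  (isClosed_range_parityProj p).completeSpace_coe

theorem ae_neg_of_mem_range_parityProj {f : L2R} (hf : f ∈ (parityProj p).range) :
    ∀ᵐ s : ℝ, f (-s) = (-1 : ℂ) ^ p * f s := by
  have h := (mem_range_parityProj p).1 hf
  filter_upwards [parityOp_apply f, Lp.coeFn_smul ((-1 : ℂ) ^ p) f] with s h1 h2
  rw [← h1, h, h2]
  rfl

/-- Functions of parity `p` have no components of the opposite parity. -/
theorem featureOp_eq_zero_of_parity (q : Set.Ioo (0 : ℝ) 1) {f : L2R}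
    (hf : f ∈ (parityProj p).range) :
    ∀ᵐ x ∂featureMeasure, ¬ Even (x.2 + p) → featureOp q f x = 0 := by
  filter_upwards [(isIntegralOperator_featureOp q f).2] with x hx hxp
  rw [hx]
  have h1 : ∫ s, featureKernel q x s * f s = -∫ s, featureKernel q x s * f s := by
    conv_lhs => rw [← integral_neg_eq_self]
    rw [← integral_neg]
    refine integral_congr_ae ?_
    filter_upwards [ae_neg_of_mem_range_parityProj p hf] with s hs
    rw [hs, featureKernel, featureKernel, mul_neg, hermiteWave_neg, map_mul]
    have h2 : conj ((-1 : ℂ) ^ x.2) * (-1) ^ p = -1 := by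
      rw [map_pow, map_neg, map_one, ← pow_add]
      exact Odd.neg_one_pow (Nat.not_even_iff_odd.1 hxp)
    calc _ = (conj ((-1 : ℂ) ^ x.2) * (-1) ^ p) * (((√(q : ℝ) ^ x.2 *
          √(Real.exp (-x.1) / (2 * Real.pi)) : ℝ) : ℂ) *
          conj (hermiteWave x.2 (√x.1 * s)) * f s) := by ring
      _ = _ := by rw [h2]; ring
  exact self_eq_neg.1 h1

/-- The indicators of `(n, n + 1)` are orthonormal and orthogonal to all their reflections, so their
projections are pairwise orthogonal with squared norm `1/2`. -/
theorem not_finiteDimensional_range_parityProj :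
    ¬ FiniteDimensional ℂ (parityProj p).range := by
  intro hfd
  let S : ℕ → Set ℝ := fun n => Set.Ioo (n : ℝ) (n + 1)
  have hS : ∀ n, MeasurableSet (S n) := fun n => measurableSet_Ioo
  have hSf : ∀ n, volume (S n) ≠ ∞ := fun n => by simp [S]
  let w : ℕ → L2R := fun n => indicatorConstLp 2 (hS n) (hSf n) (1 : ℂ)
  have hw : ∀ m n, ⟪w m, w n⟫_ℂ = if m = n then 1 else 0 := by
    intro m n
    rw [L2.inner_indicatorConstLp_one_indicatorConstLp_one (hS m) (hS n) (hSf m) (hSf n)]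
    split_ifs with hmn
    · subst hmn
      simp [S, measureReal_def]
    · have : S m ∩ S n = ∅ := by
        ext x
        simp only [S, Set.mem_inter_iff, Set.mem_Ioo, Set.mem_empty_iff_false, iff_false]
        rintro ⟨⟨h1, h2⟩, h3, h4⟩
        have h5 : (m : ℝ) < n + 1 := h1.trans h4
        have h6 : (n : ℝ) < m + 1 := h3.trans h2
        norm_cast at h5 h6
        omega
      simp [this]
  have hw' : ∀ m n, ⟪w m, parityOp (w n)⟫_ℂ = 0 := by
    intro m n
    have hn : volume (Neg.neg ⁻¹' S n) ≠ ∞ := by simp [S]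
    rw [show parityOp (w n) = indicatorConstLp 2 ((hS n).preimage measurable_neg) hn (1 : ℂ)
      from rfl, L2.inner_indicatorConstLp_one_indicatorConstLp_one (hS m) _ (hSf m) hn]
    have : S m ∩ (fun x : ℝ => -x) ⁻¹' S n = ∅ := by
      ext x
      simp only [S, Set.mem_inter_iff, Set.mem_preimage, Set.mem_Ioo, Set.mem_empty_iff_false,
        iff_false]
      rintro ⟨⟨h1, -⟩, h3, -⟩
      have h5 : (0 : ℝ) ≤ m := m.cast_nonneg
      have h6 : (0 : ℝ) ≤ n := n.cast_nonneg
      linarith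
    rw [show (Neg.neg : ℝ → ℝ) ⁻¹' S n = (fun x : ℝ => -x) ⁻¹' S n from rfl, this]
    simp
  let v : ℕ → (parityProj p).range := fun n => ⟨parityProj p (w n), ⟨w n, rfl⟩⟩
  have hv : ∀ m n, ⟪v m, v n⟫_ℂ = if m = n then 1 / 2 else 0 := by
    intro m n
    show ⟪parityProj p (w m), parityProj p (w n)⟫_ℂ = _
    simp only [parityProj_apply, inner_smul_left, inner_smul_right, inner_add_left,
      inner_add_right, inner_parityOp_left, parityOp_parityOp, hw, hw', mul_zero, add_zero,
      zero_add]
    have h1 : conj ((-1 : ℂ) ^ p) * ((-1 : ℂ) ^ p) = 1 := by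
      rw [map_pow, map_neg, map_one, neg_one_pow_mul_self]
    have h2 : conj (1 / 2 : ℂ) = 1 / 2 := by simp [Complex.conj_ofNat]
    rw [h2]
    split_ifs with hmn
    · linear_combination (1 / 4 : ℂ) * h1
    · simp
  have hli : LinearIndependent ℂ v := by
    refine linearIndependent_of_ne_zero_of_inner_eq_zero (𝕜 := ℂ) (fun n h => ?_) fun m n hmn => ?_
    · have := hv n n
      rw [h] at this
      simp at this
    · show ⟪v m, v n⟫_ℂ = 0
      rw [hv m n, if_neg hmn]
  have := hli.finite
  exact not_finite ℕ

end Parity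


/-! ### The even and odd parts of `T_θ`: reflection, positivity, monotonicity, continuity. -/

section ParityBlocks

open scoped BoundedContinuousFunction

theorem continuous_featureForm (q : Set.Ioo (0 : ℝ) 1) : Continuous (featureForm q) :=
  continuous_const.clm_comp (featureMul.continuous.clm_comp continuous_const)

theorem abs_cos_lt_one {θ : ℝ} (hθ : θ ∈ Set.Ioo 0 Real.pi) : |Real.cos θ| < 1 := by
  rw [← sq_lt_one_iff_abs_lt_one, Real.cos_sq']
  have := Real.sin_pos_of_mem_Ioo hθ
  nlinarith

/-- The kernel depends on `r` and `t` through `t²`, `r²` and `r t s`, so reflecting `t` is the same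
as negating `r`. -/
theorem parityOp_comp_featureForm_powSeq (q : Set.Ioo (0 : ℝ) 1) {r : ℂ} (hr : ‖r‖ < (q : ℝ)) :
    parityOp ∘L featureForm q (powSeq (r / (q : ℝ))) = featureForm q (powSeq (-(r / (q : ℝ)))) := by
  have h := hasKernel_featureForm_powSeq q hr
  have h2 := hasKernel_featureForm_powSeq q (r := -r) (by rwa [norm_neg])
  rw [neg_div] at h2
  refine HasKernel.unique (fun f => ⟨(h2 f).1, ?_⟩) h2
  filter_upwards [parityOp_apply (featureForm q (powSeq (r / (q : ℝ))) f),
    ae_comp_neg (h f).2] with t h3 h4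
  rw [ContinuousLinearMap.comp_apply, h3, h4]
  refine integral_congr_ae (Eventually.of_forall fun s => ?_)
  simp [cosKernel]

/-- The part of the sequence `1, u, u², …` of parity `p`. -/
def parityPowSeq (p : ℕ) (u : ℂ) : ℕ →ᵇ ℂ := (1 / 2 : ℂ) • (powSeq u + (-1 : ℂ) ^ p • powSeq (-u))

variable (p : ℕ)

theorem parityPowSeq_apply {u : ℂ} (hu : ‖u‖ < 1) (n : ℕ) :
    parityPowSeq p u n = if Even (n + p) then u ^ n else 0 := by
  show (1 / 2 : ℂ) * (powSeq u n + (-1 : ℂ) ^ p * powSeq (-u) n) = _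
  rw [powSeq_apply hu, powSeq_apply (by rwa [norm_neg]), neg_pow u n, ← mul_assoc, ← pow_add]
  split_ifs with h
  · rw [Even.neg_one_pow (by rwa [add_comm])]
    ring
  · rw [Odd.neg_one_pow (by rwa [add_comm, ← Nat.not_even_iff_odd])]
    ring

theorem parityPowSeq_neg (u : ℂ) : parityPowSeq p (-u) = (-1 : ℂ) ^ p • parityPowSeq p u := by
  rw [parityPowSeq, parityPowSeq, neg_neg, smul_comm]
  congr 1
  rw [smul_add, smul_smul, neg_one_pow_mul_self, one_smul, add_comm]

/-- The part of `T_θ` in the functions of parity `p`. -/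
def parityThetaOp (θ : ℝ) : L2R →L[ℂ] L2R := parityProj p ∘L thetaOp θ

theorem parityThetaOp_mem (θ : ℝ) (f : L2R) : parityThetaOp p θ f ∈ (parityProj p).range :=
  ⟨thetaOp θ f, rfl⟩

theorem parityThetaOp_eq (q : Set.Ioo (0 : ℝ) 1) {θ : ℝ} (hθ : |Real.cos θ| < q) :
    parityThetaOp p θ = featureForm q (parityPowSeq p ((Real.cos θ / q : ℝ) : ℂ)) := by
  have h : ‖Complex.cos θ‖ < (q : ℝ) := by
    rwa [← Complex.ofReal_cos, Complex.norm_real, Real.norm_eq_abs]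
  rw [parityThetaOp, thetaOp_eq_featureForm q h, parityProj, ContinuousLinearMap.smul_comp,
    ContinuousLinearMap.add_comp, ContinuousLinearMap.id_comp, ContinuousLinearMap.smul_comp,
    parityOp_comp_featureForm_powSeq q h, ← featureForm_smul, ← featureForm_add,
    ← featureForm_smul, parityPowSeq]
  push_cast
  rfl

/-- `cos (π - θ) = -cos θ`, and a symbol supported on `n` of parity `p` picks up `(-1) ^ p` when `u`
is negated. -/
theorem parityThetaOp_pi_sub {θ : ℝ} (hθ : θ ∈ Set.Ioo 0 Real.pi) :
    parityThetaOp p (Real.pi - θ) = (-1 : ℂ) ^ p • parityThetaOp p θ := by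
  obtain ⟨q, h1, h2⟩ := exists_between (abs_cos_lt_one hθ)
  let q' : Set.Ioo (0 : ℝ) 1 := ⟨q, (abs_nonneg _).trans_lt h1, h2⟩
  rw [parityThetaOp_eq p q' h1, parityThetaOp_eq p q' (by rwa [Real.cos_pi_sub, abs_neg]),
    Real.cos_pi_sub, neg_div, Complex.ofReal_neg, parityPowSeq_neg, featureForm_smul]

theorem continuousAt_parityThetaOp {θ : ℝ} (hθ : θ ∈ Set.Ioo 0 Real.pi) :
    ContinuousAt (parityThetaOp p) θ := by
  obtain ⟨q, h1, h2⟩ := exists_between (abs_cos_lt_one hθ)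
  let q' : Set.Ioo (0 : ℝ) 1 := ⟨q, (abs_nonneg _).trans_lt h1, h2⟩
  have hev : (fun x : ℝ => parityProj p ∘L featureForm q' (powSeq (Complex.cos x / (q' : ℝ))))
      =ᶠ[𝓝 θ] parityThetaOp p := by
    filter_upwards [Real.continuous_cos.abs.continuousAt.eventually_lt continuousAt_const h1]
      with x hx
    rw [parityThetaOp, thetaOp_eq_featureForm q'
      (by rwa [← Complex.ofReal_cos, Complex.norm_real, Real.norm_eq_abs])]
  refine ContinuousAt.congr ?_ hev
  have hq : ‖Complex.cos θ / (q' : ℝ)‖ < 1 := norm_div_lt_one q'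
    (by rwa [← Complex.ofReal_cos, Complex.norm_real, Real.norm_eq_abs])
  have h3 : ContinuousAt (fun x : ℝ => powSeq (Complex.cos x / (q' : ℝ))) θ :=
    ContinuousAt.comp (g := powSeq) (f := fun x : ℝ => Complex.cos x / (q' : ℝ))
      (differentiableAt_powSeq hq).continuousAt (by fun_prop)
  exact continuousAt_const.clm_comp ((continuous_featureForm q').continuousAt.comp h3)

variable {p}

/-- A vanishing form kills `B f` wherever the symbol is positive, and parity kills the components of
the wrong parity. The two alternatives match the two uniqueness theorems: one for all `n ≠ 0`, one
for even functions and `n = 0` alone. -/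
theorem inner_featureForm_pos (q : Set.Ioo (0 : ℝ) 1) {φ : ℕ →ᵇ ℂ}
    (h0 : ∀ n, Even (n + p) → 0 ≤ (φ n).re)
    (h1 : (∀ n ≠ 0, Even (n + p) → 0 < (φ n).re) ∨ Even p ∧ 0 < (φ 0).re)
    {f : L2R} (hf : f ∈ (parityProj p).range) (hf0 : f ≠ 0) :
    0 < RCLike.re ⟪f, featureForm q φ f⟫_ℂ := by
  obtain ⟨h2, h3⟩ := inner_featureForm q φ f
  have hpar := featureOp_eq_zero_of_parity p q hf
  have h4 : 0 ≤ᵐ[featureMeasure] fun x => (φ x.2).re * ‖featureOp q f x‖ ^ 2 := by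
    filter_upwards [hpar] with x hx
    by_cases hxp : Even (x.2 + p)
    · exact mul_nonneg (h0 _ hxp) (by positivity)
    · simp [hx hxp]
  rw [h2]
  refine (integral_nonneg_of_ae h4).lt_of_ne' fun h5 => hf0 ?_
  rw [integral_eq_zero_iff_of_nonneg_ae h4 h3] at h5
  rcases h1 with h1 | ⟨hp, h1⟩
  · refine eq_zero_of_featureOp_eq_zero_of_ne_zero q ?_
    filter_upwards [hpar, h5] with x hx hx5 hx0
    by_cases hxp : Even (x.2 + p)
    · simpa [(h1 _ hx0 hxp).ne'] using hx5
    · exact hx hxp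
  · refine eq_zero_of_featureOp_eq_zero_of_even q ?_ ?_
    · filter_upwards [ae_neg_of_mem_range_parityProj p hf] with s hs
      rw [hs, hp.neg_one_pow, one_mul]
    · filter_upwards [h5] with x hx5 hx0
      rw [hx0] at hx5
      simpa [h1.ne'] using hx5

theorem exists_sum_inner_featureForm_le (q : Set.Ioo (0 : ℝ) 1) (φ : ℕ →ᵇ ℂ) :
    ∃ C : ℝ, ∀ (ι : Type) (s : Finset ι) (b : ι → L2R), Orthonormal ℂ b →
      ∑ i ∈ s, RCLike.re ⟪b i, featureForm q φ (b i)⟫_ℂ ≤ C := by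
  obtain ⟨C, hC⟩ := hilbertSchmidtBound_featureOp q
  refine ⟨‖featureMul φ‖ * C, fun ι s b hb => ?_⟩
  have h1 : ∀ i ∈ s, RCLike.re ⟪b i, featureForm q φ (b i)⟫_ℂ ≤
      ‖featureMul φ‖ * ‖featureOp q (b i)‖ ^ 2 := fun i _ => by
    rw [featureForm, ContinuousLinearMap.comp_apply, ContinuousLinearMap.adjoint_inner_right,
      ContinuousLinearMap.comp_apply]
    refine (RCLike.re_le_norm _).trans ((norm_inner_le_norm _ _).trans ?_)
    have := mul_le_mul_of_nonneg_left ((featureMul φ).le_opNorm (featureOp q (b i)))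
      (norm_nonneg (featureOp q (b i)))
    linarith
  refine (Finset.sum_le_sum h1).trans ?_
  rw [← Finset.mul_sum]
  exact mul_le_mul_of_nonneg_left (hC (ContinuousLinearMap.id ℂ L2R)
    ContinuousLinearMap.norm_id_le ι s b hb) (norm_nonneg _)

theorem exists_common_Ioo {a b : ℝ} (ha : |a| < 1) (hb : |b| < 1) :
    ∃ q : Set.Ioo (0 : ℝ) 1, |a| < q ∧ |b| < q := by
  obtain ⟨q, h1, h2⟩ := exists_between (max_lt ha hb)
  exact ⟨⟨q, ((abs_nonneg a).trans (le_max_left _ _)).trans_lt h1, h2⟩,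
    (le_max_left _ _).trans_lt h1, (le_max_right _ _).trans_lt h1⟩

theorem norm_ofReal_div_lt_one (q : Set.Ioo (0 : ℝ) 1) {a : ℝ} (ha : |a| < q) :
    ‖((a / q : ℝ) : ℂ)‖ < 1 := by
  rw [Complex.norm_real, Real.norm_eq_abs, abs_div, abs_of_pos q.2.1]
  exact (div_lt_one q.2.1).2 ha

theorem isSymmetric_parityThetaOp {θ : ℝ} (hθ : θ ∈ Set.Ioo 0 Real.pi) :
    (parityThetaOp p θ).IsSymmetric := by
  obtain ⟨q, hq, -⟩ := exists_common_Ioo (abs_cos_lt_one hθ) (abs_cos_lt_one hθ)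
  rw [← ContinuousLinearMap.isSelfAdjoint_iff_isSymmetric, parityThetaOp_eq p q hq]
  refine adjoint_featureForm q fun n => ?_
  rw [parityPowSeq_apply p (norm_ofReal_div_lt_one q hq)]
  split_ifs
  · rw [map_pow, Complex.conj_ofReal]
  · rw [map_zero]

/-- The odd part at `π/2` is left out because it is zero there, not positive definite. -/
theorem exists_isEigenvalueSequence_parityThetaOp {θ : ℝ} (hθ : θ ∈ Set.Ioc 0 (Real.pi / 2))
    (h : Even p ∨ θ < Real.pi / 2) :
    ∃ E : ℕ → ℝ, IsEigenvalueSequence (parityThetaOp p θ) (parityProj p).range E ∧ Antitone E := by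
  have hθ' : θ ∈ Set.Ioo 0 Real.pi := ⟨hθ.1, by linarith [hθ.1, hθ.2]⟩
  obtain ⟨q, hq, -⟩ := exists_common_Ioo (abs_cos_lt_one hθ') (abs_cos_lt_one hθ')
  have hu := norm_ofReal_div_lt_one q hq
  have hq0 := q.2.1
  have hsymm := isSymmetric_parityThetaOp (p := p) hθ'
  have heq := parityThetaOp_eq p q hq
  obtain ⟨C, hC⟩ := exists_sum_inner_featureForm_le q
    (parityPowSeq p ((Real.cos θ / q : ℝ) : ℂ))
  have hre : ∀ n, Even (n + p) →
      (parityPowSeq p ((Real.cos θ / q : ℝ) : ℂ) n).re = (Real.cos θ / q) ^ n := fun n hn => by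
    rw [parityPowSeq_apply p hu, if_pos hn, ← Complex.ofReal_pow, Complex.ofReal_re]
  have hcos : 0 ≤ Real.cos θ := Real.cos_nonneg_of_mem_Icc ⟨by linarith [hθ.1, Real.pi_pos], hθ.2⟩
  refine exists_isEigenvalueSequence (C := C) ?_ hsymm (fun x hx hx0 => ?_) (fun x hx => ?_)
    (not_finiteDimensional_range_parityProj p) ?_
  · rw [heq]
    exact isCompactOperator_featureForm q _
  · rw [heq]
    refine inner_featureForm_pos q (fun n hn => ?_) ?_ hx hx0
    · rw [hre n hn]
      positivity
    · rcases h with h | h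
      · right
        refine ⟨h, ?_⟩
        rw [hre 0 (by simpa using h)]
        simp
      · left
        intro n _ hn
        rw [hre n hn]
        have : 0 < Real.cos θ := Real.cos_pos_of_mem_Ioo ⟨by linarith [hθ.1, Real.pi_pos], h⟩
        positivity
  -- `‖A x‖² = ⟪x, A (A x)⟫ = 0`, as the range of `A` consists of functions of parity `p` and `x` is
  -- orthogonal to them.
  · rw [← inner_self_eq_zero (𝕜 := ℂ)]
    have h1 := hsymm x (parityThetaOp p θ x)
    exact h1.trans ((Submodule.mem_orthogonal' _ _).1 hx _ (parityThetaOp_mem p θ _))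
  · rw [heq]
    exact hC

/-- With a common `q`, the difference of the symbols is `(cos θ₂ / q) ^ n - (cos θ₁ / q) ^ n` on the
right parity: zero at `n = 0`, positive otherwise. -/
theorem IsEigenvalueSequence.parityThetaOp_lt {θ₁ θ₂ : ℝ} (h₁ : θ₁ ∈ Set.Ioo 0 Real.pi)
    (h₂ : θ₂ ∈ Set.Ioo 0 Real.pi) (h0 : 0 ≤ Real.cos θ₁) (hlt : Real.cos θ₁ < Real.cos θ₂)
    {E₁ E₂ : ℕ → ℝ} (hE₁ : IsEigenvalueSequence (parityThetaOp p θ₁) (parityProj p).range E₁)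
    (hE₂ : IsEigenvalueSequence (parityThetaOp p θ₂) (parityProj p).range E₂)
    (ha₁ : Antitone E₁) (ha₂ : Antitone E₂) (n : ℕ) : E₁ n < E₂ n := by
  obtain ⟨q, hq₁, hq₂⟩ := exists_common_Ioo (abs_cos_lt_one h₁) (abs_cos_lt_one h₂)
  have hq0 := q.2.1
  refine hE₁.lt_of_inner_lt hE₂ ha₁ ha₂ (fun x hx hx0 => ?_) n
  rw [← sub_pos, ← map_sub, ← inner_sub_right, ← sub_apply,
    parityThetaOp_eq p q hq₁, parityThetaOp_eq p q hq₂, ← featureForm_sub]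
  have hre : ∀ n, Even (n + p) → ((parityPowSeq p ((Real.cos θ₂ / q : ℝ) : ℂ) -
      parityPowSeq p ((Real.cos θ₁ / q : ℝ) : ℂ)) n).re =
        (Real.cos θ₂ / q) ^ n - (Real.cos θ₁ / q) ^ n := fun n hn => by
    rw [BoundedContinuousFunction.sub_apply, parityPowSeq_apply p (norm_ofReal_div_lt_one q hq₁),
      parityPowSeq_apply p (norm_ofReal_div_lt_one q hq₂), if_pos hn, if_pos hn,
      ← Complex.ofReal_pow, ← Complex.ofReal_pow, ← Complex.ofReal_sub, Complex.ofReal_re]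
  have hlt' : Real.cos θ₁ / q < Real.cos θ₂ / q := div_lt_div_of_pos_right hlt hq0
  have h0' : 0 ≤ Real.cos θ₁ / q := by positivity
  refine inner_featureForm_pos q (fun n hn => ?_) (Or.inl fun n hn0 hn => ?_) hx hx0
  · rw [hre n hn, sub_nonneg]
    exact pow_le_pow_left₀ h0' hlt'.le n
  · rw [hre n hn, sub_pos]
    exact pow_lt_pow_left₀ hlt' h0' hn0

/-- Eigenvalues in descending order depend continuously on the operator. -/
theorem IsEigenvalueSequence.continuousWithinAt {H : Type*} [NormedAddCommGroup H]
    [InnerProductSpace ℂ H] [CompleteSpace H] {A : ℝ → H →L[ℂ] H} {V : Submodule ℂ H}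
    {E : ℕ → ℝ → ℝ} {s : Set ℝ} (hE : ∀ θ ∈ s, IsEigenvalueSequence (A θ) V (fun n => E n θ))
    (ha : ∀ θ ∈ s, Antitone fun n => E n θ) {θ : ℝ} (hθ : θ ∈ s) (hA : ContinuousWithinAt A s θ)
    (n : ℕ) : ContinuousWithinAt (E n) s θ := by
  have h1 : Tendsto (fun x => ‖A x - A θ‖) (𝓝[s] θ) (𝓝 0) :=
    tendsto_iff_norm_sub_tendsto_zero.1 hA
  refine tendsto_iff_norm_sub_tendsto_zero.2 (squeeze_zero' (Eventually.of_forall fun _ =>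
    norm_nonneg _) ?_ h1)
  filter_upwards [self_mem_nhdsWithin] with x hx
  exact (hE x hx).abs_sub_le (hE θ hθ) (ha x hx) (ha θ hθ) n

/-- `E` lists the eigenvalues of the operators `parityThetaOp p θ`, `0 < θ ≤ π / 2`, in descending
order. -/
def IsHalfLabelling (p : ℕ) (E : ℕ → ℝ → ℝ) : Prop :=
  ∀ θ ∈ Set.Ioc 0 (Real.pi / 2),
    IsEigenvalueSequence (parityThetaOp p θ) (parityProj p).range (fun n => E n θ) ∧
      Antitone (fun n => E n θ)

theorem Ioc_pi_div_two_subset : Set.Ioc 0 (Real.pi / 2) ⊆ Set.Ioo 0 Real.pi := fun _ hθ =>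
  ⟨hθ.1, by linarith [hθ.1, hθ.2]⟩

theorem IsHalfLabelling.strictAntiOn {E : ℕ → ℝ → ℝ} (h : IsHalfLabelling p E) (n : ℕ) :
    StrictAntiOn (E n) (Set.Ioc 0 (Real.pi / 2)) := fun θ₁ h₁ θ₂ h₂ hlt =>
  IsEigenvalueSequence.parityThetaOp_lt (Ioc_pi_div_two_subset h₂) (Ioc_pi_div_two_subset h₁)
    (Real.cos_nonneg_of_mem_Icc ⟨by linarith [h₂.1, Real.pi_pos], h₂.2⟩)
    (Real.cos_lt_cos_of_nonneg_of_le_pi_div_two h₁.1.le h₂.2 hlt) (h θ₂ h₂).1 (h θ₁ h₁).1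
    (h θ₂ h₂).2 (h θ₁ h₁).2 n

theorem IsHalfLabelling.continuousOn {E : ℕ → ℝ → ℝ} (h : IsHalfLabelling p E) (n : ℕ) :
    ContinuousOn (E n) (Set.Ioc 0 (Real.pi / 2)) := fun _ hθ =>
  IsEigenvalueSequence.continuousWithinAt (fun x hx => (h x hx).1) (fun x hx => (h x hx).2) hθ
    (continuousAt_parityThetaOp p (Ioc_pi_div_two_subset hθ)).continuousWithinAt n

theorem pi_sub_mem_Ioc {θ : ℝ} (hθ : θ ∈ Set.Ico (Real.pi / 2) Real.pi) :
    Real.pi - θ ∈ Set.Ioc 0 (Real.pi / 2) := ⟨by linarith [hθ.2], by linarith [hθ.1]⟩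

theorem ContinuousOn.comp_pi_sub {F : ℝ → ℝ} (hF : ContinuousOn F (Set.Ioc 0 (Real.pi / 2))) :
    ContinuousOn (fun θ => F (Real.pi - θ)) (Set.Ico (Real.pi / 2) Real.pi) :=
  hF.comp (by fun_prop) fun _ => pi_sub_mem_Ioc

theorem StrictAntiOn.comp_pi_sub {F : ℝ → ℝ} (hF : StrictAntiOn F (Set.Ioc 0 (Real.pi / 2))) :
    StrictMonoOn (fun θ => F (Real.pi - θ)) (Set.Ico (Real.pi / 2) Real.pi) :=
  fun _ h₁ _ h₂ hlt => hF (pi_sub_mem_Ioc h₂) (pi_sub_mem_Ioc h₁) (by linarith)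

theorem Ioc_union_Ico_pi :
    Set.Ioc 0 (Real.pi / 2) ∪ Set.Ico (Real.pi / 2) Real.pi = Set.Ioo 0 Real.pi :=
  Set.Ioc_union_Ico_eq_Ioo (by positivity) (by linarith [Real.pi_pos])

theorem continuousOn_Ioo_pi {F : ℝ → ℝ} (h₁ : ContinuousOn F (Set.Ioc 0 (Real.pi / 2)))
    (h₂ : ContinuousOn F (Set.Ico (Real.pi / 2) Real.pi)) :
    ContinuousOn F (Set.Ioo 0 Real.pi) := by
  rw [← Ioc_union_Ico_pi]
  intro θ hθ
  refine ContinuousWithinAt.union ?_ ?_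
  · by_cases h : θ ∈ Set.Ioc 0 (Real.pi / 2)
    · exact h₁ θ h
    -- Both pieces are relatively closed in `(0, π)`, so a point of the interval outside one piece
    -- is not in its closure.
    · refine continuousWithinAt_of_notMem_closure fun hc => ?_
      have h3 := closure_minimal Set.Ioc_subset_Icc_self isClosed_Icc hc
      rw [Ioc_union_Ico_pi] at hθ
      exact h ⟨hθ.1, h3.2⟩
  · by_cases h : θ ∈ Set.Ico (Real.pi / 2) Real.pi
    · exact h₂ θ h
    · refine continuousWithinAt_of_notMem_closure fun hc => ?_
      have h3 := closure_minimal Set.Ico_subset_Icc_self isClosed_Icc hc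
      rw [Ioc_union_Ico_pi] at hθ
      exact h ⟨h3.1, hθ.2⟩

end ParityBlocks

/-! ### Existence and regularity of the labellings on all of `(0, π)`. -/

section Labellings

theorem thetaOpPlus_eq (θ : ℝ) : thetaOpPlus θ = parityThetaOp 0 θ := by
  rw [thetaOpPlus, parityThetaOp, parityProj_zero]

theorem thetaOpMinus_eq (θ : ℝ) : thetaOpMinus θ = parityThetaOp 1 θ := by
  rw [thetaOpMinus, parityThetaOp, parityProj_one]

theorem parityThetaOp_zero_pi_sub {θ : ℝ} (hθ : θ ∈ Set.Ioo 0 Real.pi) :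
    parityThetaOp 0 (Real.pi - θ) = parityThetaOp 0 θ := by
  rw [parityThetaOp_pi_sub 0 hθ, pow_zero, one_smul]

theorem parityThetaOp_one_pi_sub {θ : ℝ} (hθ : θ ∈ Set.Ioo 0 Real.pi) :
    parityThetaOp 1 (Real.pi - θ) = -parityThetaOp 1 θ := by
  rw [parityThetaOp_pi_sub 1 hθ, pow_one, neg_one_smul]

theorem parityThetaOp_one_pi_div_two : parityThetaOp 1 (Real.pi / 2) = 0 := by
  have h := parityThetaOp_one_pi_sub (θ := Real.pi / 2)
    (Ioc_pi_div_two_subset ⟨by positivity, le_rfl⟩)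
  rw [sub_half] at h
  have h2 : (2 : ℂ) • parityThetaOp 1 (Real.pi / 2) = 0 := by
    rw [two_smul]
    exact add_eq_zero_iff_eq_neg.2 h
  exact (smul_eq_zero.1 h2).resolve_left two_ne_zero

theorem pi_sub_mem_Ioo {θ : ℝ} (hθ : θ ∈ Set.Ioo 0 Real.pi) : Real.pi - θ ∈ Set.Ioo 0 Real.pi :=
  ⟨by linarith [hθ.2], by linarith [hθ.1]⟩

theorem isPlusLabelling_iff {E : ℕ → ℝ → ℝ} : IsPlusLabelling E ↔
    ∀ θ ∈ Set.Ioo 0 Real.pi,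
      IsEigenvalueSequence (parityThetaOp 0 θ) (parityProj 0).range (fun n => E n θ) ∧
        Antitone (fun n => E n θ) := by
  simp only [IsPlusLabelling, thetaOpPlus_eq, parityProj_zero]

theorem IsPlusLabelling.isHalfLabelling {E : ℕ → ℝ → ℝ} (h : IsPlusLabelling E) :
    IsHalfLabelling 0 E := fun θ hθ => isPlusLabelling_iff.1 h θ (Ioc_pi_div_two_subset hθ)

theorem IsPlusLabelling.comp_pi_sub {E : ℕ → ℝ → ℝ} (h : IsPlusLabelling E) :
    IsPlusLabelling fun n θ => E n (Real.pi - θ) := by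
  rw [isPlusLabelling_iff] at h ⊢
  intro θ hθ
  rw [← parityThetaOp_zero_pi_sub hθ]
  exact h _ (pi_sub_mem_Ioo hθ)

theorem exists_isPlusLabelling : ∃ E : ℕ → ℝ → ℝ, IsPlusLabelling E := by
  have h : ∀ θ : ℝ, ∃ E : ℕ → ℝ, θ ∈ Set.Ioo 0 Real.pi →
      IsEigenvalueSequence (parityThetaOp 0 θ) (parityProj 0).range E ∧ Antitone E := by
    intro θ
    by_cases hθ : θ ∈ Set.Ioo 0 Real.pi
    · rcases le_or_gt θ (Real.pi / 2) with h1 | h1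
      · obtain ⟨E, hE⟩ := exists_isEigenvalueSequence_parityThetaOp (p := 0) ⟨hθ.1, h1⟩
          (Or.inl Even.zero)
        exact ⟨E, fun _ => hE⟩
      · obtain ⟨E, hE⟩ := exists_isEigenvalueSequence_parityThetaOp (p := 0)
          (pi_sub_mem_Ioc ⟨h1.le, hθ.2⟩) (Or.inl Even.zero)
        rw [parityThetaOp_zero_pi_sub hθ] at hE
        exact ⟨E, fun _ => hE⟩
    · exact ⟨0, fun h => absurd h hθ⟩
  choose E hE using h
  exact ⟨fun n θ => E θ n, isPlusLabelling_iff.2 fun θ hθ => hE θ hθ⟩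

/-- The reflected labelling is again a labelling, so the results on `(0, π/2]` apply to both halves.
-/
theorem IsPlusLabelling.regularity {E : ℕ → ℝ → ℝ} (h : IsPlusLabelling E) (n : ℕ) :
    ContinuousOn (E n) (Set.Ioo 0 Real.pi) ∧
      StrictAntiOn (E n) (Set.Ioc 0 (Real.pi / 2)) ∧
      StrictMonoOn (E n) (Set.Ico (Real.pi / 2) Real.pi) := by
  have h1 := h.isHalfLabelling
  have h2 := h.comp_pi_sub.isHalfLabelling
  have h3 := (h2.continuousOn n).comp_pi_sub
  have h4 := (h2.strictAntiOn n).comp_pi_sub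
  simp only [sub_sub_cancel] at h3 h4
  exact ⟨continuousOn_Ioo_pi (h1.continuousOn n) h3, h1.strictAntiOn n, h4⟩

theorem isMinusLabelling_iff {E : ℕ → ℝ → ℝ} : IsMinusLabelling E ↔
    (∀ θ ∈ Set.Ioo 0 Real.pi,
      IsEigenvalueSequence (parityThetaOp 1 θ) (parityProj 1).range (fun n => E n θ)) ∧
    (∀ θ ∈ Set.Ioo 0 (Real.pi / 2), Antitone (fun n => E n θ)) ∧
    (∀ θ ∈ Set.Ioo (Real.pi / 2) Real.pi, Monotone (fun n => E n θ)) := by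
  simp only [IsMinusLabelling, thetaOpMinus_eq, parityProj_one]

/-- The operator is zero at `π/2`. This supplies the ordering there, which a labelling does not
impose, and joins the two halves. -/
theorem IsMinusLabelling.apply_pi_div_two {E : ℕ → ℝ → ℝ} (h : IsMinusLabelling E) (n : ℕ) :
    E n (Real.pi / 2) = 0 := by
  obtain ⟨e, he, -, h1⟩ := (isMinusLabelling_iff.1 h).1 (Real.pi / 2)
    (Ioc_pi_div_two_subset ⟨by positivity, le_rfl⟩)
  have h2 := h1 n
  rw [parityThetaOp_one_pi_div_two, zero_apply] at h2
  simpa using (smul_eq_zero.1 h2.symm).resolve_right (he.ne_zero n)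

theorem IsMinusLabelling.isHalfLabelling {E : ℕ → ℝ → ℝ} (h : IsMinusLabelling E) :
    IsHalfLabelling 1 E := fun θ hθ => by
  refine ⟨(isMinusLabelling_iff.1 h).1 θ (Ioc_pi_div_two_subset hθ), ?_⟩
  rcases hθ.2.lt_or_eq with h1 | rfl
  · exact (isMinusLabelling_iff.1 h).2.1 θ ⟨hθ.1, h1⟩
  · simp only [h.apply_pi_div_two]
    exact antitone_const

theorem IsMinusLabelling.neg_comp_pi_sub {E : ℕ → ℝ → ℝ} (h : IsMinusLabelling E) :
    IsMinusLabelling fun n θ => -E n (Real.pi - θ) := by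
  rw [isMinusLabelling_iff] at h ⊢
  refine ⟨fun θ hθ => ?_, fun θ hθ => ?_, fun θ hθ => ?_⟩
  · have h1 := (h.1 _ (pi_sub_mem_Ioo hθ)).neg
    rwa [parityThetaOp_one_pi_sub hθ, neg_neg] at h1
  · exact (h.2.2 (Real.pi - θ) ⟨by linarith [hθ.2], by linarith [hθ.1]⟩).neg
  · exact (h.2.1 (Real.pi - θ) ⟨by linarith [hθ.2], by linarith [hθ.1]⟩).neg

theorem exists_isMinusLabelling : ∃ E : ℕ → ℝ → ℝ, IsMinusLabelling E := by
  have h : ∀ θ : ℝ, ∃ E : ℕ → ℝ, θ ∈ Set.Ioo 0 Real.pi →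
      IsEigenvalueSequence (parityThetaOp 1 θ) (parityProj 1).range E ∧
      (θ < Real.pi / 2 → Antitone E) ∧ (Real.pi / 2 < θ → Monotone E) := by
    intro θ
    by_cases hθ : θ ∈ Set.Ioo 0 Real.pi
    · rcases lt_trichotomy θ (Real.pi / 2) with h1 | rfl | h1
      · obtain ⟨E, hE, ha⟩ := exists_isEigenvalueSequence_parityThetaOp (p := 1) ⟨hθ.1, h1.le⟩
          (Or.inr h1)
        exact ⟨E, fun _ => ⟨hE, fun _ => ha, fun h2 => absurd h1 h2.not_gt⟩⟩
      -- For the zero operator any orthonormal basis of the odd functions will do; one is borrowed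
      -- from `θ = π/4`.
      · obtain ⟨E, ⟨e, he, hV, -⟩, -⟩ := exists_isEigenvalueSequence_parityThetaOp (p := 1)
          (θ := Real.pi / 4) ⟨by positivity, by linarith [Real.pi_pos]⟩
          (Or.inr (by linarith [Real.pi_pos]))
        refine ⟨0, fun _ => ⟨⟨e, he, hV, fun n => ?_⟩, fun h2 => absurd h2 (lt_irrefl _),
          fun h2 => absurd h2 (lt_irrefl _)⟩⟩
        rw [parityThetaOp_one_pi_div_two]
        simp
      · have h2 : Real.pi - θ < Real.pi / 2 := by linarith
        obtain ⟨E, hE, ha⟩ := exists_isEigenvalueSequence_parityThetaOp (p := 1)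
          (pi_sub_mem_Ioc ⟨h1.le, hθ.2⟩) (Or.inr h2)
        have hE' := hE.neg
        rw [parityThetaOp_one_pi_sub hθ, neg_neg] at hE'
        exact ⟨_, fun _ => ⟨hE', fun h3 => absurd h1 h3.not_gt, fun _ => ha.neg⟩⟩
    · exact ⟨0, fun h => absurd h hθ⟩
  choose E hE using h
  refine ⟨fun n θ => E θ n, isMinusLabelling_iff.2 ⟨fun θ hθ => (hE θ hθ).1, fun θ hθ => ?_,
    fun θ hθ => ?_⟩⟩
  · exact (hE θ ⟨hθ.1, by linarith [hθ.1, hθ.2]⟩).2.1 hθ.2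
  · exact (hE θ ⟨by linarith [hθ.1, Real.pi_pos], hθ.2⟩).2.2 hθ.1

/-- Reflection combined with negation preserves labellings. The two strictly decreasing pieces share
the point `π/2`, so they glue to a strictly decreasing function. -/
theorem IsMinusLabelling.regularity {E : ℕ → ℝ → ℝ} (h : IsMinusLabelling E) (n : ℕ) :
    ContinuousOn (E n) (Set.Ioo 0 Real.pi) ∧ StrictAntiOn (E n) (Set.Ioo 0 Real.pi) := by
  have h1 := h.isHalfLabelling
  have h2 := h.neg_comp_pi_sub.isHalfLabelling
  have h3 := (h2.continuousOn n).comp_pi_sub.neg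
  have h4 := (h2.strictAntiOn n).comp_pi_sub.neg
  simp only [sub_sub_cancel, Pi.neg_def, neg_neg] at h3 h4
  refine ⟨continuousOn_Ioo_pi (h1.continuousOn n) h3, ?_⟩
  rw [← Ioc_union_Ico_pi]
  exact (h1.strictAntiOn n).union h4 (isGreatest_Ioc (by positivity))
    (isLeast_Ico (by linarith [Real.pi_pos]))

end Labellings

end

theorem mainTheorem4 :
    -- the operators are well defined and form a selfadjoint analytic trace-class family
    (∀ θ ∈ thetaDomain, HasKernel (thetaOp θ) (thetaKernel θ)) ∧
    IsSelfAdjointTraceClassAnalyticFamily thetaOp thetaDomain ∧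
    -- the eigenvalues of the even part
    (∃ E : ℕ → ℝ → ℝ, IsPlusLabelling E) ∧
    (∀ E : ℕ → ℝ → ℝ, IsPlusLabelling E → ∀ n : ℕ,
      ContinuousOn (E n) (Set.Ioo 0 Real.pi) ∧
      StrictAntiOn (E n) (Set.Ioc 0 (Real.pi / 2)) ∧
      StrictMonoOn (E n) (Set.Ico (Real.pi / 2) Real.pi)) ∧
    -- the eigenvalues of the odd part
    (∃ E : ℕ → ℝ → ℝ, IsMinusLabelling E) ∧
    (∀ E : ℕ → ℝ → ℝ, IsMinusLabelling E → ∀ n : ℕ,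
      ContinuousOn (E n) (Set.Ioo 0 Real.pi) ∧
      StrictAntiOn (E n) (Set.Ioo 0 Real.pi)) :=
  ⟨fun _ hθ => hasKernel_thetaOp hθ, isSelfAdjointTraceClassAnalyticFamily_thetaOp,
    exists_isPlusLabelling, fun _ hE => hE.regularity,
    exists_isMinusLabelling, fun _ hE => hE.regularity⟩
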